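/- **Setting.** Let $\mathbb H=\{z=x+iy: y>0\}$ with the hyperbolic metric $|dz|/y$, arclength $ds$, distance $d$, area $d\mu=y^{-2}\,dx\,dy$ and Laplacian $\Delta=-y^2(\partial_x^2+\partial_y^2)$. An eigenfunction with eigenvalue $\lambda>0$ on a closed region is a real- or complex-valued function $\psi$ that is $C^2$ up to the boundary and satisfies $\Delta\psi=\lambda\psi$ in the interior. Along a curve, $\partial_n\psi$ is the derivative of $\psi$ in the direction of the hyperbolic unit normal (taken from inside the region if the curve is its boundary). **Theorem 1.2.** (1) (Hyperbolic circles.) Let $w\in\mathbb H$, $R>0$, $\lambda>0$, let $B_R=\{z\in\mathbb H: d(z,w)\le R\}$ and let $\mathcal C_R$ be the hyperbolic circle bounding $B_R$. For every eigenfunction $\psi$ with eigenvalue $\lambda$ on $B_R$, $$\int_{\mathcal C_R}|\psi|^2\,ds+\frac1\lambda\int_{\mathcal C_R}|\partial_n\psi|^2\,ds\;\ge\;\frac{2}{\sinh R}\iint_{B_R}\cosh(r)\,|\psi|^2\,d\mu,\qquad r=d(z,w),$$ where the integral on the right converges. (2) (Closed horocycles.) Let $A>0$. A *cusp eigenfunction*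 with eigenvalue $\lambda$ is an eigenfunction $\psi$ on $\{y\ge A\}$ with $\psi(z+1)=\psi(z)$ whose square is integrable over $\{-\tfrac12<x\le\tfrac12,\ y\ge A\}$ with respect to $\mu$. For $Y\ge A$ let $\mathcal C_Y=\{x+iY:-\tfrac12<x\le\tfrac12\}$ and $\mathcal R_Y=\{-\tfrac12<x\le\tfrac12,\ y\ge Y\}$. For every $\lambda>0$, every cusp eigenfunction $\psi$ with eigenvalue $\lambda$, and every $Y\ge A$, $$\int_{\mathcal C_Y}|\psi|^2\,ds+\frac1\lambda\int_{\mathcal C_Y}|\partial_n\psi|^2\,ds\;\ge\;2Y\iint_{\mathcal R_Y}|\psi|^2\,y^{-1}\,d\mu,$$ where the integral on the right converges. (3) (Sharpness of the weight in (2).) Let $A>0$ and let $\alpha,G:[A,\infty)\to(0,\infty)$ be smooth functions with $\alpha(Y)G(y)\ge Y/y$ whenever $y\ge Y\ge A$. Suppose that for every $Y\ge A$, every $\lambda>0$ and every cusp eigenfunction $\psi$ with eigenvalue $\lambda$ that tends to $0$ as $y\to\infty$, uniformly in $x$, $$\int_{\mathcal C_Y}|\psi|^2\,ds+\frac1\lambda\int_{\mathcal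 C_Y}|\partial_n\psi|^2\,ds\;\ge\;2\alpha(Y)\iint_{\mathcal R_Y}|\psi|^2\,G(y)\,d\mu,$$ with a convergent integral on the right. Then $\alpha(Y)G(y)=Y/y$ for all $y\ge Y\ge A$. This holds both when only real-valued and when complex-valued $\psi$ are considered. -/

import Mathlib

open MeasureTheory UpperHalfPlane
open scoped ContDiff

noncomputable section

namespace HypRestriction

variable {𝕜 : Type*} [RCLike 𝕜]

/-- A function on the upper half-plane, read in the coordinate `z = x + i y`
(only its values at points with `y > 0` matter). -/
def inCoord (ψ : ℍ → 𝕜) : ℂ → 𝕜 := fun z => ψ (ofComplex z)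

/-- The (positive) hyperbolic Laplacian `Δ = -y² (∂²/∂x² + ∂²/∂y²)`. -/
def hypLaplacian (ψ : ℍ → 𝕜) (z : ℍ) : 𝕜 :=
  -((z.im ^ 2) • Laplacian.laplacian (inCoord ψ) (z : ℂ))

/-- `ψ` is an eigenfunction of the hyperbolic Laplacian with eigenvalue `lam` on the closed
region `S`: it is `C²` up to the boundary of `S`, and `Δ ψ = lam ψ` in the interior. -/
structure IsEigenfunctionOn (S : Set ℍ) (lam : ℝ) (ψ : ℍ → 𝕜) : Prop where
  contDiffOn : ContDiffOn ℝ 2 (inCoord ψ) (UpperHalfPlane.coe '' S)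
  eigen : ∀ z ∈ interior S, hypLaplacian ψ z = lam • ψ z

/-- The Euclidean velocity of a parametrized curve in the upper half-plane. -/
def velocity (γ : ℝ → ℍ) (t : ℝ) : ℂ := deriv (fun s => (γ s : ℂ)) t

/-- The integral of `f` over the curve `γ`, `a ≤ t ≤ b`, with respect to hyperbolic arclength
`ds = |dz| / y`; here `f` is a function of the parameter of the curve. -/
def arclengthIntegral (γ : ℝ → ℍ) (a b : ℝ) (f : ℝ → ℝ) : ℝ :=
  ∫ t in a..b, f t * (‖velocity γ t‖ / (γ t).im)

/-- The unit normal, for the hyperbolic metric, to the curve `γ`: the unit tangent rotated by a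
right angle, and of Euclidean length `y`. -/
def unitNormal (γ : ℝ → ℍ) (t : ℝ) : ℂ :=
  ((γ t).im : ℂ) * (Complex.I * (velocity γ t / (‖velocity γ t‖ : ℂ)))

/-- The hyperbolic unit normal derivative `∂ₙψ` along a curve `γ` in the closed region `S`
(the derivative taken from within `S` at points where `γ` runs in the boundary of `S`). -/
def normalDeriv (S : Set ℍ) (ψ : ℍ → 𝕜) (γ : ℝ → ℍ) (t : ℝ) : 𝕜 :=
  fderivWithin ℝ (inCoord ψ) (UpperHalfPlane.coe '' S) (γ t : ℂ) (unitNormal γ t)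

/-- The restricted norm `∫_C |ψ|² ds + lam⁻¹ ∫_C |∂ₙψ|² ds`, for the curve `C` given by
`γ` on `a ≤ t ≤ b`. -/
def restrictedNorm (S : Set ℍ) (lam : ℝ) (ψ : ℍ → 𝕜) (γ : ℝ → ℍ) (a b : ℝ) : ℝ :=
  arclengthIntegral γ a b (fun t => ‖ψ (γ t)‖ ^ 2) +
    lam⁻¹ * arclengthIntegral γ a b (fun t => ‖normalDeriv S ψ γ t‖ ^ 2)

/-! ### Hyperbolic circles -/

theorem polar_pos (r θ : ℝ) : 0 < Real.cosh r + Real.sinh r * Real.cos θ := by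
  have h1 := Real.cosh_sq r
  have h2 := Real.cosh_pos r
  have h3 := Real.neg_one_le_cos θ
  have h4 := Real.cos_le_one θ
  have h5 : |Real.sinh r * Real.cos θ| < Real.cosh r := by
    apply abs_lt_of_sq_lt_sq _ h2.le
    nlinarith [sq_nonneg (Real.sinh r), sq_nonneg (Real.cos θ),
      mul_nonneg (sq_nonneg (Real.sinh r)) (by nlinarith : (0 : ℝ) ≤ 1 - Real.cos θ ^ 2)]
  linarith [(abs_lt.mp h5).1]

/-- The point with geodesic polar coordinates `(r, θ)` about `w`. For `w = i` it is
`x + i y` with `x = sinh r sin θ / (cosh r + sinh r cos θ)`, `y = 1 / (cosh r + sinh r cos θ)`;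
the general case is its image under the isometry `z ↦ re w + (im w) z`, which takes `i` to `w`. -/
def polar (w : ℍ) (r θ : ℝ) : ℍ :=
  ⟨⟨w.re + w.im * (Real.sinh r * Real.sin θ / (Real.cosh r + Real.sinh r * Real.cos θ)),
    w.im * (1 / (Real.cosh r + Real.sinh r * Real.cos θ))⟩,
    mul_pos w.im_pos (one_div_pos.mpr (polar_pos r θ))⟩

/-- `polar w R θ` lies on the hyperbolic circle of radius `R` about `w`. -/
theorem dist_polar (w : ℍ) {R : ℝ} (hR : 0 ≤ R) (θ : ℝ) : dist (polar w R θ) w = R := by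
  have hp := polar_pos R θ
  have hw := w.im_pos
  have h := UpperHalfPlane.cosh_dist' (polar w R θ) w
  have h1 : (polar w R θ).re =
      w.re + w.im * (Real.sinh R * Real.sin θ / (Real.cosh R + Real.sinh R * Real.cos θ)) := rfl
  have h2 : (polar w R θ).im = w.im * (1 / (Real.cosh R + Real.sinh R * Real.cos θ)) := rfl
  have h3 : Real.cosh (dist (polar w R θ) w) = Real.cosh R := by
    rw [h, h1, h2]
    field_simp
    have e1 := Real.cosh_sq R
    have e2 := Real.sin_sq_add_cos_sq θ
    linear_combination (w.im ^ 2 * Real.sinh R ^ 2) * e2 - w.im ^ 2 * e1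
  rwa [← Real.cosh_abs, ← Real.cosh_abs R, Real.cosh_strictMonoOn.injOn.eq_iff
    (Set.mem_Ici.mpr (abs_nonneg _)) (Set.mem_Ici.mpr (abs_nonneg _)),
    abs_of_nonneg dist_nonneg, abs_of_nonneg hR] at h3

/-! ### Cusps and closed horocycles -/

/-- The closed region `y ≥ A`; its quotient by `z ↦ z + 1` is the cuspidal cylinder. -/
def cuspRegion (A : ℝ) : Set ℍ := {z | A ≤ z.im}

/-- The fundamental domain `-1/2 < x ≤ 1/2`, `y ≥ A` of the cuspidal cylinder. -/
def cuspStrip (A : ℝ) : Set ℍ := {z | -(1 / 2) < z.re ∧ z.re ≤ 1 / 2 ∧ A ≤ z.im}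

/-- The horocycle at height `Y`, `x ↦ x + i Y`; on `-1/2 ≤ x ≤ 1/2` it is the closed horocycle
of the cylinder. -/
def horocycle (Y : ℝ) (hY : 0 < Y) (x : ℝ) : ℍ := ⟨⟨x, Y⟩, hY⟩

/-- `ψ` is a square-integrable eigenfunction, with eigenvalue `lam`, on the cuspidal cylinder
`y ≥ A` (that is: of period `1` in `x`). -/
structure IsCuspEigenfunction (A lam : ℝ) (ψ : ℍ → 𝕜) : Prop where
  eigenfunction : IsEigenfunctionOn (cuspRegion A) lam ψ
  periodic : ∀ z ∈ cuspRegion A, ψ ((1 : ℝ) +ᵥ z) = ψ z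
  memLp : MemLp ψ 2 (volume.restrict (cuspStrip A))

end HypRestriction

end

/-! Both inequalities come from one Rellich identity. In coordinates `(s, θ)` where the metric is
`q/p² ds² + q dθ²`, with `p`, `q` functions of `s`, the eigenvalue equation reads `p (p ψ_s)_s +
ψ_θθ = -λ q ψ`. Pairing it with `2 ψ_s` gives `∂_s (p²|ψ_s|² + λ q|ψ|² - |ψ_θ|²) + ∂_θ (2⟨ψ_s, ψ_θ⟩)
= λ q' |ψ|²`. Integration over a rectangle that closes up in `θ` (`IsCoordRectangle.rellich`)
expresses the weighted mass inside through the two ends in `s`.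

For circles, geodesic polar coordinates have `p = sinh r`, `q = sinh² r`. The end `r = 0`
contributes nothing, and `q' dr dθ` is `2 cosh r dμ`. Discarding the tangential term `-|ψ_θ|²` at `r
= R` leaves the inequality. For horocycles, `s = y` and `q = y⁻²`, so `-q' dy dx = 2 y⁻¹ dμ`. Now
the tangential energy at the far end `y = T` has the wrong sign, but square integrability makes it
arbitrarily small at arbitrarily large heights (`exists_tangential_energy_lt`). No vanishing at the
cusp is needed.

For sharpness the test functions are `u(y) cos (2πx)`, with `u = √y K_{it}(2πy)` up to a constant
and `λ = 1/4 + t²`. With `k = 2π`, the energy `H = u'² + (λ/y² - k²) u²` satisfies `H' = -2λ u²/y³`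
and tends to `0`, so the mass with the optimal weight is exactly `H(Y)`. The restricted norm exceeds
it only by a multiple of `k² u(Y)²`, of relative size `1/λ`. A weight that is too large by `c` on an
interval `[a, b]` costs about `c λ ∫ u²/y²`, and equipartition of energy (`IsDecayingMode.mass_ge`)
bounds this below by a fixed fraction of `H`. For large `λ` this is a contradiction
(`exists_eigenvalue_bound`). -/

noncomputable section

namespace HypRestriction

/-! ### Hyperbolic area in plane coordinates and change of variables -/

section Parametrization

open Set

/-- Real and imaginary part, as a map to the plane. -/
def toPlane (z : ℍ) : ℝ × ℝ := (z.re, z.im)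

theorem toPlane_eq : toPlane = Complex.measurableEquivRealProd ∘ UpperHalfPlane.coe := by
  funext z; rfl

theorem measurableEmbedding_toPlane : MeasurableEmbedding toPlane := by
  rw [toPlane_eq]
  exact Complex.measurableEquivRealProd.measurableEmbedding.comp measurableEmbedding_coe

theorem measurePreserving_toPlane :
    MeasurePreserving toPlane ((volume : Measure ℂ).comap UpperHalfPlane.coe)
      ((volume : Measure (ℝ × ℝ)).restrict (range toPlane)) := by
  have h1 : MeasurePreserving UpperHalfPlane.coe ((volume : Measure ℂ).comap UpperHalfPlane.coe)
      (volume.restrict (range UpperHalfPlane.coe)) :=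
    ⟨measurable_coe, by rw [measurableEmbedding_coe.map_comap]⟩
  have h2 := Complex.volume_preserving_equiv_real_prod.restrict_image_emb
    Complex.measurableEquivRealProd.measurableEmbedding (range UpperHalfPlane.coe)
  have h3 := h2.comp h1
  rw [← range_comp] at h3
  rwa [toPlane_eq]

/-- The hyperbolic density, as a function with values in the nonnegative reals. -/
theorem measurable_density :
    Measurable fun z : ℍ ↦ ((1 / NNReal.mk z.im z.im_pos.le : NNReal) ^ 2) := by
  have : Continuous fun z : ℍ ↦ ((1 / NNReal.mk z.im z.im_pos.le : NNReal) ^ 2) := by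
    refine .pow (.div₀ continuous_const ?_ ?_) _
    · exact continuous_im.subtype_mk _
    · exact fun x ↦ NNReal.ne_iff.mp x.im_ne_zero
  exact this.measurable

/-- The hyperbolic measure is Lebesgue measure with density `y⁻²`, and `toPlane` is a
measure-preserving embedding for the Lebesgue part. -/
theorem setIntegral_eq_plane {S : Set ℍ} (hS : MeasurableSet S) (f : ℍ → ℝ) (g : ℝ × ℝ → ℝ)
    (hg : ∀ z ∈ S, g (toPlane z) = (z.im ^ 2)⁻¹ * f z) :
    (∫ z in S, f z = ∫ p in toPlane '' S, g p) ∧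
      (IntegrableOn f S ↔ IntegrableOn g (toPlane '' S)) := by
  have hsub : (volume.restrict (range toPlane)).restrict (toPlane '' S) =
      (volume : Measure (ℝ × ℝ)).restrict (toPlane '' S) := by
    rw [Measure.restrict_restrict_of_subset (image_subset_range _ _)]
  have hd : ∀ z : ℍ, ((1 / NNReal.mk z.im z.im_pos.le : NNReal) ^ 2) • f z
      = (z.im ^ 2)⁻¹ * f z := by
    intro z
    rw [NNReal.smul_def]
    simp
  constructor
  · rw [volume_def, setIntegral_withDensity_eq_setIntegral_smul measurable_density _ hS, ← hsub,
      measurePreserving_toPlane.setIntegral_image_emb measurableEmbedding_toPlane]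
    refine setIntegral_congr_fun hS fun z hz ↦ ?_
    simp only [hd, hg z hz]
  · rw [IntegrableOn, volume_def, restrict_withDensity hS,
      integrable_withDensity_iff_integrable_smul measurable_density, ← IntegrableOn]
    have hr : IntegrableOn g (toPlane '' S) ↔
        IntegrableOn g (toPlane '' S) (volume.restrict (range toPlane)) := by
      rw [IntegrableOn, IntegrableOn, hsub]
    rw [hr, measurePreserving_toPlane.integrableOn_image measurableEmbedding_toPlane]
    refine integrableOn_congr_fun (fun z hz ↦ ?_) hS
    simp only [hd, Function.comp, hg z hz]

/-- Change of variables for a parametrization of a subset of the upper half-plane. -/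
theorem setIntegral_image_param {P : ℝ × ℝ → ℍ} {S : Set (ℝ × ℝ)} (hS : MeasurableSet S)
    {Q' : ℝ × ℝ → (ℝ × ℝ →L[ℝ] ℝ × ℝ)}
    (hQ : ∀ p ∈ S, HasFDerivAt (fun p ↦ ((P p).re, (P p).im)) (Q' p) p) (hinj : InjOn P S)
    {J : ℝ × ℝ → ℝ} (hJ : ∀ p ∈ S, |(Q' p).det| = J p * (P p).im ^ 2) (f : ℍ → ℝ) :
    MeasurableSet (P '' S) ∧ (∫ z in P '' S, f z = ∫ p in S, J p * f (P p)) ∧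
      (IntegrableOn f (P '' S) ↔ IntegrableOn (fun p ↦ J p * f (P p)) S) := by
  have hinj' : InjOn (fun p ↦ ((P p).re, (P p).im)) S := fun p hp p' hp' h ↦
    hinj hp hp' (measurableEmbedding_toPlane.injective h)
  have himg : toPlane '' (P '' S) = (fun p ↦ ((P p).re, (P p).im)) '' S := by
    rw [image_image]; rfl
  have hmeas : MeasurableSet (P '' S) := by
    rw [← measurableEmbedding_toPlane.measurableSet_image, himg]
    exact measurable_image_of_fderivWithin hS (fun p hp ↦ (hQ p hp).hasFDerivWithinAt) hinj'
  let g : ℝ × ℝ → ℝ := fun p ↦ (p.2 ^ 2)⁻¹ * f (ofComplex ⟨p.1, p.2⟩)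
  have hg : ∀ z : ℍ, g (toPlane z) = (z.im ^ 2)⁻¹ * f z := fun z ↦ by
    have : ofComplex ⟨z.re, z.im⟩ = z := ofComplex_apply z
    simp only [g, toPlane, this]
  obtain ⟨h1, h2⟩ := setIntegral_eq_plane hmeas f g fun z _ ↦ hg z
  have hcongr : ∀ p ∈ S, |(Q' p).det| • g ((P p).re, (P p).im) = J p * f (P p) := by
    intro p hp
    have := hg (P p)
    simp only [toPlane] at this
    have hne := (P p).im_ne_zero
    rw [this, hJ p hp, smul_eq_mul]
    field_simp
  refine ⟨hmeas, ?_, ?_⟩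
  · rw [h1, himg, integral_image_eq_integral_abs_det_fderiv_smul volume hS
      (fun p hp ↦ (hQ p hp).hasFDerivWithinAt) hinj']
    exact setIntegral_congr_fun hS hcongr
  · rw [h2, himg, integrableOn_image_iff_integrableOn_abs_det_fderiv_smul volume hS
      (fun p hp ↦ (hQ p hp).hasFDerivWithinAt) hinj']
    exact integrableOn_congr_fun hcongr hS

end Parametrization

/-! ### First and second derivatives in the interior of a closed region -/

section Jets

variable {F : Type*} [NormedAddCommGroup F] [NormedSpace ℝ F]

theorem hasFDerivAt_fderivWithin_of_interior {φ : ℂ → F} {K : Set ℂ} (h : ContDiffOn ℝ 2 φ K)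
    {z : ℂ} (hz : z ∈ interior K) : HasFDerivAt φ (fderivWithin ℝ φ K z) z := by
  have hK := mem_interior_iff_mem_nhds.mp hz
  rw [fderivWithin_of_mem_nhds hK]
  exact ((h.contDiffAt hK).differentiableAt (by norm_num)).hasFDerivAt

/-- `fderivWithin` is used throughout because it makes sense up to the boundary; near an interior
point it coincides with `fderiv` and so inherits its derivative. -/
theorem hasFDerivAt_fderiv_of_interior {φ : ℂ → F} {K : Set ℂ} (h : ContDiffOn ℝ 2 φ K)
    {z : ℂ} (hz : z ∈ interior K) :
    HasFDerivAt (fderivWithin ℝ φ K) (fderiv ℝ (fderiv ℝ φ) z) z := by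
  have hK := mem_interior_iff_mem_nhds.mp hz
  have h1 : HasFDerivAt (fderiv ℝ φ) (fderiv ℝ (fderiv ℝ φ) z) z :=
    (((h.contDiffAt hK).fderiv_right (m := 1) (by norm_num)).differentiableAt
      (by norm_num)).hasFDerivAt
  refine h1.congr_of_eventuallyEq ?_
  filter_upwards [isOpen_interior.mem_nhds hz] with y hy
  exact fderivWithin_of_mem_nhds (mem_interior_iff_mem_nhds.mp hy)

theorem fderiv_fderiv_symm {φ : ℂ → F} {K : Set ℂ} (h : ContDiffOn ℝ 2 φ K)
    {z : ℂ} (hz : z ∈ interior K) (v w : ℂ) :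
    fderiv ℝ (fderiv ℝ φ) z v w = fderiv ℝ (fderiv ℝ φ) z w v :=
  ((h.contDiffAt (mem_interior_iff_mem_nhds.mp hz)).isSymmSndFDerivAt (by simp)).eq v w

theorem laplacian_eq_fderiv_fderiv (φ : ℂ → F) (z : ℂ) :
    Laplacian.laplacian φ z =
      fderiv ℝ (fderiv ℝ φ) z 1 1 + fderiv ℝ (fderiv ℝ φ) z Complex.I Complex.I := by
  rw [InnerProductSpace.laplacian_eq_iteratedFDeriv_complexPlane]
  simp [iteratedFDeriv_two_apply]

/-- The Laplacian in an arbitrary orthogonal frame `v, i v`. -/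
theorem fderiv_fderiv_add_rotate {φ : ℂ → F} {K : Set ℂ} (h : ContDiffOn ℝ 2 φ K)
    {z : ℂ} (hz : z ∈ interior K) (v : ℂ) :
    fderiv ℝ (fderiv ℝ φ) z v v + fderiv ℝ (fderiv ℝ φ) z (Complex.I * v) (Complex.I * v) =
      (‖v‖ ^ 2) • Laplacian.laplacian φ z := by
  have hs := fderiv_fderiv_symm h hz 1 Complex.I
  rw [laplacian_eq_fderiv_fderiv]
  have e1 : v = v.re • (1 : ℂ) + v.im • Complex.I := by
    simp [Complex.re_add_im]
  have e2 : Complex.I * v = (-v.im) • (1 : ℂ) + v.re • Complex.I := by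
    apply Complex.ext <;> simp
  have e3 : ‖v‖ ^ 2 = v.re ^ 2 + v.im ^ 2 := by
    rw [Complex.sq_norm, Complex.normSq_apply]; ring
  rw [e3, e2]
  generalize v.re = a at *
  generalize v.im = b at *
  subst e1
  simp only [map_add, map_smul, add_apply, smul_apply, hs]
  module

end Jets

/-! ### The divergence theorem and the Rellich identity on a rectangle -/

section Divergence

open Set

/-- Periodicity cancels the two sides `θ = c` and `θ = d`, so only the ends in `s` survive. The
divergence is supplied as a function `h` continuous on the closed rectangle, which gives
integrability although derivatives exist only inside. -/
theorem integral_divergence_of_periodic {f g h : ℝ × ℝ → ℝ} {f' g' : ℝ × ℝ → ℝ × ℝ →L[ℝ] ℝ}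
    {a b c d : ℝ} (hab : a ≤ b) (hcd : c ≤ d)
    (hf : ContinuousOn f (Icc a b ×ˢ Icc c d)) (hg : ContinuousOn g (Icc a b ×ˢ Icc c d))
    (hh : ContinuousOn h (Icc a b ×ˢ Icc c d))
    (hf' : ∀ x ∈ Ioo a b ×ˢ Ioo c d, HasFDerivAt f (f' x) x)
    (hg' : ∀ x ∈ Ioo a b ×ˢ Ioo c d, HasFDerivAt g (g' x) x)
    (hdiv : ∀ x ∈ Ioo a b ×ˢ Ioo c d, f' x (1, 0) + g' x (0, 1) = h x)
    (hper : ∀ s ∈ Icc a b, g (s, d) = g (s, c)) :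
    ∫ x in Icc a b ×ˢ Icc c d, h x = (∫ y in c..d, f (b, y)) - ∫ y in c..d, f (a, y) := by
  classical
  let S : Set (ℝ × ℝ) := Ioo a b ×ˢ Ioo c d
  -- On the boundary the derivatives are replaced by dummies whose divergence is still `h`, so that
  -- the divergence equals `h` everywhere.
  let f'' : ℝ × ℝ → ℝ × ℝ →L[ℝ] ℝ := fun x ↦
    if x ∈ S then f' x else h x • ContinuousLinearMap.fst ℝ ℝ ℝ
  let g'' : ℝ × ℝ → ℝ × ℝ →L[ℝ] ℝ := fun x ↦ if x ∈ S then g' x else 0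
  have hsum : (fun x ↦ f'' x (1, 0) + g'' x (0, 1)) = h := by
    funext x
    by_cases hx : x ∈ S
    · simp only [f'', g'', hx, if_true]; exact hdiv x hx
    · simp [f'', g'', hx]
  have hI : Icc (a, c) (b, d) = Icc a b ×ˢ Icc c d := Icc_prod_eq _ _
  have key := integral_divergence_prod_Icc_of_hasFDerivAt_of_le f g f'' g'' (a, c) (b, d)
    ⟨hab, hcd⟩ (by rwa [hI]) (by rwa [hI])
    (fun x hx ↦ by
      have : x ∈ S := hx
      simp only [f'', this, if_true]; exact hf' x hx)
    (fun x hx ↦ by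
      have : x ∈ S := hx
      simp only [g'', this, if_true]; exact hg' x hx)
    (by
      rw [hsum, hI]
      exact hh.integrableOn_compact (isCompact_Icc.prod isCompact_Icc))
  have hsum' : ∀ x, f'' x (1, 0) + g'' x (0, 1) = h x := fun x ↦ congrFun hsum x
  simp only [hsum', hI] at key
  rw [key]
  have : (∫ x in a..b, g (x, d)) = ∫ x in a..b, g (x, c) :=
    intervalIntegral.integral_congr fun x hx ↦ hper x (by rwa [uIcc_of_le hab] at hx)
  rw [this]; ring

variable {F : Type*} [NormedAddCommGroup F] [InnerProductSpace ℝ F]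

/-- The Rellich identity on a rectangle for an equation `p (p U_s)_s + U_θθ = -lam q U`. Here `X`
and `W` stand for `U_s` and `U_θ`. -/
theorem rellich_rectangle {a b c d lam : ℝ} (hab : a ≤ b) (hcd : c ≤ d) {p p' q q' : ℝ → ℝ}
    (hp : ∀ s ∈ Icc a b, HasDerivAt p (p' s) s) (hq : ∀ s ∈ Icc a b, HasDerivAt q (q' s) s)
    (hq' : ContinuousOn q' (Icc a b)) {U X W : ℝ × ℝ → F} {U' X' W' : ℝ × ℝ → ℝ × ℝ →L[ℝ] F}
    (hU : ContinuousOn U (Icc a b ×ˢ Icc c d)) (hX : ContinuousOn X (Icc a b ×ˢ Icc c d))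
    (hW : ContinuousOn W (Icc a b ×ˢ Icc c d))
    (hU' : ∀ x ∈ Ioo a b ×ˢ Ioo c d, HasFDerivAt U (U' x) x)
    (hX' : ∀ x ∈ Ioo a b ×ˢ Ioo c d, HasFDerivAt X (X' x) x)
    (hW' : ∀ x ∈ Ioo a b ×ˢ Ioo c d, HasFDerivAt W (W' x) x)
    (hUX : ∀ x ∈ Ioo a b ×ˢ Ioo c d, U' x (1, 0) = X x)
    (hXW : ∀ x ∈ Ioo a b ×ˢ Ioo c d, X' x (0, 1) = W' x (1, 0))
    (heq : ∀ x ∈ Ioo a b ×ˢ Ioo c d,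
      (p x.1 ^ 2) • X' x (1, 0) + (p x.1 * p' x.1) • X x + W' x (0, 1) = -((lam * q x.1) • U x))
    (hXper : ∀ s ∈ Icc a b, X (s, d) = X (s, c)) (hWper : ∀ s ∈ Icc a b, W (s, d) = W (s, c)) :
    ∫ x in Icc a b ×ˢ Icc c d, lam * q' x.1 * ‖U x‖ ^ 2 =
      (∫ y in c..d, (p b ^ 2 * ‖X (b, y)‖ ^ 2 + lam * q b * ‖U (b, y)‖ ^ 2 - ‖W (b, y)‖ ^ 2)) -
        ∫ y in c..d, (p a ^ 2 * ‖X (a, y)‖ ^ 2 + lam * q a * ‖U (a, y)‖ ^ 2 - ‖W (a, y)‖ ^ 2) := by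
  have hp1 : ∀ x ∈ Icc a b ×ˢ Icc c d, HasFDerivAt (fun x : ℝ × ℝ ↦ p x.1)
      (p' x.1 • ContinuousLinearMap.fst ℝ ℝ ℝ) x := fun x hx ↦
    (hp x.1 hx.1).comp_hasFDerivAt x hasFDerivAt_fst
  have hq1 : ∀ x ∈ Icc a b ×ˢ Icc c d, HasFDerivAt (fun x : ℝ × ℝ ↦ q x.1)
      (q' x.1 • ContinuousLinearMap.fst ℝ ℝ ℝ) x := fun x hx ↦
    (hq x.1 hx.1).comp_hasFDerivAt x hasFDerivAt_fst
  have hpc : ContinuousOn (fun x : ℝ × ℝ ↦ p x.1) (Icc a b ×ˢ Icc c d) := fun x hx ↦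
    (hp1 x hx).continuousAt.continuousWithinAt
  have hqc : ContinuousOn (fun x : ℝ × ℝ ↦ q x.1) (Icc a b ×ˢ Icc c d) := fun x hx ↦
    (hq1 x hx).continuousAt.continuousWithinAt
  have hq'c : ContinuousOn (fun x : ℝ × ℝ ↦ q' x.1) (Icc a b ×ˢ Icc c d) :=
    hq'.comp continuousOn_fst fun x hx ↦ hx.1
  have hsub : Ioo a b ×ˢ Ioo c d ⊆ Icc a b ×ˢ Icc c d :=
    prod_mono Ioo_subset_Icc_self Ioo_subset_Icc_self
  refine integral_divergence_of_periodic (c := c) (d := d)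
    (f := fun x ↦ p x.1 ^ 2 * ‖X x‖ ^ 2 + lam * q x.1 * ‖U x‖ ^ 2 - ‖W x‖ ^ 2)
    (g := fun x ↦ 2 * inner ℝ (X x) (W x)) hab hcd
    ((((hpc.pow 2).mul (hX.norm.pow 2)).add ((hqc.const_mul lam).mul (hU.norm.pow 2))).sub
      (hW.norm.pow 2)) ((hX.inner hW).const_mul 2)
    ((hq'c.const_mul lam).mul (hU.norm.pow 2))
    (fun x hx ↦ ((((hp1 x (hsub hx)).pow 2).mul (hX' x hx).norm_sq).add
      (((hq1 x (hsub hx)).const_mul lam).mul (hU' x hx).norm_sq)).sub (hW' x hx).norm_sq)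
    (fun x hx ↦ ((hX' x hx).inner ℝ (hW' x hx)).const_mul 2) ?_ ?_
  · intro x hx
    have h1 := hUX x hx
    have h2 := hXW x hx
    -- The equation is paired with `U_s`; twice the result is exactly the Rellich identity.
    have h3 := congrArg (fun v ↦ inner ℝ (X x) v) (heq x hx)
    simp only [inner_add_right, inner_smul_right, inner_neg_right, real_inner_self_eq_norm_sq] at h3
    simp [h1, h2, fderivInnerCLM_apply, real_inner_comm (X x)]
    rw [real_inner_comm (W x) (W' x (1, 0))]
    linear_combination 2 * h3
  · intro s hs
    simp only [hXper s hs, hWper s hs]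

end Divergence

/-! ### Pulling the eigenvalue equation back to adapted coordinates -/

section Pullback

open Set

variable {F : Type*} [NormedAddCommGroup F] [NormedSpace ℝ F]

/-- Coordinates `(s, θ)` near a rectangle, valued in the half-plane, in which the hyperbolic metric
is `q/p² ds² + q dθ²`; `V` is the velocity in the direction of `s`. -/
structure IsCoordRectangle (K : Set ℂ) (a b c d : ℝ) (p p' q : ℝ → ℝ) (P V : ℝ × ℝ → ℂ)
    (P' V' : ℝ × ℝ → ℝ × ℝ →L[ℝ] ℂ) : Prop where
  hasFDerivAt : ∀ x ∈ Icc a b ×ˢ Icc c d, HasFDerivAt P (P' x) x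
  hasFDerivAt_velocity : ∀ x ∈ Icc a b ×ˢ Icc c d, HasFDerivAt V (V' x) x
  hasDerivAt : ∀ s ∈ Icc a b, HasDerivAt p (p' s) s
  fst : ∀ x ∈ Icc a b ×ˢ Icc c d, P' x (1, 0) = V x
  snd : ∀ x ∈ Icc a b ×ˢ Icc c d, P' x (0, 1) = p x.1 • (Complex.I * V x)
  symm : ∀ x ∈ Icc a b ×ˢ Icc c d,
    V' x (0, 1) = Complex.I * (p' x.1 • V x + p x.1 • V' x (1, 0))
  normSq : ∀ x ∈ Icc a b ×ˢ Icc c d, p x.1 ^ 2 * ‖V x‖ ^ 2 = q x.1 * (P x).im ^ 2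
  mapsTo : MapsTo P (Icc a b ×ˢ Icc c d) K
  mapsTo_interior : MapsTo P (Ioo a b ×ˢ Ioo c d) (interior K)

/-- Since `φ` is `C²` up to the boundary of a region with unique derivatives, its within-derivative
is continuous there, as the divergence theorem on the closed rectangle demands. -/
theorem IsCoordRectangle.continuousOn {K : Set ℂ} {a b c d : ℝ} {p p' q : ℝ → ℝ}
    {P V : ℝ × ℝ → ℂ} {P' V' : ℝ × ℝ → ℝ × ℝ →L[ℝ] ℂ}
    (hP : IsCoordRectangle K a b c d p p' q P V P' V') {φ : ℂ → F} (hφ : ContDiffOn ℝ 2 φ K)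
    (hK : UniqueDiffOn ℝ K) :
    ContinuousOn (fun x ↦ φ (P x)) (Icc a b ×ˢ Icc c d) ∧
    ContinuousOn (fun x ↦ fderivWithin ℝ φ K (P x) (V x)) (Icc a b ×ˢ Icc c d) ∧
    ContinuousOn (fun x ↦ fderivWithin ℝ φ K (P x) (p x.1 • (Complex.I * V x)))
      (Icc a b ×ˢ Icc c d) := by
  have hPc : ContinuousOn P (Icc a b ×ˢ Icc c d) := fun x hx ↦
    (hP.hasFDerivAt x hx).continuousAt.continuousWithinAt
  have hVc : ContinuousOn V (Icc a b ×ˢ Icc c d) := fun x hx ↦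
    (hP.hasFDerivAt_velocity x hx).continuousAt.continuousWithinAt
  have hpc : ContinuousOn (fun x : ℝ × ℝ ↦ p x.1) (Icc a b ×ˢ Icc c d) :=
    ContinuousOn.comp (t := Icc a b)
      (fun s hs ↦ (hP.hasDerivAt s hs).continuousAt.continuousWithinAt) continuousOn_fst
      fun x hx ↦ hx.1
  have hD : ContinuousOn (fun x ↦ fderivWithin ℝ φ K (P x)) (Icc a b ×ˢ Icc c d) :=
    (hφ.fderivWithin hK (m := 1) (by norm_num)).continuousOn.comp hPc hP.mapsTo
  exact ⟨hφ.continuousOn.comp hPc hP.mapsTo, hD.clm_apply hVc,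
    hD.clm_apply (hpc.smul (continuousOn_const.mul hVc))⟩

/-- The coordinate vectors `V` and `p i V` are orthogonal, so the two second-order terms combine
into `p²‖V‖²` times the Laplacian, which the normalization of `q` turns into `-λ q φ`. The relation
`V_θ = i (p V)_s` gives both the equality of mixed derivatives and the cancellation of the
first-order terms. -/
theorem IsCoordRectangle.exists_derivatives {K : Set ℂ} {a b c d : ℝ} {p p' q : ℝ → ℝ}
    {P V : ℝ × ℝ → ℂ} {P' V' : ℝ × ℝ → ℝ × ℝ →L[ℝ] ℂ}
    (hP : IsCoordRectangle K a b c d p p' q P V P' V') {φ : ℂ → F} (hφ : ContDiffOn ℝ 2 φ K)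
    {lam : ℝ} (heig : ∀ z ∈ interior K, (z.im ^ 2) • Laplacian.laplacian φ z = -(lam • φ z)) :
    ∃ U' X' W' : ℝ × ℝ → ℝ × ℝ →L[ℝ] F,
      (∀ x ∈ Ioo a b ×ˢ Ioo c d, HasFDerivAt (fun x ↦ φ (P x)) (U' x) x) ∧
      (∀ x ∈ Ioo a b ×ˢ Ioo c d,
        HasFDerivAt (fun x ↦ fderivWithin ℝ φ K (P x) (V x)) (X' x) x) ∧
      (∀ x ∈ Ioo a b ×ˢ Ioo c d,
        HasFDerivAt (fun x ↦ fderivWithin ℝ φ K (P x) (p x.1 • (Complex.I * V x))) (W' x) x) ∧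
      (∀ x ∈ Ioo a b ×ˢ Ioo c d, U' x (1, 0) = fderivWithin ℝ φ K (P x) (V x)) ∧
      (∀ x ∈ Ioo a b ×ˢ Ioo c d,
        U' x (0, 1) = fderivWithin ℝ φ K (P x) (p x.1 • (Complex.I * V x))) ∧
      (∀ x ∈ Ioo a b ×ˢ Ioo c d, X' x (0, 1) = W' x (1, 0)) ∧
      (∀ x ∈ Ioo a b ×ˢ Ioo c d, (p x.1 ^ 2) • X' x (1, 0) +
        (p x.1 * p' x.1) • fderivWithin ℝ φ K (P x) (V x) + W' x (0, 1) =
          -((lam * q x.1) • φ (P x))) := by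
  have hsub : Ioo a b ×ˢ Ioo c d ⊆ Icc a b ×ˢ Icc c d :=
    prod_mono Ioo_subset_Icc_self Ioo_subset_Icc_self
  have hDx : ∀ x ∈ Ioo a b ×ˢ Ioo c d, HasFDerivAt (fun x ↦ fderivWithin ℝ φ K (P x))
      (fderiv ℝ (fderiv ℝ φ) (P x) ∘L P' x) x := fun x hx ↦
    (hasFDerivAt_fderiv_of_interior hφ (hP.mapsTo_interior hx)).comp x
      (hP.hasFDerivAt x (hsub hx))
  have hp1 : ∀ x ∈ Ioo a b ×ˢ Ioo c d, HasFDerivAt (fun x : ℝ × ℝ ↦ p x.1)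
      (p' x.1 • ContinuousLinearMap.fst ℝ ℝ ℝ) x := fun x hx ↦
    (hP.hasDerivAt x.1 (hsub hx).1).comp_hasFDerivAt x hasFDerivAt_fst
  refine ⟨_, _, _, fun x hx ↦
    (hasFDerivAt_fderivWithin_of_interior hφ (hP.mapsTo_interior hx)).comp x
      (hP.hasFDerivAt x (hsub hx)),
    fun x hx ↦ (hDx x hx).clm_apply (hP.hasFDerivAt_velocity x (hsub hx)),
    fun x hx ↦ (hDx x hx).clm_apply ((hp1 x hx).smul
      ((hP.hasFDerivAt_velocity x (hsub hx)).const_mul Complex.I)), ?_, ?_, ?_, ?_⟩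
  · intro x hx
    simp [hP.fst x (hsub hx)]
  · intro x hx
    simp [hP.snd x (hsub hx)]
  · intro x hx
    simp [hP.fst x (hsub hx), hP.snd x (hsub hx), hP.symm x (hsub hx),
      fderiv_fderiv_symm hφ (hP.mapsTo_interior hx) (V x), mul_add, -Complex.real_smul]
    module
  · intro x hx
    have h1 := fderiv_fderiv_add_rotate hφ (hP.mapsTo_interior hx) (V x)
    have h2 := heig _ (hP.mapsTo_interior hx)
    have h3 : (p x.1 ^ 2) • (‖V x‖ ^ 2) • Laplacian.laplacian φ (P x) =
        -((lam * q x.1) • φ (P x)) := by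
      rw [smul_smul, hP.normSq x (hsub hx), mul_smul, h2, smul_neg, smul_smul, mul_comm lam]
    rw [← h3, ← h1]
    -- This sign makes the term `Dφ(p i V_θ)` cancel `p p' Dφ(V) + p² Dφ(V_s)`.
    have h4 : Complex.I * (Complex.I * (p' x.1 • V x + p x.1 • V' x (1, 0))) =
        -(p' x.1 • V x + p x.1 • V' x (1, 0)) := by
      rw [← mul_assoc, Complex.I_mul_I]; ring
    simp [hP.fst x (hsub hx), hP.snd x (hsub hx), hP.symm x (hsub hx), h4, -Complex.real_smul]
    module

end Pullback

/-! ### The Rellich identity in adapted coordinates -/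

section RellichPullback

open Set

variable {F : Type*} [NormedAddCommGroup F] [InnerProductSpace ℝ F]

theorem IsCoordRectangle.rellich {K : Set ℂ} {a b c d : ℝ} {p p' q q' : ℝ → ℝ}
    {P V : ℝ × ℝ → ℂ} {P' V' : ℝ × ℝ → ℝ × ℝ →L[ℝ] ℂ}
    (hP : IsCoordRectangle K a b c d p p' q P V P' V') {φ : ℂ → F} (hφ : ContDiffOn ℝ 2 φ K)
    (hK : UniqueDiffOn ℝ K) (hab : a ≤ b) (hcd : c ≤ d)
    (hq : ∀ s ∈ Icc a b, HasDerivAt q (q' s) s) (hq' : ContinuousOn q' (Icc a b))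
    {lam : ℝ} (heig : ∀ z ∈ interior K, (z.im ^ 2) • Laplacian.laplacian φ z = -(lam • φ z))
    (hVper : ∀ s ∈ Icc a b, V (s, d) = V (s, c))
    (hDper : ∀ s ∈ Icc a b, fderivWithin ℝ φ K (P (s, d)) = fderivWithin ℝ φ K (P (s, c))) :
    ∫ x in Icc a b ×ˢ Icc c d, lam * q' x.1 * ‖φ (P x)‖ ^ 2 =
      (∫ y in c..d, (p b ^ 2 * ‖fderivWithin ℝ φ K (P (b, y)) (V (b, y))‖ ^ 2 +
        lam * q b * ‖φ (P (b, y))‖ ^ 2 -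
        ‖fderivWithin ℝ φ K (P (b, y)) (p b • (Complex.I * V (b, y)))‖ ^ 2)) -
      ∫ y in c..d, (p a ^ 2 * ‖fderivWithin ℝ φ K (P (a, y)) (V (a, y))‖ ^ 2 +
        lam * q a * ‖φ (P (a, y))‖ ^ 2 -
        ‖fderivWithin ℝ φ K (P (a, y)) (p a • (Complex.I * V (a, y)))‖ ^ 2) := by
  obtain ⟨hU, hX, hW⟩ := hP.continuousOn hφ hK
  obtain ⟨U', X', W', hU', hX', hW', h1, h2, h3, h4⟩ := hP.exists_derivatives hφ heig
  have h5 := rellich_rectangle hab hcd hP.hasDerivAt hq hq' hU hX hW hU' hX' hW' h1 h3 h4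
    (fun s hs ↦ by simp only [hVper s hs, hDper s hs])
    (fun s hs ↦ by simp only [hVper s hs, hDper s hs])
  exact h5

end RellichPullback

/-! ### Interiors, partial derivatives and Jacobians -/

section General

open Set

theorem inCoord_coe {𝕜 : Type*} (ψ : ℍ → 𝕜) (z : ℍ) : inCoord ψ (z : ℂ) = ψ z := by
  simp [inCoord]

variable {𝕜 : Type*} [RCLike 𝕜]

/-- The inclusion of the half-plane in `ℂ` is an open embedding, so the interior of the image is the
image of the interior. -/
theorem IsEigenfunctionOn.laplacian_eq {S : Set ℍ} {lam : ℝ} {ψ : ℍ → 𝕜}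
    (h : IsEigenfunctionOn S lam ψ) :
    ∀ z ∈ interior (UpperHalfPlane.coe '' S),
      (z.im ^ 2) • Laplacian.laplacian (inCoord ψ) z = -(lam • inCoord ψ z) := by
  intro z hz
  have hz' := interior_subset hz
  obtain ⟨z, hzS, rfl⟩ := hz'
  have hi : z ∈ interior S := by
    have := isOpenEmbedding_coe.isOpenMap.preimage_interior_eq_interior_preimage
      isOpenEmbedding_coe.continuous (UpperHalfPlane.coe '' S)
    rw [preimage_image_eq _ isOpenEmbedding_coe.injective] at this
    rw [← this]; exact hz
  rw [inCoord_coe, ← h.eigen z hi, hypLaplacian, neg_neg]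
  rfl

theorem interior_image_coe (S : Set ℍ) :
    UpperHalfPlane.coe '' interior S ⊆ interior (UpperHalfPlane.coe '' S) :=
  interior_maximal (image_mono interior_subset) (isOpenEmbedding_coe.isOpenMap _ isOpen_interior)

theorem fderiv_apply_fst {E : Type*} [NormedAddCommGroup E] [NormedSpace ℝ E] {f : ℝ × ℝ → E}
    {x : ℝ × ℝ} (hf : DifferentiableAt ℝ f x) {u : E}
    (h : HasDerivAt (fun s ↦ f (s, x.2)) u x.1) : fderiv ℝ f x (1, 0) = u := by
  have h1 : HasDerivAt (fun s : ℝ ↦ (s, x.2)) ((1 : ℝ), (0 : ℝ)) x.1 :=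
    (hasDerivAt_id x.1).prodMk (hasDerivAt_const _ _)
  exact (hf.hasFDerivAt.comp_hasDerivAt x.1 h1).unique h

theorem fderiv_apply_snd {E : Type*} [NormedAddCommGroup E] [NormedSpace ℝ E] {f : ℝ × ℝ → E}
    {x : ℝ × ℝ} (hf : DifferentiableAt ℝ f x) {u : E}
    (h : HasDerivAt (fun s ↦ f (x.1, s)) u x.2) : fderiv ℝ f x (0, 1) = u := by
  have h1 : HasDerivAt (fun s : ℝ ↦ (x.1, s)) ((0 : ℝ), (1 : ℝ)) x.2 :=
    (hasDerivAt_const _ _).prodMk (hasDerivAt_id x.2)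
  exact (hf.hasFDerivAt.comp_hasDerivAt x.2 h1).unique h

theorem det_prod_real (A : ℝ × ℝ →L[ℝ] ℝ × ℝ) :
    A.det = (A (1, 0)).1 * (A (0, 1)).2 - (A (0, 1)).1 * (A (1, 0)).2 := by
  rw [ContinuousLinearMap.det, ← LinearMap.det_toMatrix (Module.Basis.finTwoProd ℝ),
    Matrix.det_fin_two]
  simp [LinearMap.toMatrix_apply]

/-- The columns of the Jacobian are `V` and `p i V`, and a vector and its rotation span a square of
area `‖V‖²`. -/
theorem IsCoordRectangle.abs_det {K : Set ℂ} {a b c d : ℝ} {p p' q : ℝ → ℝ}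
    {P V : ℝ × ℝ → ℂ} {P' V' : ℝ × ℝ → ℝ × ℝ →L[ℝ] ℂ}
    (hP : IsCoordRectangle K a b c d p p' q P V P' V') {x : ℝ × ℝ}
    (hx : x ∈ Icc a b ×ˢ Icc c d) :
    HasFDerivAt (fun x ↦ ((P x).re, (P x).im))
        (Complex.equivRealProdCLM.toContinuousLinearMap ∘L P' x) x ∧
      |(Complex.equivRealProdCLM.toContinuousLinearMap ∘L P' x).det| = |p x.1| * ‖V x‖ ^ 2 := by
  refine ⟨Complex.equivRealProdCLM.toContinuousLinearMap.hasFDerivAt.comp x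
    (hP.hasFDerivAt x hx), ?_⟩
  rw [det_prod_real, Complex.sq_norm, Complex.normSq_apply]
  simp only [ContinuousLinearMap.comp_apply, hP.fst x hx, hP.snd x hx]
  simp
  rw [← abs_of_nonneg (add_nonneg (mul_self_nonneg (V x).re) (mul_self_nonneg (V x).im)), ← abs_mul]
  congr 1; ring

theorem setIntegral_Icc_prod_eq (a b c d : ℝ) (f : ℝ × ℝ → ℝ) :
    ∫ x in Icc a b ×ˢ Icc c d, f x = ∫ x in Ioc a b ×ˢ Ioc c d, f x := by
  refine setIntegral_congr_set ?_
  rw [Measure.volume_eq_prod]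
  exact Measure.set_prod_ae_eq Ioc_ae_eq_Icc.symm Ioc_ae_eq_Icc.symm

theorem volume_singleton_upperHalfPlane (w : ℍ) : volume ({w} : Set ℍ) = 0 := by
  rw [volume_eq_lintegral]; simp

end General

/-! ### Geodesic polar coordinates -/

section Polar

open Set

/-- `d/dr` of the polar coordinate map. -/
def polarVelocity (w : ℍ) (x : ℝ × ℝ) : ℂ :=
  ((w.im * (Real.sin x.2 / (Real.cosh x.1 + Real.sinh x.1 * Real.cos x.2) ^ 2) : ℝ) : ℂ) +
    ((-(w.im * ((Real.sinh x.1 + Real.cosh x.1 * Real.cos x.2) /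
      (Real.cosh x.1 + Real.sinh x.1 * Real.cos x.2) ^ 2)) : ℝ) : ℂ) * Complex.I

theorem coe_polar (w : ℍ) (r θ : ℝ) : (polar w r θ : ℂ) =
    ((w.re + w.im * (Real.sinh r * Real.sin θ / (Real.cosh r + Real.sinh r * Real.cos θ)) : ℝ) : ℂ)
      + ((w.im * (1 / (Real.cosh r + Real.sinh r * Real.cos θ)) : ℝ) : ℂ) * Complex.I := by
  rw [← Complex.re_add_im (polar w r θ : ℂ)]
  rfl

theorem ofReal_add_ofReal_mul_I_congr {a b : ℝ} {z : ℂ} (h1 : a = z.re) (h2 : b = z.im) :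
    (a : ℂ) + (b : ℂ) * Complex.I = z := by
  rw [h1, h2, Complex.re_add_im]

theorem hasDerivAt_polar_denom_fst (r θ : ℝ) :
    HasDerivAt (fun r ↦ Real.cosh r + Real.sinh r * Real.cos θ)
      (Real.sinh r + Real.cosh r * Real.cos θ) r :=
  (Real.hasDerivAt_cosh r).add ((Real.hasDerivAt_sinh r).mul_const _)

theorem hasDerivAt_polar_denom_snd (a b θ : ℝ) :
    HasDerivAt (fun θ ↦ a + b * Real.cos θ) (-(b * Real.sin θ)) θ :=
  (((Real.hasDerivAt_cos θ).const_mul _).const_add _).congr_deriv (by ring)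

theorem polarVelocity_re (w : ℍ) (x : ℝ × ℝ) : (polarVelocity w x).re =
    w.im * (Real.sin x.2 / (Real.cosh x.1 + Real.sinh x.1 * Real.cos x.2) ^ 2) := by
  rw [polarVelocity, Complex.add_re, Complex.re_ofReal_mul, Complex.ofReal_re, Complex.I_re,
    mul_zero, add_zero]

theorem polarVelocity_im (w : ℍ) (x : ℝ × ℝ) : (polarVelocity w x).im =
    -(w.im * ((Real.sinh x.1 + Real.cosh x.1 * Real.cos x.2) /
      (Real.cosh x.1 + Real.sinh x.1 * Real.cos x.2) ^ 2)) := by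
  rw [polarVelocity, Complex.add_im, Complex.im_ofReal_mul, Complex.ofReal_im, Complex.I_im,
    mul_one, zero_add]

theorem hasDerivAt_coe_polar_fst (w : ℍ) (r θ : ℝ) :
    HasDerivAt (fun r ↦ (polar w r θ : ℂ)) (polarVelocity w (r, θ)) r := by
  have hD := (polar_pos r θ).ne'
  have h1 := hasDerivAt_polar_denom_fst r θ
  have h2 := ((((Real.hasDerivAt_sinh r).mul_const (Real.sin θ)).div h1 hD).const_mul
    w.im).const_add w.re
  have h3 := ((hasDerivAt_const r (1 : ℝ)).div h1 hD).const_mul w.im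
  simp only [coe_polar]
  refine (h2.ofReal_comp.add (h3.ofReal_comp.mul_const Complex.I)).congr_deriv
    (ofReal_add_ofReal_mul_I_congr ?_ ?_)
  · rw [polarVelocity_re]
    congr 2
    linear_combination Real.sin θ * Real.cosh_sq r
  · rw [polarVelocity_im]
    ring

theorem hasDerivAt_coe_polar_snd (w : ℍ) (r θ : ℝ) :
    HasDerivAt (fun θ ↦ (polar w r θ : ℂ))
      (Real.sinh r • (Complex.I * polarVelocity w (r, θ))) θ := by
  have hD := (polar_pos r θ).ne'
  have h1 := hasDerivAt_polar_denom_snd (Real.cosh r) (Real.sinh r) θ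
  have h2 := ((((Real.hasDerivAt_sin θ).const_mul (Real.sinh r)).div h1 hD).const_mul
    w.im).const_add w.re
  have h3 := ((hasDerivAt_const θ (1 : ℝ)).div h1 hD).const_mul w.im
  simp only [coe_polar]
  refine (h2.ofReal_comp.add (h3.ofReal_comp.mul_const Complex.I)).congr_deriv
    (ofReal_add_ofReal_mul_I_congr ?_ ?_)
  · rw [Complex.smul_re, Complex.I_mul_re, polarVelocity_im, smul_eq_mul]
    field_simp
    linear_combination Real.sinh r ^ 2 * Real.sin_sq_add_cos_sq θ
  · rw [Complex.smul_im, Complex.I_mul_im, polarVelocity_re, smul_eq_mul]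
    ring

theorem contDiff_coe_polar (w : ℍ) : ContDiff ℝ 1 fun x : ℝ × ℝ ↦ (polar w x.1 x.2 : ℂ) := by
  have hD : ∀ x : ℝ × ℝ, Real.cosh x.1 + Real.sinh x.1 * Real.cos x.2 ≠ 0 := fun x ↦
    (polar_pos x.1 x.2).ne'
  have h1 : ContDiff ℝ 1 fun x : ℝ × ℝ ↦ w.re + w.im *
      (Real.sinh x.1 * Real.sin x.2 / (Real.cosh x.1 + Real.sinh x.1 * Real.cos x.2)) := by
    fun_prop (disch := exact hD)
  have h2 : ContDiff ℝ 1 fun x : ℝ × ℝ ↦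
      w.im * (1 / (Real.cosh x.1 + Real.sinh x.1 * Real.cos x.2)) := by
    fun_prop (disch := exact hD)
  simp only [coe_polar]
  exact (Complex.ofRealCLM.contDiff.comp h1).add
    ((Complex.ofRealCLM.contDiff.comp h2).mul contDiff_const)

theorem contDiff_polarVelocity (w : ℍ) : ContDiff ℝ 1 (polarVelocity w) := by
  have hD : ∀ x : ℝ × ℝ, (Real.cosh x.1 + Real.sinh x.1 * Real.cos x.2) ^ 2 ≠ 0 := fun x ↦
    pow_ne_zero 2 (polar_pos x.1 x.2).ne'
  have h1 : ContDiff ℝ 1 fun x : ℝ × ℝ ↦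
      w.im * (Real.sin x.2 / (Real.cosh x.1 + Real.sinh x.1 * Real.cos x.2) ^ 2) := by
    fun_prop (disch := exact hD)
  have h2 : ContDiff ℝ 1 fun x : ℝ × ℝ ↦ -(w.im * ((Real.sinh x.1 + Real.cosh x.1 * Real.cos x.2) /
      (Real.cosh x.1 + Real.sinh x.1 * Real.cos x.2) ^ 2)) := by
    fun_prop (disch := exact hD)
  exact (Complex.ofRealCLM.contDiff.comp h1).add
    ((Complex.ofRealCLM.contDiff.comp h2).mul contDiff_const)

/-- The radial coordinate is hyperbolic arclength along the rays. -/
theorem norm_polarVelocity_sq (w : ℍ) (r θ : ℝ) :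
    ‖polarVelocity w (r, θ)‖ ^ 2 = (polar w r θ).im ^ 2 := by
  have hD := (polar_pos r θ).ne'
  have h : (polar w r θ).im = w.im * (1 / (Real.cosh r + Real.sinh r * Real.cos θ)) := rfl
  rw [Complex.sq_norm, Complex.normSq_apply, h, polarVelocity_re, polarVelocity_im]
  field_simp
  have e1 := Real.cosh_sq r
  have e2 := Real.sin_sq_add_cos_sq θ
  linear_combination e2 + (Real.cos θ ^ 2 - 1) * e1

/-- This is the equality of the mixed partials of the polar map, whose angular derivative is `sinh r
· i V`. It is checked by differentiating the explicit formulas, which needs only `C¹` regularity of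
the map and of `V`. -/
theorem polarVelocity_symm (w : ℍ) (x : ℝ × ℝ) :
    fderiv ℝ (polarVelocity w) x (0, 1) = Complex.I *
      (Real.cosh x.1 • polarVelocity w x + Real.sinh x.1 • fderiv ℝ (polarVelocity w) x (1, 0)) := by
  obtain ⟨r, θ⟩ := x
  have hD := (polar_pos r θ).ne'
  have hdiff : DifferentiableAt ℝ (polarVelocity w) (r, θ) :=
    (contDiff_polarVelocity w).differentiable (by norm_num) _
  have a1 := hasDerivAt_polar_denom_fst r θ
  have a2 : HasDerivAt (fun r ↦ Real.sinh r + Real.cosh r * Real.cos θ)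
      (Real.cosh r + Real.sinh r * Real.cos θ) r :=
    (Real.hasDerivAt_sinh r).add ((Real.hasDerivAt_cosh r).mul_const _)
  have b1 := hasDerivAt_polar_denom_snd (Real.cosh r) (Real.sinh r) θ
  have b2 := hasDerivAt_polar_denom_snd (Real.sinh r) (Real.cosh r) θ
  have a3 : HasDerivAt (fun r ↦
      w.im * (Real.sin θ / (Real.cosh r + Real.sinh r * Real.cos θ) ^ 2))
      (-(w.im * (2 * Real.sin θ * (Real.sinh r + Real.cosh r * Real.cos θ)) /
        (Real.cosh r + Real.sinh r * Real.cos θ) ^ 3)) r := by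
    refine (((hasDerivAt_const r (Real.sin θ)).fun_div (a1.fun_pow 2)
      (pow_ne_zero 2 hD)).const_mul w.im).congr_deriv ?_
    field_simp
    ring
  have a4 : HasDerivAt (fun r ↦ -(w.im * ((Real.sinh r + Real.cosh r * Real.cos θ) /
      (Real.cosh r + Real.sinh r * Real.cos θ) ^ 2)))
      (-(w.im * ((Real.cosh r + Real.sinh r * Real.cos θ) ^ 2 -
        2 * (Real.sinh r + Real.cosh r * Real.cos θ) ^ 2)) /
        (Real.cosh r + Real.sinh r * Real.cos θ) ^ 3) r := by
    refine ((a2.fun_div (a1.fun_pow 2) (pow_ne_zero 2 hD)).const_mul w.im).fun_neg.congr_deriv ?_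
    field_simp
    ring
  have b3 : HasDerivAt (fun θ ↦
      w.im * (Real.sin θ / (Real.cosh r + Real.sinh r * Real.cos θ) ^ 2))
      (w.im * (Real.cos θ * (Real.cosh r + Real.sinh r * Real.cos θ) +
        2 * Real.sinh r * Real.sin θ ^ 2) /
        (Real.cosh r + Real.sinh r * Real.cos θ) ^ 3) θ := by
    refine (((Real.hasDerivAt_sin θ).fun_div (b1.fun_pow 2)
      (pow_ne_zero 2 hD)).const_mul w.im).congr_deriv ?_
    rw [← mul_div_assoc, div_eq_div_iff (pow_ne_zero 2 (pow_ne_zero 2 hD)) (pow_ne_zero 3 hD)]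
    ring
  have b4 : HasDerivAt (fun θ ↦ -(w.im * ((Real.sinh r + Real.cosh r * Real.cos θ) /
      (Real.cosh r + Real.sinh r * Real.cos θ) ^ 2)))
      (w.im * Real.sin θ * (Real.cosh r * (Real.cosh r + Real.sinh r * Real.cos θ) -
        2 * Real.sinh r * (Real.sinh r + Real.cosh r * Real.cos θ)) /
        (Real.cosh r + Real.sinh r * Real.cos θ) ^ 3) θ := by
    refine ((b2.fun_div (b1.fun_pow 2) (pow_ne_zero 2 hD)).const_mul w.im).fun_neg.congr_deriv ?_
    field_simp
    ring
  have a5 := fderiv_apply_fst (x := (r, θ)) (f := polarVelocity w) hdiff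
    (a3.ofReal_comp.add (a4.ofReal_comp.mul_const Complex.I))
  have b5 := fderiv_apply_snd (x := (r, θ)) (f := polarVelocity w) hdiff
    (b3.ofReal_comp.add (b4.ofReal_comp.mul_const Complex.I))
  rw [a5, b5]
  have e1 := Real.cosh_sq r
  have e2 := Real.sin_sq_add_cos_sq θ
  refine ofReal_add_ofReal_mul_I_congr ?_ ?_
  · simp only [Complex.I_mul_re, Complex.add_im, Complex.smul_im, polarVelocity_im,
      Complex.im_ofReal_mul, Complex.ofReal_im, Complex.I_im, mul_one, zero_add, smul_eq_mul]
    generalize Real.cosh r = C at *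
    generalize Real.sinh r = S at *
    generalize Real.cos θ = c at *
    generalize Real.sin θ = s at *
    generalize hDd : C + S * c = D at *
    field_simp
    subst hDd
    linear_combination (2 * S) * e2 - (S + C * c + S * (1 - c ^ 2)) * e1
  · simp only [Complex.I_mul_im, Complex.add_re, Complex.smul_re, polarVelocity_re,
      Complex.re_ofReal_mul, Complex.ofReal_re, Complex.I_re, mul_zero, add_zero, smul_eq_mul]
    field_simp
    ring

theorem polar_isCoordRectangle (w : ℍ) {R : ℝ} :
    IsCoordRectangle (UpperHalfPlane.coe '' Metric.closedBall w R) 0 R 0 (2 * Real.pi)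
      Real.sinh Real.cosh (fun r ↦ Real.sinh r ^ 2)
      (fun x ↦ (polar w x.1 x.2 : ℂ)) (polarVelocity w)
      (fderiv ℝ fun x : ℝ × ℝ ↦ (polar w x.1 x.2 : ℂ)) (fderiv ℝ (polarVelocity w)) where
  hasFDerivAt x _ := ((contDiff_coe_polar w).differentiable (by norm_num) x).hasFDerivAt
  hasFDerivAt_velocity x _ :=
    ((contDiff_polarVelocity w).differentiable (by norm_num) x).hasFDerivAt
  hasDerivAt s _ := Real.hasDerivAt_sinh s
  fst x _ := fderiv_apply_fst ((contDiff_coe_polar w).differentiable (by norm_num) x)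
    (hasDerivAt_coe_polar_fst w x.1 x.2)
  snd x _ := fderiv_apply_snd ((contDiff_coe_polar w).differentiable (by norm_num) x)
    (hasDerivAt_coe_polar_snd w x.1 x.2)
  symm x _ := polarVelocity_symm w x
  normSq x _ := by
    rw [norm_polarVelocity_sq w x.1 x.2]; rfl
  mapsTo x hx := mem_image_of_mem _ (by
    rw [Metric.mem_closedBall, dist_polar w hx.1.1]; exact hx.1.2)
  mapsTo_interior x hx := interior_image_coe _ (mem_image_of_mem _
    (Metric.ball_subset_interior_closedBall (by
      rw [Metric.mem_ball, dist_polar w hx.1.1.le]; exact hx.1.2)))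

end Polar

/-! ### Disc integrals and the inequality for circles -/

section Circle

open Set

theorem exists_mem_Ioc_cos_sin {a b : ℝ} (h : a ^ 2 + b ^ 2 = 1) :
    ∃ θ ∈ Ioc 0 (2 * Real.pi), Real.cos θ = a ∧ Real.sin θ = b := by
  have hn : ‖(⟨a, b⟩ : ℂ)‖ = 1 := by
    rw [← sq_eq_sq₀ (norm_nonneg _) zero_le_one, Complex.sq_norm, Complex.normSq_apply]
    simp only [one_pow]; linarith
  have hc : Real.cos (Complex.arg ⟨a, b⟩) = a := by
    rw [Complex.cos_arg (by rw [← norm_ne_zero_iff, hn]; exact one_ne_zero), hn, div_one]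
  have hs : Real.sin (Complex.arg ⟨a, b⟩) = b := by
    rw [Complex.sin_arg, hn, div_one]
  have h1 := Complex.neg_pi_lt_arg ⟨a, b⟩
  have h2 := Complex.arg_le_pi ⟨a, b⟩
  have h3 := Real.pi_pos
  rcases le_or_gt (Complex.arg ⟨a, b⟩) 0 with h0 | h0
  · exact ⟨Complex.arg ⟨a, b⟩ + 2 * Real.pi, ⟨by linarith, by linarith⟩,
      by rw [Real.cos_add_two_pi, hc], by rw [Real.sin_add_two_pi, hs]⟩
  · exact ⟨Complex.arg ⟨a, b⟩, ⟨h0, by linarith⟩, hc, hs⟩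

theorem eq_of_mem_Ioc_cos_sin {θ θ' : ℝ} (h : θ ∈ Ioc 0 (2 * Real.pi))
    (h' : θ' ∈ Ioc 0 (2 * Real.pi)) (hc : Real.cos θ = Real.cos θ')
    (hs : Real.sin θ = Real.sin θ') : θ = θ' := by
  obtain ⟨k, hk⟩ := Real.Angle.angle_eq_iff_two_pi_dvd_sub.mp (Real.Angle.cos_sin_inj hc hs)
  have h3 := Real.pi_pos
  have h4 : (k : ℝ) < 1 := by
    by_contra! h5
    nlinarith [h.2, h'.1]
  have h5 : (-1 : ℝ) < k := by
    by_contra! h5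
    nlinarith [h.1, h'.2]
  have h6 : k < 1 := by exact_mod_cast h4
  have h7 : -1 < k := by exact_mod_cast h5
  have h8 : k = 0 := by omega
  rw [h8] at hk
  simp at hk
  linarith

theorem polar_injOn (w : ℍ) (R : ℝ) :
    InjOn (fun x : ℝ × ℝ ↦ polar w x.1 x.2) (Ioc 0 R ×ˢ Ioc 0 (2 * Real.pi)) := by
  rintro ⟨r, θ⟩ ⟨hr, hθ⟩ ⟨r', θ'⟩ ⟨hr', hθ'⟩ h
  simp only at h hr hr' hθ hθ'
  have e1 : r = r' := by
    rw [← dist_polar w hr.1.le θ, ← dist_polar w hr'.1.le θ', h]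
  subst e1
  have hsr : Real.sinh r ≠ 0 := (Real.sinh_pos_iff.mpr hr.1).ne'
  have hw := w.im_ne_zero
  have h2 : w.im * (1 / (Real.cosh r + Real.sinh r * Real.cos θ)) =
      w.im * (1 / (Real.cosh r + Real.sinh r * Real.cos θ')) := congrArg UpperHalfPlane.im h
  have h1 : w.re + w.im * (Real.sinh r * Real.sin θ / (Real.cosh r + Real.sinh r * Real.cos θ)) =
      w.re + w.im * (Real.sinh r * Real.sin θ' / (Real.cosh r + Real.sinh r * Real.cos θ')) :=
    congrArg UpperHalfPlane.re h
  have hD := (polar_pos r θ).ne'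
  have h3 := mul_left_cancel₀ hw h2
  rw [one_div, one_div, inv_inj] at h3
  have hc : Real.cos θ = Real.cos θ' := mul_left_cancel₀ hsr (add_left_cancel h3)
  rw [← h3] at h1
  have h4 := mul_left_cancel₀ hw (add_left_cancel h1)
  rw [div_left_inj' hD] at h4
  rw [eq_of_mem_Ioc_cos_sin hθ hθ' hc (mul_left_cancel₀ hsr h4)]

/-- The half-open angular interval makes the parametrization bijective away from the centre. For
surjectivity, the angle is recovered from the coordinates of the point and the formula for `cosh` of
the distance. -/
theorem image_polar (w : ℍ) (R : ℝ) :
    (fun x : ℝ × ℝ ↦ polar w x.1 x.2) '' (Ioc 0 R ×ˢ Ioc 0 (2 * Real.pi)) =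
      Metric.closedBall w R \ {w} := by
  ext z
  constructor
  · rintro ⟨⟨r, θ⟩, ⟨hr, hθ⟩, rfl⟩
    simp only at hr
    refine ⟨?_, fun h ↦ ?_⟩
    · rw [Metric.mem_closedBall, dist_polar w hr.1.le]; exact hr.2
    · have h' : dist (polar w r θ) w = 0 := by rw [dist_eq_zero]; exact h
      rw [dist_polar w hr.1.le] at h'
      exact hr.1.ne' h'
  · rintro ⟨hz, hzw⟩
    set r := dist z w with hr
    have hr0 : 0 < r := dist_pos.mpr hzw
    have hsr : Real.sinh r ≠ 0 := (Real.sinh_pos_iff.mpr hr0).ne'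
    have hcosh := UpperHalfPlane.cosh_dist' z w
    rw [← hr] at hcosh
    have hw := w.im_ne_zero
    have hzi := z.im_ne_zero
    have hsq := Real.cosh_sq r
    -- The two values solve the equations for the imaginary and the real part of the polar point;
    -- that their squares add up to `1` is the distance formula.
    obtain ⟨θ, hθ, hc, hs⟩ := exists_mem_Ioc_cos_sin
      (a := (w.im / z.im - Real.cosh r) / Real.sinh r)
      (b := (z.re - w.re) / (z.im * Real.sinh r)) (by
        have hsq' : Real.sinh r ^ 2 = Real.cosh r ^ 2 - 1 := by linarith
        field_simp
        rw [hsq']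
        field_simp at hcosh
        linear_combination -hcosh)
    refine ⟨(r, θ), ⟨⟨hr0, hz⟩, hθ⟩, ?_⟩
    have hD : Real.cosh r + Real.sinh r * Real.cos θ = w.im / z.im := by
      rw [hc]; field_simp; ring
    apply UpperHalfPlane.ext_re_im
    · change w.re + w.im * (Real.sinh r * Real.sin θ /
        (Real.cosh r + Real.sinh r * Real.cos θ)) = z.re
      rw [hD, hs]; field_simp; ring
    · change w.im * (1 / (Real.cosh r + Real.sinh r * Real.cos θ)) = z.im
      rw [hD]; field_simp

variable {𝕜 : Type*} [RCLike 𝕜]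

theorem uniqueDiffOn_image_closedBall (w : ℍ) {R : ℝ} (hR : 0 < R) :
    UniqueDiffOn ℝ (UpperHalfPlane.coe '' Metric.closedBall w R) := by
  rw [image_coe_closedBall]
  refine uniqueDiffOn_convex (convex_closedBall _ _) ?_
  have hpos : 0 < w.im * Real.sinh R := mul_pos w.im_pos (Real.sinh_pos_iff.mpr hR)
  rw [interior_closedBall _ hpos.ne']
  exact Metric.nonempty_ball.mpr hpos

theorem setIntegral_closedBall (w : ℍ) (R : ℝ) (f : ℍ → ℝ) :
    (∫ z in Metric.closedBall w R, f z =
      ∫ x in Icc 0 R ×ˢ Icc 0 (2 * Real.pi), Real.sinh x.1 * f (polar w x.1 x.2)) ∧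
    (IntegrableOn (fun x : ℝ × ℝ ↦ Real.sinh x.1 * f (polar w x.1 x.2))
      (Icc 0 R ×ˢ Icc 0 (2 * Real.pi)) → IntegrableOn f (Metric.closedBall w R)) := by
  have hsub : Ioc 0 R ×ˢ Ioc 0 (2 * Real.pi) ⊆ Icc 0 R ×ˢ Icc 0 (2 * Real.pi) :=
    prod_mono Ioc_subset_Icc_self Ioc_subset_Icc_self
  have hP := polar_isCoordRectangle w (R := R)
  obtain ⟨-, h1, h2⟩ := setIntegral_image_param (P := fun x : ℝ × ℝ ↦ polar w x.1 x.2)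
    (measurableSet_Ioc.prod measurableSet_Ioc)
    (fun x hx ↦ (hP.abs_det (hsub hx)).1) (polar_injOn w R) (J := fun x ↦ Real.sinh x.1)
    (fun x hx ↦ by
      rw [(hP.abs_det (hsub hx)).2, norm_polarVelocity_sq w x.1 x.2,
        abs_of_nonneg (Real.sinh_nonneg_iff.mpr hx.1.1.le)]) f
  -- The centre, where polar coordinates degenerate, is a null set.
  have hae : (Metric.closedBall w R \ {w} : Set ℍ) =ᵐ[volume] Metric.closedBall w R :=
    sdiff_null_ae_eq_self (volume_singleton_upperHalfPlane w)
  rw [image_polar] at h1 h2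
  rw [setIntegral_congr_set hae] at h1
  rw [setIntegral_Icc_prod_eq]
  exact ⟨h1, fun h ↦ (h2.mpr (h.mono_set hsub)).congr_set_ae hae.symm⟩

/-- The rotated unit tangent is the inward radial vector `-V`, and the sign is lost in the norm. The
arclength element is `sinh R dθ`. -/
theorem restrictedNorm_circle (w : ℍ) {R : ℝ} (hR : 0 < R) (lam : ℝ) (ψ : ℍ → 𝕜) :
    restrictedNorm (Metric.closedBall w R) lam ψ (polar w R) 0 (2 * Real.pi) =
      (∫ θ in (0 : ℝ)..2 * Real.pi, ‖ψ (polar w R θ)‖ ^ 2 * Real.sinh R) +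
      lam⁻¹ * ∫ θ in (0 : ℝ)..2 * Real.pi,
        ‖fderivWithin ℝ (inCoord ψ) (UpperHalfPlane.coe '' Metric.closedBall w R) (polar w R θ)
          (polarVelocity w (R, θ))‖ ^ 2 * Real.sinh R := by
  have hs := Real.sinh_pos_iff.mpr hR
  have hn : ∀ θ, ‖polarVelocity w (R, θ)‖ = (polar w R θ).im := fun θ ↦ by
    rw [← sq_eq_sq₀ (norm_nonneg _) (polar w R θ).im_pos.le, norm_polarVelocity_sq]
  have hv : ∀ θ, velocity (polar w R) θ = Real.sinh R • (Complex.I * polarVelocity w (R, θ)) :=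
    fun θ ↦ (hasDerivAt_coe_polar_snd w R θ).deriv
  have hvn : ∀ θ, ‖velocity (polar w R) θ‖ = Real.sinh R * (polar w R θ).im := fun θ ↦ by
    rw [hv, norm_smul, norm_mul, Complex.norm_I, hn, one_mul, Real.norm_of_nonneg hs.le]
  have hN : ∀ θ, unitNormal (polar w R) θ = -polarVelocity w (R, θ) := fun θ ↦ by
    have h1 : ((polar w R θ).im : ℂ) ≠ 0 := by exact_mod_cast (polar w R θ).im_ne_zero
    have h2 : (Real.sinh R : ℂ) ≠ 0 := by exact_mod_cast hs.ne'
    rw [unitNormal, hvn, hv, Complex.real_smul]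
    push_cast
    push_cast at h2
    field_simp
    rw [Complex.I_sq]; ring
  have hl : ∀ θ, ‖velocity (polar w R) θ‖ / (polar w R θ).im = Real.sinh R := fun θ ↦ by
    rw [hvn]; field_simp [(polar w R θ).im_ne_zero]
  simp only [restrictedNorm, arclengthIntegral, normalDeriv, hN, hl, map_neg, norm_neg]

theorem restriction_circle (w : ℍ) {R : ℝ} (hR : 0 < R) {lam : ℝ} (hlam : 0 < lam) {ψ : ℍ → 𝕜}
    (hψ : IsEigenfunctionOn (Metric.closedBall w R) lam ψ) :
    IntegrableOn (fun z => Real.cosh (dist z w) * ‖ψ z‖ ^ 2) (Metric.closedBall w R) ∧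
    2 / Real.sinh R * (∫ z in Metric.closedBall w R, Real.cosh (dist z w) * ‖ψ z‖ ^ 2) ≤
      restrictedNorm (Metric.closedBall w R) lam ψ (polar w R) 0 (2 * Real.pi) := by
  have hs := Real.sinh_pos_iff.mpr hR
  have hK := uniqueDiffOn_image_closedBall w hR
  have hP := polar_isCoordRectangle w (R := R)
  have hφ : ContDiffOn ℝ 2 (inCoord ψ) _ := hψ.contDiffOn
  obtain ⟨cU, cX, cW⟩ := hP.continuousOn hφ hK
  have h2pi : (0 : ℝ) ≤ 2 * Real.pi := by positivity
  have hper1 : ∀ s, polarVelocity w (s, 2 * Real.pi) = polarVelocity w (s, 0) := fun s ↦ by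
    simp [polarVelocity]
  have hper2 : ∀ s, (polar w s (2 * Real.pi) : ℂ) = polar w s 0 := fun s ↦ by
    simp [coe_polar]
  have key := hP.rellich hφ hK hR.le h2pi (q' := fun r ↦ 2 * Real.sinh r * Real.cosh r)
    (fun s _ ↦ ((Real.hasDerivAt_sinh s).pow 2).congr_deriv (by norm_num))
    (by fun_prop) hψ.laplacian_eq (fun s _ ↦ hper1 s) (fun s _ ↦ by rw [hper2])
  obtain ⟨h1, h2⟩ := setIntegral_closedBall w R fun z ↦ Real.cosh (dist z w) * ‖ψ z‖ ^ 2
  have hcongr : ∀ x ∈ Icc 0 R ×ˢ Icc 0 (2 * Real.pi),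
      Real.sinh x.1 * (Real.cosh (dist (polar w x.1 x.2) w) * ‖ψ (polar w x.1 x.2)‖ ^ 2) =
        Real.sinh x.1 * (Real.cosh x.1 * ‖inCoord ψ (polar w x.1 x.2)‖ ^ 2) := fun x hx ↦ by
    rw [dist_polar w hx.1.1, inCoord_coe]
  have hmeas : MeasurableSet (Icc 0 R ×ˢ Icc 0 (2 * Real.pi)) :=
    measurableSet_Icc.prod measurableSet_Icc
  constructor
  · apply h2
    rw [integrableOn_congr_fun hcongr hmeas]
    refine ContinuousOn.integrableOn_compact (isCompact_Icc.prod isCompact_Icc) ?_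
    exact (by fun_prop : ContinuousOn (fun x : ℝ × ℝ ↦ Real.sinh x.1) _).mul
      ((by fun_prop : ContinuousOn (fun x : ℝ × ℝ ↦ Real.cosh x.1) _).mul (cU.norm.pow 2))
  rw [h1, setIntegral_congr_fun hmeas hcongr, restrictedNorm_circle w hR]
  have hline : MapsTo (fun θ : ℝ ↦ (R, θ)) (Icc 0 (2 * Real.pi))
      (Icc 0 R ×ˢ Icc 0 (2 * Real.pi)) := fun θ hθ ↦ ⟨⟨hR.le, le_rfl⟩, hθ⟩
  have hlc : ContinuousOn (fun θ : ℝ ↦ (R, θ)) (Icc 0 (2 * Real.pi)) := by fun_prop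
  have iU : IntervalIntegrable (fun θ ↦ ‖inCoord ψ (polar w R θ)‖ ^ 2) volume 0 (2 * Real.pi) := by
    apply ContinuousOn.intervalIntegrable
    rw [uIcc_of_le h2pi]
    exact ((cU.comp hlc hline).norm.pow 2)
  have iX : IntervalIntegrable (fun θ ↦ ‖fderivWithin ℝ (inCoord ψ)
      (UpperHalfPlane.coe '' Metric.closedBall w R) (polar w R θ)
        (polarVelocity w (R, θ))‖ ^ 2) volume 0 (2 * Real.pi) := by
    apply ContinuousOn.intervalIntegrable
    rw [uIcc_of_le h2pi]
    exact ((cX.comp hlc hline).norm.pow 2)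
  have iW : IntervalIntegrable (fun θ ↦ ‖fderivWithin ℝ (inCoord ψ)
      (UpperHalfPlane.coe '' Metric.closedBall w R) (polar w R θ)
        (Real.sinh R • (Complex.I * polarVelocity w (R, θ)))‖ ^ 2) volume 0 (2 * Real.pi) := by
    apply ContinuousOn.intervalIntegrable
    rw [uIcc_of_le h2pi]
    exact ((cW.comp hlc hline).norm.pow 2)
  have hW0 : 0 ≤ ∫ θ in (0 : ℝ)..2 * Real.pi, ‖fderivWithin ℝ (inCoord ψ)
      (UpperHalfPlane.coe '' Metric.closedBall w R) (polar w R θ)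
        (Real.sinh R • (Complex.I * polarVelocity w (R, θ)))‖ ^ 2 :=
    intervalIntegral.integral_nonneg h2pi fun θ _ ↦ by positivity
  -- At `r = 0` the factors `p`, `q` and the angular vector all vanish, so the inner end drops out.
  simp only [Real.sinh_zero, zero_smul, map_zero, norm_zero, ne_eq, OfNat.ofNat_ne_zero,
    not_false_eq_true, zero_pow, zero_mul, mul_zero, add_zero, sub_zero,
    intervalIntegral.integral_zero] at key
  rw [intervalIntegral.integral_sub ((iX.const_mul _).add (iU.const_mul _)) iW,
    intervalIntegral.integral_add (iX.const_mul _) (iU.const_mul _),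
    intervalIntegral.integral_const_mul, intervalIntegral.integral_const_mul] at key
  simp only [intervalIntegral.integral_mul_const]
  simp only [inCoord_coe] at *
  have hL : (∫ x in Icc 0 R ×ˢ Icc 0 (2 * Real.pi),
      lam * (2 * Real.sinh x.1 * Real.cosh x.1) * ‖ψ (polar w x.1 x.2)‖ ^ 2) =
      2 * lam * ∫ x in Icc 0 R ×ˢ Icc 0 (2 * Real.pi),
        Real.sinh x.1 * (Real.cosh x.1 * ‖ψ (polar w x.1 x.2)‖ ^ 2) := by
    rw [← integral_const_mul]
    congr 1; funext x; ring
  rw [hL] at key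
  -- Division by `λ sinh R` turns the identity into the claim with the defect `W / (λ sinh R)`,
  -- where `W ≥ 0` is the tangential energy.
  have arith : ∀ {s A X U W : ℝ}, 0 < s → 0 ≤ W →
      2 * lam * A = s ^ 2 * X + lam * s ^ 2 * U - W → 2 / s * A ≤ U * s + lam⁻¹ * (X * s) := by
    intro s A X U W hs hW h
    have e : U * s + lam⁻¹ * (X * s) - 2 / s * A = W / (lam * s) := by
      have hlam' := hlam.ne'
      have hs' := hs.ne'
      field_simp
      linear_combination -h
    have : 0 ≤ W / (lam * s) := by positivity
    linarith
  exact arith hs hW0 key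

end Circle

/-! ### Fubini on rectangles -/

section Rectangle

open Set

theorem setIntegral_rectangle_eq {a b c d : ℝ} (hab : a ≤ b) (hcd : c ≤ d) {h : ℝ × ℝ → ℝ}
    (hh : ContinuousOn h (Icc a b ×ˢ Icc c d)) :
    ∫ x in Icc a b ×ˢ Icc c d, h x = ∫ s in a..b, ∫ θ in c..d, h (s, θ) := by
  have hi : IntegrableOn h (Icc a b ×ˢ Icc c d) :=
    hh.integrableOn_compact (isCompact_Icc.prod isCompact_Icc)
  rw [Measure.volume_eq_prod] at hi ⊢
  rw [setIntegral_prod _ hi, intervalIntegral.integral_of_le hab, integral_Icc_eq_integral_Ioc]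
  simp only [intervalIntegral.integral_of_le hcd, integral_Icc_eq_integral_Ioc]

theorem integral_le_setIntegral_rectangle {a b c d : ℝ} (hab : a ≤ b) (hcd : c ≤ d)
    {h : ℝ × ℝ → ℝ} (hh : ContinuousOn h (Icc a b ×ˢ Icc c d)) {k : ℝ → ℝ}
    (hk : ContinuousOn k (Icc a b)) (hle : ∀ s ∈ Icc a b, k s ≤ ∫ θ in c..d, h (s, θ)) :
    ∫ s in a..b, k s ≤ ∫ x in Icc a b ×ˢ Icc c d, h x := by
  have hi : IntegrableOn h (Icc a b ×ˢ Icc c d) :=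
    hh.integrableOn_compact (isCompact_Icc.prod isCompact_Icc)
  rw [setIntegral_rectangle_eq hab hcd hh]
  refine intervalIntegral.integral_mono_on hab
    (ContinuousOn.intervalIntegrable (by rwa [uIcc_of_le hab])) ?_ hle
  rw [IntegrableOn, Measure.volume_eq_prod, ← Measure.prod_restrict] at hi
  have h2 := hi.integral_prod_left
  simp only [integral_Icc_eq_integral_Ioc, ← intervalIntegral.integral_of_le hcd] at h2
  rw [intervalIntegrable_iff_integrableOn_Icc_of_le hab]
  exact h2

end Rectangle

/-! ### Decay of the tangential energy along a sequence of heights -/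

section Energy

open Set

variable {F : Type*} [NormedAddCommGroup F] [InnerProductSpace ℝ F]

/-- If `U` is a solution of `U_ss + U_θθ = -lam q U`, periodic in `θ`, on a half-infinite strip and
`∬ q |U|²` is finite, where `q = s⁻²`, then the tangential energy `∫ |U_θ|² dθ` is small for some
arbitrarily large `s`. -/
theorem exists_tangential_energy_lt {Y c d lam C : ℝ} (hY : 0 < Y) (hlam : 0 < lam) (hcd : c ≤ d)
    {U X W : ℝ × ℝ → F} {U' X' W' : ℝ × ℝ → ℝ × ℝ →L[ℝ] F}
    (hU : ContinuousOn U (Ici Y ×ˢ Icc c d)) (hX : ContinuousOn X (Ici Y ×ˢ Icc c d))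
    (hW : ContinuousOn W (Ici Y ×ˢ Icc c d))
    (hU' : ∀ x ∈ Ioi Y ×ˢ Ioo c d, HasFDerivAt U (U' x) x)
    (hX' : ∀ x ∈ Ioi Y ×ˢ Ioo c d, HasFDerivAt X (X' x) x)
    (hW' : ∀ x ∈ Ioi Y ×ˢ Ioo c d, HasFDerivAt W (W' x) x)
    (hUX : ∀ x ∈ Ioi Y ×ˢ Ioo c d, U' x (1, 0) = X x)
    (hUW : ∀ x ∈ Ioi Y ×ˢ Ioo c d, U' x (0, 1) = W x)
    (heq : ∀ x ∈ Ioi Y ×ˢ Ioo c d,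
      X' x (1, 0) + W' x (0, 1) = -((lam * (x.1 ^ 2)⁻¹) • U x))
    (hUper : ∀ s ∈ Ici Y, U (s, d) = U (s, c)) (hWper : ∀ s ∈ Ici Y, W (s, d) = W (s, c))
    (hC : ∀ S T, Y ≤ S → S ≤ T → ∫ x in Icc S T ×ˢ Icc c d, (x.1 ^ 2)⁻¹ * ‖U x‖ ^ 2 ≤ C)
    {ε : ℝ} (hε : 0 < ε) {T₀ : ℝ} (hT₀ : Y ≤ T₀) :
    ∃ T, T₀ ≤ T ∧ ∫ θ in c..d, ‖W (T, θ)‖ ^ 2 < ε := by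
  by_contra! hcon
  have hqc : ContinuousOn (fun x : ℝ × ℝ ↦ (x.1 ^ 2)⁻¹) (Ici Y ×ˢ Icc c d) := by
    refine ContinuousOn.inv₀ (by fun_prop) fun x hx ↦ ?_
    exact pow_ne_zero 2 (hY.trans_le hx.1).ne'
  have hsub : ∀ {S T}, Y ≤ S → Icc S T ×ˢ Icc c d ⊆ Ici Y ×ˢ Icc c d := fun hS ↦
    prod_mono (fun s hs ↦ hS.trans hs.1) Subset.rfl
  have hsub' : ∀ {S T}, Y ≤ S → Ioo S T ×ˢ Ioo c d ⊆ Ioi Y ×ˢ Ioo c d := fun hS ↦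
    prod_mono (fun s hs ↦ hS.trans_lt hs.1) Subset.rfl
  have hint : ∀ {h : ℝ × ℝ → ℝ} {S T}, Y ≤ S → ContinuousOn h (Ici Y ×ˢ Icc c d) →
      IntegrableOn h (Icc S T ×ˢ Icc c d) := fun hS hh ↦
    (hh.mono (hsub hS)).integrableOn_compact (isCompact_Icc.prod isCompact_Icc)
  have hmeas : ∀ {S T : ℝ}, MeasurableSet (Icc S T ×ˢ Icc c d) :=
    measurableSet_Icc.prod measurableSet_Icc
  have hUXc : ContinuousOn (fun x ↦ 2 * inner ℝ (U x) (X x)) (Ici Y ×ˢ Icc c d) :=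
    (hU.inner hX).const_mul 2
  -- Let `m(s) = ∫ |U|² dθ`. This is the integrated form of `m' = 2∫⟨U, U_s⟩`, and the next identity
  -- is that of `m'' = 2∫(|U_s|² + |U_θ|²) - 2λ s⁻² m`. If the tangential energy stayed above `ε`,
  -- then `m'` would grow linearly, because `∫ s⁻² m ≤ C`. Then `m` would grow at least linearly,
  -- making `∫ s⁻² m` diverge logarithmically.
  have first : ∀ S T, Y ≤ S → S ≤ T →
      ∫ x in Icc S T ×ˢ Icc c d, 2 * inner ℝ (U x) (X x) =
        (∫ θ in c..d, ‖U (T, θ)‖ ^ 2) - ∫ θ in c..d, ‖U (S, θ)‖ ^ 2 := by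
    intro S T hS hST
    refine integral_divergence_of_periodic (f := fun x ↦ ‖U x‖ ^ 2) (g := fun _ ↦ 0)
      (g' := fun _ ↦ 0) hST hcd ((hU.norm.pow 2).mono (hsub hS)) continuousOn_const
      (hUXc.mono (hsub hS)) (fun x hx ↦ (hU' x (hsub' hS hx)).norm_sq)
      (fun x _ ↦ hasFDerivAt_const _ _) (fun x hx ↦ ?_) (fun _ _ ↦ rfl)
    simp [hUX x (hsub' hS hx)]
  have second : ∀ S T, Y ≤ S → S ≤ T →
      ∫ x in Icc S T ×ˢ Icc c d,
        (2 * (‖X x‖ ^ 2 + ‖W x‖ ^ 2) - 2 * lam * ((x.1 ^ 2)⁻¹ * ‖U x‖ ^ 2)) =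
        (∫ θ in c..d, 2 * inner ℝ (U (T, θ)) (X (T, θ))) -
          ∫ θ in c..d, 2 * inner ℝ (U (S, θ)) (X (S, θ)) := by
    intro S T hS hST
    refine integral_divergence_of_periodic (f := fun x ↦ 2 * inner ℝ (U x) (X x))
      (g := fun x ↦ 2 * inner ℝ (U x) (W x)) hST hcd (hUXc.mono (hsub hS))
      (((hU.inner hW).const_mul 2).mono (hsub hS)) (((((hX.norm.pow 2).add
        (hW.norm.pow 2)).const_mul 2).sub ((hqc.mul (hU.norm.pow 2)).const_mul _)).mono (hsub hS))
      (fun x hx ↦ ((hU' x (hsub' hS hx)).inner ℝ (hX' x (hsub' hS hx))).const_mul 2)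
      (fun x hx ↦ ((hU' x (hsub' hS hx)).inner ℝ (hW' x (hsub' hS hx))).const_mul 2)
      (fun x hx ↦ ?_) (fun s hs ↦ ?_)
    · have h3 := congrArg (fun v ↦ inner ℝ (U x) v) (heq x (hsub' hS hx))
      simp only [inner_add_right, inner_smul_right, inner_neg_right,
        real_inner_self_eq_norm_sq] at h3
      simp [hUX x (hsub' hS hx), hUW x (hsub' hS hx), fderivInnerCLM_apply]
      linear_combination 2 * h3
    · simp only [hUper s (hS.trans hs.1), hWper s (hS.trans hs.1)]
  -- Eventually `m' ≥ 1`: the threshold makes the gain `2ε(T - T₀)` exceed `1 + 2λC - m'(T₀)`.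
  have hM : ∃ T₁, T₀ ≤ T₁ ∧ ∀ T, T₁ ≤ T → 1 ≤ ∫ θ in c..d, 2 * inner ℝ (U (T, θ)) (X (T, θ)) := by
    set M₀ := ∫ θ in c..d, 2 * inner ℝ (U (T₀, θ)) (X (T₀, θ)) with hM₀
    refine ⟨T₀ + (|1 + 2 * lam * C - M₀|) / (2 * ε), by
      have : 0 ≤ |1 + 2 * lam * C - M₀| / (2 * ε) := by positivity
      linarith, fun T hT ↦ ?_⟩
    have hT' : T₀ ≤ T := by
      have : 0 ≤ |1 + 2 * lam * C - M₀| / (2 * ε) := by positivity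
      linarith
    have h1 := second T₀ T hT₀ hT'
    have h2 : ∫ x in Icc T₀ T ×ˢ Icc c d,
        (2 * ‖W x‖ ^ 2 - 2 * lam * ((x.1 ^ 2)⁻¹ * ‖U x‖ ^ 2)) ≤
        ∫ x in Icc T₀ T ×ˢ Icc c d,
          (2 * (‖X x‖ ^ 2 + ‖W x‖ ^ 2) - 2 * lam * ((x.1 ^ 2)⁻¹ * ‖U x‖ ^ 2)) := by
      refine setIntegral_mono_on (hint hT₀ (((hW.norm.pow 2).const_mul 2).sub
        ((hqc.mul (hU.norm.pow 2)).const_mul _))) (hint hT₀ ((((hX.norm.pow 2).add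
        (hW.norm.pow 2)).const_mul 2).sub ((hqc.mul (hU.norm.pow 2)).const_mul _))) hmeas
        fun x _ ↦ ?_
      nlinarith [sq_nonneg ‖X x‖]
    have hWc : ContinuousOn (fun x ↦ 2 * ‖W x‖ ^ 2) (Ici Y ×ˢ Icc c d) :=
      (hW.norm.pow 2).const_mul 2
    have hUc : ContinuousOn (fun x ↦ 2 * lam * ((x.1 ^ 2)⁻¹ * ‖U x‖ ^ 2)) (Ici Y ×ˢ Icc c d) :=
      (hqc.mul (hU.norm.pow 2)).const_mul _
    rw [integral_sub (hint hT₀ hWc) (hint hT₀ hUc), integral_const_mul,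
      integral_const_mul] at h2
    have h3 := integral_le_setIntegral_rectangle hT' hcd ((hW.norm.pow 2).mono (hsub hT₀))
      (k := fun _ ↦ ε) continuousOn_const fun s hs ↦ hcon s hs.1
    rw [intervalIntegral.integral_const, smul_eq_mul] at h3
    have h4 := hC T₀ T hT₀ hT'
    have h5 : |1 + 2 * lam * C - M₀| ≤ (T - T₀) * (2 * ε) := by
      rw [← div_le_iff₀ (by positivity)]; linarith
    have h6 := le_abs_self (1 + 2 * lam * C - M₀)
    simp only [Pi.pow_apply] at h3
    have h7 := mul_le_mul_of_nonneg_left h4 (by positivity : 0 ≤ 2 * lam)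
    rw [h1] at h2
    linarith
  obtain ⟨T₁, hT₁, hM⟩ := hM
  have hY1 : Y ≤ T₁ := hT₀.trans hT₁
  have hm : ∀ T, T₁ ≤ T → T - T₁ ≤ ∫ θ in c..d, ‖U (T, θ)‖ ^ 2 := by
    intro T hT
    have h3 := integral_le_setIntegral_rectangle hT hcd (hUXc.mono (hsub hY1))
      (k := fun _ ↦ 1) continuousOn_const fun s hs ↦ hM s hs.1
    rw [intervalIntegral.integral_const, smul_eq_mul, first T₁ T hY1 hT] at h3
    have : 0 ≤ ∫ θ in c..d, ‖U (T₁, θ)‖ ^ 2 :=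
      intervalIntegral.integral_nonneg hcd fun _ _ ↦ by positivity
    linarith
  have hT1 : 0 < T₁ := hY.trans_le hY1
  have hT2 : Y ≤ 2 * T₁ := by linarith
  -- From `2T₁` on, `m(s) ≥ s - T₁ ≥ s/2`, so the integral of `s⁻² m` up to `T` is at least `½ log
  -- (T / 2T₁) = |C| + 1 > C`.
  set T := 2 * T₁ * Real.exp (2 * |C| + 2) with hT
  have hTT : 2 * T₁ ≤ T := by
    have : 1 ≤ Real.exp (2 * |C| + 2) := Real.one_le_exp (by positivity)
    nlinarith
  have hpos : ∀ s ∈ Icc (2 * T₁) T, 0 < s := fun s hs ↦ by linarith [hs.1]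
  have h8 := integral_le_setIntegral_rectangle hTT hcd
    ((hqc.mul (hU.norm.pow 2)).mono (hsub hT2)) (k := fun s ↦ (1 / 2) * s⁻¹)
    (continuousOn_const.mul (continuousOn_inv₀.mono fun s hs ↦ (hpos s hs).ne')) fun s hs ↦ by
      have hs0 := hpos s hs
      have h9 := hm s (by linarith [hs.1])
      simp only [Pi.mul_apply, Pi.pow_apply]
      rw [intervalIntegral.integral_const_mul]
      have : (1 / 2) * s⁻¹ = (s ^ 2)⁻¹ * (s / 2) := by field_simp
      rw [this]
      exact mul_le_mul_of_nonneg_left (by linarith [hs.1]) (by positivity)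
  have h10 := hC (2 * T₁) T hT2 hTT
  rw [intervalIntegral.integral_const_mul, integral_inv_of_pos (by linarith) (by linarith), hT,
    mul_div_cancel_left₀ _ (by linarith), Real.log_exp] at h8
  simp only [Pi.mul_apply, Pi.pow_apply] at h8
  linarith [le_abs_self C]

end Energy

/-! ### Coordinates, periodicity and integration on the cusp -/

section Cusp

open Set
open scoped Pointwise

theorem image_cuspRegion {A : ℝ} (hA : 0 < A) :
    UpperHalfPlane.coe '' cuspRegion A = {z : ℂ | A ≤ z.im} := by
  ext z
  constructor
  · rintro ⟨z, hz, rfl⟩; exact hz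
  · intro hz
    exact ⟨⟨z, hA.trans_le hz⟩, hz, rfl⟩

theorem uniqueDiffOn_image_cuspRegion {A : ℝ} (hA : 0 < A) :
    UniqueDiffOn ℝ (UpperHalfPlane.coe '' cuspRegion A) := by
  rw [image_cuspRegion hA]
  refine uniqueDiffOn_convex (convex_halfSpace_im_ge A) ⟨⟨0, A + 1⟩, ?_⟩
  rw [Complex.interior_setOfPred_le_im]
  exact lt_add_one A

/-- The order `(y, x)` reverses orientation: the velocity in `y` is `i`, and `1 = p · i · i` forces
`p = -1`. Only `p²` enters the Rellich identity. -/
theorem cusp_isCoordRectangle {A Y T c d : ℝ} (hA : 0 < A) (hY : A ≤ Y) :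
    IsCoordRectangle (UpperHalfPlane.coe '' cuspRegion A) Y T c d (fun _ ↦ -1) (fun _ ↦ 0)
      (fun s ↦ (s ^ 2)⁻¹) (fun x ↦ (x.2 : ℂ) + (x.1 : ℂ) * Complex.I) (fun _ ↦ Complex.I)
      (fun _ ↦ Complex.ofRealCLM ∘L ContinuousLinearMap.snd ℝ ℝ ℝ +
        Complex.I • (Complex.ofRealCLM ∘L ContinuousLinearMap.fst ℝ ℝ ℝ)) (fun _ ↦ 0) where
  hasFDerivAt x _ := by
    have h1 : HasFDerivAt (fun x : ℝ × ℝ ↦ (x.2 : ℂ))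
        (Complex.ofRealCLM ∘L ContinuousLinearMap.snd ℝ ℝ ℝ) x :=
      (Complex.ofRealCLM ∘L ContinuousLinearMap.snd ℝ ℝ ℝ).hasFDerivAt
    have h2 : HasFDerivAt (fun x : ℝ × ℝ ↦ (x.1 : ℂ))
        (Complex.ofRealCLM ∘L ContinuousLinearMap.fst ℝ ℝ ℝ) x :=
      (Complex.ofRealCLM ∘L ContinuousLinearMap.fst ℝ ℝ ℝ).hasFDerivAt
    exact h1.add (h2.mul_const Complex.I)
  hasFDerivAt_velocity x _ := hasFDerivAt_const _ _
  hasDerivAt s _ := hasDerivAt_const _ _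
  fst x _ := by simp
  snd x _ := by simp
  symm x _ := by simp
  normSq x hx := by
    have : x.1 ≠ 0 := (hA.trans_le (hY.trans hx.1.1)).ne'
    simp [this]
  mapsTo x hx := by
    rw [image_cuspRegion hA]
    simpa using hY.trans hx.1.1
  mapsTo_interior x hx := by
    rw [image_cuspRegion hA, Complex.interior_setOfPred_le_im]
    simpa using hY.trans_lt hx.1.1

variable {𝕜 : Type*} [RCLike 𝕜]

theorem IsCuspEigenfunction.inCoord_add_one {A lam : ℝ} {ψ : ℍ → 𝕜}
    (h : IsCuspEigenfunction A lam ψ) {z : ℂ} (hz : z ∈ UpperHalfPlane.coe '' cuspRegion A) :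
    inCoord ψ (z + 1) = inCoord ψ z := by
  obtain ⟨z, hz, rfl⟩ := hz
  have h1 := h.periodic z hz
  have h2 : ((z : ℂ) + 1) = (((1 : ℝ) +ᵥ z : ℍ) : ℂ) := by
    rw [UpperHalfPlane.coe_vadd, add_comm]; simp
  rw [h2, inCoord_coe, inCoord_coe, h1]

theorem IsCuspEigenfunction.fderivWithin_add_one {A lam : ℝ} (hA : 0 < A) {ψ : ℍ → 𝕜}
    (h : IsCuspEigenfunction A lam ψ) {z : ℂ} (hz : z ∈ UpperHalfPlane.coe '' cuspRegion A) :
    fderivWithin ℝ (inCoord ψ) (UpperHalfPlane.coe '' cuspRegion A) (z + 1) =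
      fderivWithin ℝ (inCoord ψ) (UpperHalfPlane.coe '' cuspRegion A) z := by
  have hK : (1 : ℂ) +ᵥ (UpperHalfPlane.coe '' cuspRegion A) =
      UpperHalfPlane.coe '' cuspRegion A := by
    rw [image_cuspRegion hA]
    ext z
    rw [mem_vadd_set_iff_neg_vadd_mem]
    simp
  have h1 := fderivWithin_comp_add_right (𝕜 := ℝ) (f := inCoord ψ)
    (s := UpperHalfPlane.coe '' cuspRegion A) (x := z) (1 : ℂ)
  rw [hK] at h1
  rw [← h1]
  exact fderivWithin_congr (fun w hw ↦ h.inCoord_add_one hw) (h.inCoord_add_one hz)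

theorem measurableSet_cuspStrip (Y : ℝ) : MeasurableSet (cuspStrip Y) := by
  have h1 : Measurable fun z : ℍ ↦ z.re := continuous_re.measurable
  have h2 : Measurable fun z : ℍ ↦ z.im := continuous_im.measurable
  exact (measurableSet_lt measurable_const h1).inter
    ((measurableSet_le h1 measurable_const).inter (measurableSet_le measurable_const h2))

theorem setIntegral_cuspStrip {Y : ℝ} (hY : 0 < Y) (f : ℍ → ℝ) :
    (∫ z in cuspStrip Y, f z = ∫ x in Ici Y ×ˢ Ioc (-(1 / 2) : ℝ) (1 / 2),
      (x.1 ^ 2)⁻¹ * f (ofComplex ((x.2 : ℂ) + (x.1 : ℂ) * Complex.I))) ∧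
    (IntegrableOn f (cuspStrip Y) ↔
      IntegrableOn (fun x : ℝ × ℝ ↦
        (x.1 ^ 2)⁻¹ * f (ofComplex ((x.2 : ℂ) + (x.1 : ℂ) * Complex.I)))
        (Ici Y ×ˢ Ioc (-(1 / 2) : ℝ) (1 / 2))) := by
  have himg : toPlane '' cuspStrip Y = Ioc (-(1 / 2) : ℝ) (1 / 2) ×ˢ Ici Y := by
    ext ⟨a, b⟩
    constructor
    · rintro ⟨z, hz, h⟩
      simp only [toPlane, Prod.mk.injEq] at h
      rw [← h.1, ← h.2]
      exact ⟨⟨hz.1, hz.2.1⟩, hz.2.2⟩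
    · rintro ⟨h1, h2⟩
      exact ⟨⟨⟨a, b⟩, hY.trans_le h2⟩, ⟨h1.1, h1.2, h2⟩, rfl⟩
  obtain ⟨h1, h2⟩ := setIntegral_eq_plane (measurableSet_cuspStrip Y) f (fun p ↦ (p.2 ^ 2)⁻¹ *
    f (ofComplex ((p.1 : ℂ) + (p.2 : ℂ) * Complex.I))) fun z _ ↦ by
      have : ((z.re : ℂ) + (z.im : ℂ) * Complex.I) = z := Complex.re_add_im z
      simp only [toPlane, this, ofComplex_apply]
  rw [himg] at h1 h2
  rw [h1, h2, Measure.volume_eq_prod]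
  constructor
  · rw [← setIntegral_prod_swap]
    rfl
  · exact ⟨fun h ↦ h.swap, fun h ↦ h.swap⟩

end Cusp

/-! ### The inequality for closed horocycles -/

section Horocycle

open Set Filter Topology

variable {𝕜 : Type*} [RCLike 𝕜]

theorem restrictedNorm_horocycle {A Y : ℝ} (hY : 0 < Y) (lam : ℝ) (ψ : ℍ → 𝕜) :
    restrictedNorm (cuspRegion A) lam ψ (horocycle Y hY) (-(1 / 2)) (1 / 2) =
      Y⁻¹ * (∫ θ in (-(1 / 2) : ℝ)..1 / 2, ‖inCoord ψ ((θ : ℂ) + (Y : ℂ) * Complex.I)‖ ^ 2) +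
      lam⁻¹ * (Y * ∫ θ in (-(1 / 2) : ℝ)..1 / 2,
        ‖fderivWithin ℝ (inCoord ψ) (UpperHalfPlane.coe '' cuspRegion A)
          ((θ : ℂ) + (Y : ℂ) * Complex.I) Complex.I‖ ^ 2) := by
  have hc : ∀ θ, (horocycle Y hY θ : ℂ) = (θ : ℂ) + (Y : ℂ) * Complex.I := fun θ ↦
    (Complex.re_add_im _).symm
  have hv : ∀ θ, velocity (horocycle Y hY) θ = 1 := fun θ ↦ by
    have h1 : HasDerivAt (fun θ : ℝ ↦ (horocycle Y hY θ : ℂ)) 1 θ := by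
      simp only [hc]
      exact ((hasDerivAt_id θ).ofReal_comp.add_const _).congr_deriv (by simp)
    exact h1.deriv
  have him : ∀ θ, (horocycle Y hY θ).im = Y := fun θ ↦ rfl
  have hN : ∀ θ, unitNormal (horocycle Y hY) θ = Y • Complex.I := fun θ ↦ by
    rw [unitNormal, hv, him]; simp
  simp only [restrictedNorm, arclengthIntegral, normalDeriv, hN, hv, him, hc, ← inCoord_coe ψ,
    map_smul, norm_smul, norm_one, intervalIntegral.integral_mul_const, mul_pow,
    intervalIntegral.integral_const_mul, Real.norm_of_nonneg hY.le]
  field_simp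

theorem continuousOn_cusp {A lam : ℝ} (hA : 0 < A) {ψ : ℍ → 𝕜}
    (hψ : IsEigenfunctionOn (cuspRegion A) lam ψ) (v : ℂ) (c d : ℝ) :
    ContinuousOn (fun x : ℝ × ℝ ↦ inCoord ψ ((x.2 : ℂ) + (x.1 : ℂ) * Complex.I))
      (Ici A ×ˢ Icc c d) ∧
    ContinuousOn (fun x : ℝ × ℝ ↦ fderivWithin ℝ (inCoord ψ) (UpperHalfPlane.coe '' cuspRegion A)
      ((x.2 : ℂ) + (x.1 : ℂ) * Complex.I) v) (Ici A ×ˢ Icc c d) := by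
  have hmaps : MapsTo (fun x : ℝ × ℝ ↦ (x.2 : ℂ) + (x.1 : ℂ) * Complex.I) (Ici A ×ˢ Icc c d)
      (UpperHalfPlane.coe '' cuspRegion A) := fun x hx ↦ by
    rw [image_cuspRegion hA]
    simpa using hx.1
  have hc : ContinuousOn (fun x : ℝ × ℝ ↦ (x.2 : ℂ) + (x.1 : ℂ) * Complex.I)
      (Ici A ×ˢ Icc c d) := by fun_prop
  have h : ContDiffOn ℝ 2 (inCoord ψ) (UpperHalfPlane.coe '' cuspRegion A) := hψ.contDiffOn
  exact ⟨h.continuousOn.comp hc hmaps,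
    ((h.fderivWithin (uniqueDiffOn_image_cuspRegion hA) (m := 1) (by norm_num)).continuousOn.comp
      hc hmaps).clm_apply continuousOn_const⟩

theorem integrableOn_cuspStrip_norm_sq {A lam Y : ℝ} (hY : A ≤ Y) {ψ : ℍ → 𝕜}
    (hψ : IsCuspEigenfunction A lam ψ) : IntegrableOn (fun z ↦ ‖ψ z‖ ^ 2) (cuspStrip Y) := by
  have h : IntegrableOn (fun z ↦ ‖ψ z‖ ^ 2) (cuspStrip A) :=
    (memLp_two_iff_integrable_sq_norm hψ.memLp.1).mp hψ.memLp
  exact h.mono_set fun z hz ↦ ⟨hz.1, hz.2.1, hY.trans hz.2.2⟩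

/-- The tangential energy of a cusp eigenfunction is small along a sequence of heights. -/
theorem IsCuspEigenfunction.exists_tangential_energy_lt {A lam Y : ℝ} (hA : 0 < A) (hY : A ≤ Y)
    (hlam : 0 < lam) {ψ : ℍ → 𝕜} (hψ : IsCuspEigenfunction A lam ψ) {ε : ℝ} (hε : 0 < ε) {T₀ : ℝ}
    (hT₀ : Y ≤ T₀) :
    ∃ T, T₀ ≤ T ∧ ∫ θ in (-(1 / 2) : ℝ)..1 / 2, ‖fderivWithin ℝ (inCoord ψ)
      (UpperHalfPlane.coe '' cuspRegion A) ((θ : ℂ) + (T : ℂ) * Complex.I)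
        ((-1 : ℝ) • (Complex.I * Complex.I))‖ ^ 2 < ε := by
  have hY0 := hA.trans_le hY
  have hφ : ContDiffOn ℝ 2 (inCoord ψ) (UpperHalfPlane.coe '' cuspRegion A) :=
    hψ.eigenfunction.contDiffOn
  set K := UpperHalfPlane.coe '' cuspRegion A with hK
  let U : ℝ × ℝ → 𝕜 := fun x ↦ inCoord ψ ((x.2 : ℂ) + (x.1 : ℂ) * Complex.I)
  let X : ℝ × ℝ → 𝕜 := fun x ↦
    fderivWithin ℝ (inCoord ψ) K ((x.2 : ℂ) + (x.1 : ℂ) * Complex.I) Complex.I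
  let W : ℝ × ℝ → 𝕜 := fun x ↦ fderivWithin ℝ (inCoord ψ) K ((x.2 : ℂ) + (x.1 : ℂ) * Complex.I)
    ((-1 : ℝ) • (Complex.I * Complex.I))
  have hder : ∀ x ∈ Ioi Y ×ˢ Ioo (-(1 / 2) : ℝ) (1 / 2), HasFDerivAt U (fderiv ℝ U x) x ∧
      HasFDerivAt X (fderiv ℝ X x) x ∧ HasFDerivAt W (fderiv ℝ W x) x ∧
      fderiv ℝ U x (1, 0) = X x ∧ fderiv ℝ U x (0, 1) = W x ∧
      fderiv ℝ X x (1, 0) + fderiv ℝ W x (0, 1) = -((lam * (x.1 ^ 2)⁻¹) • U x) := by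
    intro x hx
    -- Coordinates are available only on bounded rectangles, so one reaching above the given point
    -- is used. Stating the conclusions with `fderiv` makes them independent of its height.
    have hP := cusp_isCoordRectangle (T := x.1 + 1) (c := -(1 / 2)) (d := 1 / 2) hA hY
    obtain ⟨U', X', W', hU, hX, hW, h1, h2, -, h4⟩ :=
      hP.exists_derivatives hφ hψ.eigenfunction.laplacian_eq
    have hx' : x ∈ Ioo Y (x.1 + 1) ×ˢ Ioo (-(1 / 2) : ℝ) (1 / 2) :=
      ⟨⟨hx.1, lt_add_one _⟩, hx.2⟩
    have hU := hU x hx'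
    have hX := hX x hx'
    have hW := hW x hx'
    have h4 := h4 x hx'
    rw [show fderiv ℝ U x = U' x from hU.fderiv, show fderiv ℝ X x = X' x from hX.fderiv,
      show fderiv ℝ W x = W' x from hW.fderiv]
    refine ⟨hU, hX, hW, h1 x hx', h2 x hx', ?_⟩
    rw [← h4]; simp
  have hsub : Ici Y ×ˢ Icc (-(1 / 2) : ℝ) (1 / 2) ⊆ Ici A ×ˢ Icc (-(1 / 2) : ℝ) (1 / 2) :=
    prod_mono (Ici_subset_Ici.mpr hY) Subset.rfl
  have hmem : ∀ s ∈ Ici Y, ∀ θ : ℝ, (θ : ℂ) + (s : ℂ) * Complex.I ∈ K := fun s hs θ ↦ by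
    rw [hK, image_cuspRegion hA]
    simpa using hY.trans hs
  have hshift : ∀ s : ℝ, (((1 / 2 : ℝ) : ℂ) + (s : ℂ) * Complex.I) =
      (((-(1 / 2) : ℝ) : ℂ) + (s : ℂ) * Complex.I) + 1 := fun s ↦ by
    push_cast; ring
  have hI := (setIntegral_cuspStrip hY0 fun z ↦ ‖ψ z‖ ^ 2).2.mp
    (integrableOn_cuspStrip_norm_sq hY hψ)
  refine HypRestriction.exists_tangential_energy_lt (U := U) (X := X) (W := W) (lam := lam)
    (C := ∫ x in Ici Y ×ˢ Ioc (-(1 / 2) : ℝ) (1 / 2), (x.1 ^ 2)⁻¹ * ‖U x‖ ^ 2) hY0 hlam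
    (by norm_num) ((continuousOn_cusp hA hψ.eigenfunction 0 _ _).1.mono hsub)
    ((continuousOn_cusp hA hψ.eigenfunction _ _ _).2.mono hsub)
    ((continuousOn_cusp hA hψ.eigenfunction _ _ _).2.mono hsub)
    (fun x hx ↦ (hder x hx).1) (fun x hx ↦ (hder x hx).2.1) (fun x hx ↦ (hder x hx).2.2.1)
    (fun x hx ↦ (hder x hx).2.2.2.1) (fun x hx ↦ (hder x hx).2.2.2.2.1)
    (fun x hx ↦ (hder x hx).2.2.2.2.2) (fun s hs ↦ ?_) (fun s hs ↦ ?_) (fun S T hS hST ↦ ?_) hε hT₀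
  · simp only [U, hshift]
    exact hψ.inCoord_add_one (hmem s hs _)
  · simp only [W, hshift]
    rw [hψ.fderivWithin_add_one hA (hmem s hs _)]
  · rw [setIntegral_Icc_prod_eq]
    refine setIntegral_mono_set hI (ae_of_all _ fun x ↦ by positivity) (LE.le.eventuallyLE ?_)
    exact prod_mono (fun s hs ↦ hS.trans hs.1.le) Subset.rfl

/-- The far end of the Rellich identity contributes at most its tangential energy. The rectangle is
enlarged to a height where this is below `ε`, which only increases the mass on the left. -/
theorem IsCuspEigenfunction.rectangle_le {A lam Y T : ℝ} (hA : 0 < A) (hY : A ≤ Y) (hT : Y ≤ T)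
    (hlam : 0 < lam) {ψ : ℍ → 𝕜} (hψ : IsCuspEigenfunction A lam ψ) :
    2 * lam * ∫ x in Ioc Y T ×ˢ Ioc (-(1 / 2) : ℝ) (1 / 2),
      (x.1 ^ 3)⁻¹ * ‖inCoord ψ ((x.2 : ℂ) + (x.1 : ℂ) * Complex.I)‖ ^ 2 ≤
    (∫ θ in (-(1 / 2) : ℝ)..1 / 2, ‖fderivWithin ℝ (inCoord ψ)
        (UpperHalfPlane.coe '' cuspRegion A) ((θ : ℂ) + (Y : ℂ) * Complex.I) Complex.I‖ ^ 2) +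
      lam * (Y ^ 2)⁻¹ *
        ∫ θ in (-(1 / 2) : ℝ)..1 / 2, ‖inCoord ψ ((θ : ℂ) + (Y : ℂ) * Complex.I)‖ ^ 2 := by
  refine le_of_forall_pos_le_add fun ε hε ↦ ?_
  obtain ⟨T', hT', hlt⟩ := hψ.exists_tangential_energy_lt hA hY hlam hε hT
  have hY0 := hA.trans_le hY
  have hYT := hT.trans hT'
  have hφ : ContDiffOn ℝ 2 (inCoord ψ) (UpperHalfPlane.coe '' cuspRegion A) :=
    hψ.eigenfunction.contDiffOn
  have hP := cusp_isCoordRectangle (T := T') (c := -(1 / 2)) (d := 1 / 2) hA hY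
  have hpos : ∀ s ∈ Icc Y T', s ≠ 0 := fun s hs ↦ (hY0.trans_le hs.1).ne'
  have key := hP.rellich hφ (uniqueDiffOn_image_cuspRegion hA) hYT (by norm_num)
    (q' := fun s ↦ -2 * (s ^ 3)⁻¹)
    (fun s hs ↦ by
      have hs0 := hpos s hs
      refine ((hasDerivAt_pow 2 s).inv (pow_ne_zero 2 hs0)).congr_deriv ?_
      field_simp; norm_num [mul_comm])
    (continuousOn_const.mul ((by fun_prop : ContinuousOn (fun s : ℝ ↦ s ^ 3) _).inv₀
      fun s hs ↦ pow_ne_zero 3 (hpos s hs))) hψ.eigenfunction.laplacian_eq (fun _ _ ↦ rfl)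
    (fun s hs ↦ by
      have : (((1 / 2 : ℝ) : ℂ) + (s : ℂ) * Complex.I) =
          (((-(1 / 2) : ℝ) : ℂ) + (s : ℂ) * Complex.I) + 1 := by push_cast; ring
      simp only [this]
      refine hψ.fderivWithin_add_one hA ?_
      rw [image_cuspRegion hA]
      simpa using hY.trans hs.1)
  have hi : ∀ s, Y ≤ s → ∀ v : ℂ,
      IntervalIntegrable (fun θ : ℝ ↦ ‖inCoord ψ ((θ : ℂ) + (s : ℂ) * Complex.I)‖ ^ 2) volume
        (-(1 / 2)) (1 / 2) ∧
      IntervalIntegrable (fun θ : ℝ ↦ ‖fderivWithin ℝ (inCoord ψ)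
        (UpperHalfPlane.coe '' cuspRegion A) ((θ : ℂ) + (s : ℂ) * Complex.I) v‖ ^ 2) volume
        (-(1 / 2)) (1 / 2) := by
    intro s hs v
    obtain ⟨c1, c2⟩ := continuousOn_cusp hA hψ.eigenfunction v (-(1 / 2)) (1 / 2)
    have hline : MapsTo (fun θ : ℝ ↦ (s, θ)) (Icc (-(1 / 2)) (1 / 2))
        (Ici A ×ˢ Icc (-(1 / 2) : ℝ) (1 / 2)) := fun θ hθ ↦ ⟨hY.trans hs, hθ⟩
    have hlc : ContinuousOn (fun θ : ℝ ↦ (s, θ)) (Icc (-(1 / 2)) (1 / 2)) := by fun_prop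
    constructor <;> apply ContinuousOn.intervalIntegrable <;> rw [uIcc_of_le (by norm_num)]
    · exact (c1.comp hlc hline).norm.pow 2
    · exact (c2.comp hlc hline).norm.pow 2
  have split : ∀ s, Y ≤ s → ∀ v : ℂ, (∫ θ in (-(1 / 2) : ℝ)..1 / 2, ((-1 : ℝ) ^ 2 *
      ‖fderivWithin ℝ (inCoord ψ) (UpperHalfPlane.coe '' cuspRegion A)
        ((θ : ℂ) + (s : ℂ) * Complex.I) Complex.I‖ ^ 2 +
      lam * (s ^ 2)⁻¹ * ‖inCoord ψ ((θ : ℂ) + (s : ℂ) * Complex.I)‖ ^ 2 -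
      ‖fderivWithin ℝ (inCoord ψ) (UpperHalfPlane.coe '' cuspRegion A)
        ((θ : ℂ) + (s : ℂ) * Complex.I) v‖ ^ 2)) =
      (∫ θ in (-(1 / 2) : ℝ)..1 / 2, ‖fderivWithin ℝ (inCoord ψ)
        (UpperHalfPlane.coe '' cuspRegion A) ((θ : ℂ) + (s : ℂ) * Complex.I) Complex.I‖ ^ 2) +
      lam * (s ^ 2)⁻¹ *
        (∫ θ in (-(1 / 2) : ℝ)..1 / 2, ‖inCoord ψ ((θ : ℂ) + (s : ℂ) * Complex.I)‖ ^ 2) -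
      ∫ θ in (-(1 / 2) : ℝ)..1 / 2, ‖fderivWithin ℝ (inCoord ψ)
        (UpperHalfPlane.coe '' cuspRegion A) ((θ : ℂ) + (s : ℂ) * Complex.I) v‖ ^ 2 := by
    intro s hs v
    rw [intervalIntegral.integral_sub (((hi s hs _).2.const_mul _).add ((hi s hs 0).1.const_mul _))
      (hi s hs _).2, intervalIntegral.integral_add ((hi s hs _).2.const_mul _)
      ((hi s hs 0).1.const_mul _), intervalIntegral.integral_const_mul,
      intervalIntegral.integral_const_mul]
    norm_num
  have h0 : ∀ s (v : ℂ), 0 ≤ ∫ θ in (-(1 / 2) : ℝ)..1 / 2, ‖fderivWithin ℝ (inCoord ψ)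
        (UpperHalfPlane.coe '' cuspRegion A) ((θ : ℂ) + (s : ℂ) * Complex.I) v‖ ^ 2 := fun s v ↦
    intervalIntegral.integral_nonneg (by norm_num) fun _ _ ↦ by positivity
  have h1 : 0 ≤ lam * (T' ^ 2)⁻¹ *
        (∫ θ in (-(1 / 2) : ℝ)..1 / 2, ‖inCoord ψ ((θ : ℂ) + (T' : ℂ) * Complex.I)‖ ^ 2) :=
    mul_nonneg (by positivity)
      (intervalIntegral.integral_nonneg (by norm_num) fun _ _ ↦ by positivity)
  simp only at key
  rw [split T' hYT, split Y le_rfl, setIntegral_Icc_prod_eq] at key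
  have hL : ∫ x in Ioc Y T' ×ˢ Ioc (-(1 / 2) : ℝ) (1 / 2), lam * (-2 * (x.1 ^ 3)⁻¹) *
      ‖inCoord ψ ((x.2 : ℂ) + (x.1 : ℂ) * Complex.I)‖ ^ 2 =
      -(2 * lam) * ∫ x in Ioc Y T' ×ˢ Ioc (-(1 / 2) : ℝ) (1 / 2), (x.1 ^ 3)⁻¹ *
        ‖inCoord ψ ((x.2 : ℂ) + (x.1 : ℂ) * Complex.I)‖ ^ 2 := by
    rw [← integral_const_mul]
    congr 1; funext x; ring
  rw [hL] at key
  have hmono : ∫ x in Ioc Y T ×ˢ Ioc (-(1 / 2) : ℝ) (1 / 2), (x.1 ^ 3)⁻¹ *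
        ‖inCoord ψ ((x.2 : ℂ) + (x.1 : ℂ) * Complex.I)‖ ^ 2 ≤
      ∫ x in Ioc Y T' ×ˢ Ioc (-(1 / 2) : ℝ) (1 / 2), (x.1 ^ 3)⁻¹ *
        ‖inCoord ψ ((x.2 : ℂ) + (x.1 : ℂ) * Complex.I)‖ ^ 2 := by
    refine setIntegral_mono_set ?_ ?_ (LE.le.eventuallyLE
      (prod_mono (Ioc_subset_Ioc_right hT') Subset.rfl))
    · have hc := (continuousOn_cusp hA hψ.eigenfunction 0 (-(1 / 2)) (1 / 2)).1
      have hsub : Icc Y T' ×ˢ Icc (-(1 / 2) : ℝ) (1 / 2) ⊆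
          Ici A ×ˢ Icc (-(1 / 2) : ℝ) (1 / 2) :=
        prod_mono (fun s hs ↦ hY.trans hs.1) Subset.rfl
      refine IntegrableOn.mono_set (ContinuousOn.integrableOn_compact
        (isCompact_Icc.prod isCompact_Icc) (ContinuousOn.mul ?_ ((hc.mono hsub).norm.pow 2)))
        (prod_mono Ioc_subset_Icc_self Ioc_subset_Icc_self)
      exact ContinuousOn.inv₀ (by fun_prop) fun x hx ↦ pow_ne_zero 3 (hpos _ hx.1)
    · filter_upwards [ae_restrict_mem (measurableSet_Ioc.prod measurableSet_Ioc)] with x hx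
      have : 0 < x.1 := hY0.trans hx.1.1
      simp only [Pi.zero_apply]
      positivity
  have h2 := mul_le_mul_of_nonneg_left hmono (by positivity : 0 ≤ 2 * lam)
  linarith [h0 T' Complex.I, h0 Y ((-1 : ℝ) • (Complex.I * Complex.I))]

theorem restriction_horocycle {A Y lam : ℝ} (hA : 0 < A) (hY : A ≤ Y) (hlam : 0 < lam) {ψ : ℍ → 𝕜}
    (hψ : IsCuspEigenfunction A lam ψ) :
    IntegrableOn (fun z => ‖ψ z‖ ^ 2 * z.im⁻¹) (cuspStrip Y) ∧
    2 * Y * (∫ z in cuspStrip Y, ‖ψ z‖ ^ 2 * z.im⁻¹) ≤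
      restrictedNorm (cuspRegion A) lam ψ (horocycle Y (hA.trans_le hY)) (-(1 / 2)) (1 / 2) := by
  have hY0 := hA.trans_le hY
  have hint := integrableOn_cuspStrip_norm_sq hY hψ
  have hI : IntegrableOn (fun z => ‖ψ z‖ ^ 2 * z.im⁻¹) (cuspStrip Y) := by
    refine Integrable.mono' (hint.const_mul Y⁻¹) (hint.1.mul
      (continuous_im.inv₀ fun z ↦ z.im_ne_zero).aestronglyMeasurable) ?_
    filter_upwards [ae_restrict_mem (measurableSet_cuspStrip Y)] with z hz
    have h1 : z.im⁻¹ ≤ Y⁻¹ := inv_anti₀ hY0 hz.2.2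
    have h2 := z.im_pos
    rw [Real.norm_of_nonneg (by positivity), mul_comm]
    gcongr
  refine ⟨hI, ?_⟩
  obtain ⟨h1, h2⟩ := setIntegral_cuspStrip hY0 fun z ↦ ‖ψ z‖ ^ 2 * z.im⁻¹
  have hmeas' : MeasurableSet (Ici Y ×ˢ Ioc (-(1 / 2) : ℝ) (1 / 2)) :=
    measurableSet_Ici.prod measurableSet_Ioc
  let g : ℝ × ℝ → ℝ := fun x ↦
    (x.1 ^ 3)⁻¹ * ‖inCoord ψ ((x.2 : ℂ) + (x.1 : ℂ) * Complex.I)‖ ^ 2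
  have hcongr : ∀ x ∈ Ici Y ×ˢ Ioc (-(1 / 2) : ℝ) (1 / 2),
      (x.1 ^ 2)⁻¹ * (‖ψ (ofComplex ((x.2 : ℂ) + (x.1 : ℂ) * Complex.I))‖ ^ 2 *
        (ofComplex ((x.2 : ℂ) + (x.1 : ℂ) * Complex.I)).im⁻¹) = g x := by
    intro x hx
    have hx0 : 0 < x.1 := hY0.trans_le hx.1
    have him : (ofComplex ((x.2 : ℂ) + (x.1 : ℂ) * Complex.I)).im = x.1 := by
      rw [ofComplex_apply_of_im_pos (by simpa using hx0)]
      simp [UpperHalfPlane.im]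
    simp only [g, him, inCoord]
    field_simp
  have hg : IntegrableOn g (Ici Y ×ˢ Ioc (-(1 / 2) : ℝ) (1 / 2)) :=
    (integrableOn_congr_fun hcongr hmeas').mp (h2.mp hI)
  rw [h1, setIntegral_congr_fun hmeas' hcongr]
  have hae : (Ioi Y ×ˢ Ioc (-(1 / 2) : ℝ) (1 / 2) : Set (ℝ × ℝ)) =ᵐ[volume]
      (Ici Y ×ˢ Ioc (-(1 / 2) : ℝ) (1 / 2) : Set (ℝ × ℝ)) := by
    rw [Measure.volume_eq_prod]
    exact Measure.set_prod_ae_eq Ioi_ae_eq_Ici (ae_eq_refl _)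
  rw [← setIntegral_congr_set hae]
  have hU : (⋃ n : ℕ, Ioc Y (Y + n) ×ˢ Ioc (-(1 / 2) : ℝ) (1 / 2)) =
      Ioi Y ×ˢ Ioc (-(1 / 2) : ℝ) (1 / 2) := by
    rw [← iUnion_prod_const]
    congr 1
    ext s
    simp only [mem_iUnion, mem_Ioc, mem_Ioi]
    refine ⟨fun ⟨n, hn⟩ ↦ hn.1, fun hs ↦ ?_⟩
    obtain ⟨n, hn⟩ := exists_nat_ge (s - Y)
    exact ⟨n, hs, by linarith⟩
  -- The bound is uniform in the height of the rectangle, so it passes to the limit of an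
  -- exhaustion; multiplication by `Y/λ` then yields the claim.
  have hlim := tendsto_setIntegral_of_monotone (f := g) (μ := volume)
    (s := fun n : ℕ ↦ Ioc Y (Y + n) ×ˢ Ioc (-(1 / 2) : ℝ) (1 / 2))
    (fun n ↦ measurableSet_Ioc.prod measurableSet_Ioc)
    (fun m n hmn ↦ prod_mono (Ioc_subset_Ioc_right (by gcongr)) Subset.rfl)
    (by rw [hU]; exact hg.mono_set (prod_mono Ioi_subset_Ici_self Subset.rfl))
  rw [hU] at hlim
  have hb := le_of_tendsto (hlim.const_mul (2 * lam)) (Eventually.of_forall fun n : ℕ ↦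
    hψ.rectangle_le hA hY (T := Y + n) (by simp) hlam)
  rw [restrictedNorm_horocycle hY0]
  refine le_trans (le_of_eq ?_) (le_trans (mul_le_mul_of_nonneg_left hb
    (by positivity : 0 ≤ Y * lam⁻¹)) (le_of_eq ?_))
  · generalize (∫ x in Ioi Y ×ˢ Ioc (-(1 / 2) : ℝ) (1 / 2), g x) = J
    field_simp
  · generalize (∫ θ in (-(1 / 2) : ℝ)..1 / 2, ‖fderivWithin ℝ (inCoord ψ)
        (UpperHalfPlane.coe '' cuspRegion A) ((θ : ℂ) + (Y : ℂ) * Complex.I) Complex.I‖ ^ 2) = J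
    generalize (∫ θ in (-(1 / 2) : ℝ)..1 / 2,
      ‖inCoord ψ ((θ : ℂ) + (Y : ℂ) * Complex.I)‖ ^ 2) = L
    field_simp
    ring

end Horocycle

/-! ### Bessel functions of imaginary order by their integral representation -/

section Bessel

open Set Filter Topology

theorem one_add_sq_div_two_le_cosh (s : ℝ) : 1 + s ^ 2 / 2 ≤ Real.cosh s := by
  have h : Real.cosh s = 1 + 2 * Real.sinh (s / 2) ^ 2 := by
    have h1 := Real.cosh_two_mul (s / 2)
    have h2 := Real.cosh_sq (s / 2)
    rw [mul_div_cancel₀ s two_ne_zero] at h1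
    linarith
  have h2 : (s / 2) ^ 2 ≤ Real.sinh (s / 2) ^ 2 := by
    rw [sq_le_sq, Real.abs_sinh]
    exact Real.self_le_sinh_iff.mpr (abs_nonneg _)
  rw [h]; linarith

/-- The exponential beats the power `j + 2` of `cosh s`. The two spare factors dominate `1 + s²`,
which leaves a multiple of `1 / (1 + s²)`. -/
theorem integrable_cosh_pow_mul_exp (j : ℕ) {a : ℝ} (ha : 0 < a) :
    Integrable fun s ↦ Real.cosh s ^ j * Real.exp (-a * Real.cosh s) := by
  have hc : Continuous fun s ↦ Real.cosh s ^ j * Real.exp (-a * Real.cosh s) := by fun_prop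
  refine Integrable.mono' (integrable_inv_one_add_sq.const_mul
    ((j + 2).factorial / a ^ (j + 2))) hc.aestronglyMeasurable (ae_of_all _ fun s ↦ ?_)
  have hcp := Real.cosh_pos s
  have h1 := Real.pow_div_factorial_le_exp (a * Real.cosh s) (by positivity) (j + 2)
  have h2 : 1 + s ^ 2 ≤ Real.cosh s ^ 2 := by
    nlinarith [one_add_sq_div_two_le_cosh s, sq_nonneg (s ^ 2)]
  rw [Real.norm_of_nonneg (by positivity), neg_mul, Real.exp_neg]
  rw [div_le_iff₀ (by positivity), mul_pow] at h1
  rw [div_mul_eq_mul_div, ← div_eq_mul_inv, ← div_eq_mul_inv, div_le_div_iff₀ (by positivity)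
    (by positivity), div_mul_eq_mul_div, le_div_iff₀ (by positivity)]
  calc Real.cosh s ^ j * a ^ (j + 2) * (1 + s ^ 2)
      ≤ Real.cosh s ^ j * a ^ (j + 2) * Real.cosh s ^ 2 := by gcongr
    _ = a ^ (j + 2) * Real.cosh s ^ (j + 2) := by ring
    _ ≤ _ := by linarith

/-- The moments `∫ cosh^j s · exp (-a cosh s) cos (t s) ds`; for `j = 0` this is twice the Bessel
function `K_{it}(a)`. -/
def besselMoment (t : ℝ) (j : ℕ) (a : ℝ) : ℝ :=
  ∫ s, Real.cosh s ^ j * Real.exp (-a * Real.cosh s) * Real.cos (t * s)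

theorem integrable_besselMoment (t : ℝ) (j : ℕ) {a : ℝ} (ha : 0 < a) :
    Integrable fun s ↦ Real.cosh s ^ j * Real.exp (-a * Real.cosh s) * Real.cos (t * s) := by
  have hc : Continuous fun s ↦ Real.cos (t * s) := by fun_prop
  exact (integrable_cosh_pow_mul_exp j ha).mul_bdd (c := 1) hc.aestronglyMeasurable
    (ae_of_all _ fun s ↦ Real.abs_cos_le_one _)

theorem hasDerivAt_besselMoment (t : ℝ) (j : ℕ) {a : ℝ} (ha : 0 < a) :
    HasDerivAt (besselMoment t j) (-besselMoment t (j + 1) a) a := by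
  have hmeas : ∀ j : ℕ, ∀ b : ℝ, AEStronglyMeasurable (fun s ↦
      Real.cosh s ^ j * Real.exp (-b * Real.cosh s) * Real.cos (t * s)) volume := fun j b ↦
    (by fun_prop : Continuous fun s ↦
      Real.cosh s ^ j * Real.exp (-b * Real.cosh s) * Real.cos (t * s)).aestronglyMeasurable
  have h := (hasDerivAt_integral_of_dominated_loc_of_deriv_le (μ := volume) (x₀ := a)
    (s := Ioi (a / 2)) (Ioi_mem_nhds (by linarith))
    (F := fun b s ↦ Real.cosh s ^ j * Real.exp (-b * Real.cosh s) * Real.cos (t * s))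
    (F' := fun b s ↦ -(Real.cosh s ^ (j + 1) * Real.exp (-b * Real.cosh s) * Real.cos (t * s)))
    (bound := fun s ↦ Real.cosh s ^ (j + 1) * Real.exp (-(a / 2) * Real.cosh s))
    (Eventually.of_forall fun b ↦ hmeas j b) (integrable_besselMoment t j ha)
    (hmeas (j + 1) a).neg (ae_of_all _ fun s b hb ↦ ?_)
    (integrable_cosh_pow_mul_exp (j + 1) (by positivity)) (ae_of_all _ fun s b hb ↦ ?_)).2
  · rwa [integral_neg] at h
  · have hcp := Real.cosh_pos s
    rw [norm_neg, norm_mul, Real.norm_of_nonneg (by positivity)]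
    refine (mul_le_of_le_one_right (by positivity) (Real.abs_cos_le_one _)).trans ?_
    have hb' : a / 2 < b := hb
    gcongr
  · refine ((((hasDerivAt_neg b).mul_const (Real.cosh s)).exp.const_mul
      (Real.cosh s ^ j)).mul_const _).congr_deriv ?_
    ring

/-- With `f = exp (-a cosh s)` and `g = cos (t s)`, this is the vanishing of the integral of `(f' g
- f g')' = f'' g - f g''` over the line. Since differentiation in `a` raises the moment, it is the
modified Bessel equation of order `it`. -/
theorem besselMoment_ode (t : ℝ) {a : ℝ} (ha : 0 < a) :
    a ^ 2 * besselMoment t 2 a = a ^ 2 * besselMoment t 0 a + a * besselMoment t 1 a -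
      t ^ 2 * besselMoment t 0 a := by
  have i0 := integrable_besselMoment t 0 ha
  have i1 := integrable_besselMoment t 1 ha
  have i2 := integrable_besselMoment t 2 ha
  have hderiv : ∀ s, HasDerivAt (fun s ↦ -a * (Real.sinh s * (Real.exp (-a * Real.cosh s) *
      Real.cos (t * s))) + t * (Real.exp (-a * Real.cosh s) * Real.sin (t * s)))
      (a ^ 2 * (Real.cosh s ^ 2 * Real.exp (-a * Real.cosh s) * Real.cos (t * s)) -
        a ^ 2 * (Real.cosh s ^ 0 * Real.exp (-a * Real.cosh s) * Real.cos (t * s)) -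
        a * (Real.cosh s ^ 1 * Real.exp (-a * Real.cosh s) * Real.cos (t * s)) +
        t ^ 2 * (Real.cosh s ^ 0 * Real.exp (-a * Real.cosh s) * Real.cos (t * s))) s := by
    intro s
    have he := ((Real.hasDerivAt_cosh s).const_mul (-a)).exp
    have hl : HasDerivAt (fun s ↦ t * s) t s := by
      simpa using (hasDerivAt_id s).const_mul t
    refine ((((Real.hasDerivAt_sinh s).mul (he.mul hl.cos)).const_mul (-a)).add
      ((he.mul hl.sin).const_mul t)).congr_deriv ?_
    have := Real.cosh_sq s
    simp only [Pi.mul_apply]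
    linear_combination (-(a ^ 2) * Real.exp (-a * Real.cosh s) * Real.cos (t * s)) * this
  have h1 := (i2.const_mul (a ^ 2)).sub' (i0.const_mul (a ^ 2))
  have h2 := h1.sub' (i1.const_mul a)
  have hf' := h2.fun_add (i0.const_mul (t ^ 2))
  have hf : Integrable fun s ↦ -a * (Real.sinh s * (Real.exp (-a * Real.cosh s) *
      Real.cos (t * s))) + t * (Real.exp (-a * Real.cosh s) * Real.sin (t * s)) := by
    refine (Integrable.const_mul ?_ _).add (Integrable.const_mul ?_ _)
    · refine Integrable.mono' (integrable_cosh_pow_mul_exp 1 ha)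
        (by fun_prop : Continuous fun s ↦ Real.sinh s * (Real.exp (-a * Real.cosh s) *
          Real.cos (t * s))).aestronglyMeasurable (ae_of_all _ fun s ↦ ?_)
      rw [norm_mul, norm_mul, Real.norm_of_nonneg (Real.exp_pos _).le, pow_one]
      have h1 : ‖Real.sinh s‖ ≤ Real.cosh s := by
        rw [Real.norm_eq_abs]
        exact abs_le_of_sq_le_sq (by rw [Real.cosh_sq]; linarith) (Real.cosh_pos s).le
      exact mul_le_mul h1 (mul_le_of_le_one_right (Real.exp_pos _).le (Real.abs_cos_le_one _))
        (by positivity) (Real.cosh_pos s).le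
    · refine Integrable.mono' (integrable_cosh_pow_mul_exp 0 ha)
        (by fun_prop : Continuous fun s ↦ Real.exp (-a * Real.cosh s) *
          Real.sin (t * s)).aestronglyMeasurable (ae_of_all _ fun s ↦ ?_)
      rw [norm_mul, Real.norm_of_nonneg (Real.exp_pos _).le, pow_zero, one_mul]
      exact mul_le_of_le_one_right (Real.exp_pos _).le (Real.abs_sin_le_one _)
  have h := integral_eq_zero_of_hasDerivAt_of_integrable hderiv hf' hf
  rw [integral_add h2 (i0.const_mul (t ^ 2)), integral_sub h1 (i1.const_mul a),
    integral_sub (i2.const_mul (a ^ 2)) (i0.const_mul (a ^ 2)),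
    integral_const_mul, integral_const_mul, integral_const_mul, integral_const_mul] at h
  change a ^ 2 * besselMoment t 2 a - a ^ 2 * besselMoment t 0 a - a * besselMoment t 1 a +
    t ^ 2 * besselMoment t 0 a = 0 at h
  linarith

/-- For large `a` the mass concentrates near `s = 0`, where the cosine is positive. Quantitatively,
`cos (t s) ≥ 1 - t² (cosh s - 1)`, and the mean of `cosh s - 1` is at most `1 / (2a - 1)`. -/
theorem besselMoment_zero_pos (t : ℝ) {a : ℝ} (ha : 0 < a) (hat : t ^ 2 < 2 * a - 1) :
    0 < besselMoment t 0 a := by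
  have e0 : ∀ s, Real.cosh s ^ 0 * Real.exp (-a * Real.cosh s) = Real.exp (-a * Real.cosh s) :=
    fun s ↦ by rw [pow_zero, one_mul]
  have i0 : Integrable fun s ↦ Real.exp (-a * Real.cosh s) := by
    simpa only [e0] using integrable_cosh_pow_mul_exp 0 ha
  have i1 : Integrable fun s ↦ Real.cosh s * Real.exp (-a * Real.cosh s) := by
    simpa only [pow_one] using integrable_cosh_pow_mul_exp 1 ha
  have ib : Integrable fun s ↦ (Real.cosh s - 1) * Real.exp (-a * Real.cosh s) := by
    simpa only [sub_mul, one_mul] using i1.sub' i0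
  set I := ∫ s, Real.exp (-a * Real.cosh s) with hI
  set J := ∫ s, (Real.cosh s - 1) * Real.exp (-a * Real.cosh s) with hJ
  have hIpos : 0 < I := by
    rw [hI, integral_pos_iff_support_of_nonneg (fun s ↦ (Real.exp_pos _).le) i0]
    have : Function.support (fun s ↦ Real.exp (-a * Real.cosh s)) = univ := by
      ext s; simp [(Real.exp_pos _).ne']
    rw [this]; simp
  -- The moment equation at `t = 0`, combined with `cosh² s ≥ 1 + 2 (cosh s - 1)`.
  have hJI : (2 * a - 1) * J ≤ I := by
    have h1 := besselMoment_ode 0 ha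
    have i2 := integrable_cosh_pow_mul_exp 2 ha
    have b0 : besselMoment 0 0 a = I := by simp [besselMoment, hI]
    have b1 : besselMoment 0 1 a = J + I := by
      rw [hJ, hI, ← integral_add ib i0]
      simp only [besselMoment]
      congr 1; funext s; simp; ring
    have b2 : I + (J + J) + I ≤ besselMoment 0 2 a + I := by
      have : I + (J + J) ≤ besselMoment 0 2 a := by
        rw [hJ, hI, ← integral_add ib ib, ← integral_add i0 (ib.fun_add ib)]
        simp only [besselMoment, zero_mul, Real.cos_zero, mul_one]
        refine integral_mono (i0.fun_add (ib.fun_add ib)) i2 fun s ↦ ?_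
        have := Real.exp_pos (-a * Real.cosh s)
        nlinarith [mul_nonneg (sq_nonneg (Real.cosh s - 1)) this.le]
      linarith
    rw [b0, b1] at h1
    have h3 : a ^ 2 * (I + (J + J)) ≤ a ^ 2 * besselMoment 0 2 a := by
      apply mul_le_mul_of_nonneg_left _ (by positivity); linarith
    have h4 : a * (a * (2 * J)) ≤ a * (J + I) := by nlinarith
    have h5 := le_of_mul_le_mul_left h4 ha
    linarith
  have hB : I - t ^ 2 * J ≤ besselMoment t 0 a := by
    rw [hI, hJ, ← integral_const_mul, ← integral_sub i0 (ib.const_mul _)]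
    refine integral_mono (i0.sub (ib.const_mul _)) (integrable_besselMoment t 0 ha) fun s ↦ ?_
    simp only [e0]
    have h1 : 1 - (t * s) ^ 2 / 2 ≤ Real.cos (t * s) := Real.one_sub_sq_div_two_le_cos
    have h2 := one_add_sq_div_two_le_cosh s
    have h3 : 1 - t ^ 2 * (Real.cosh s - 1) ≤ Real.cos (t * s) := by
      nlinarith [mul_le_mul_of_nonneg_left h2 (sq_nonneg t)]
    nlinarith [mul_le_mul_of_nonneg_left h3 (Real.exp_pos (-a * Real.cosh s)).le]
  have hJ0 : 0 ≤ J := integral_nonneg fun s ↦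
    mul_nonneg (by linarith [Real.one_le_cosh s]) (Real.exp_pos _).le
  have h6 : 0 < 2 * a - 1 := by linarith [sq_nonneg t]
  have h7 : (2 * a - 1) * (t ^ 2 * J) < (2 * a - 1) * I := by
    nlinarith [mul_le_mul_of_nonneg_left hJI (sq_nonneg t), mul_lt_mul_of_pos_right hat hIpos]
  linarith [lt_of_mul_lt_mul_left h7 h6.le]

/-- Exponential decay in `a`: since `cosh s ≥ 1`, a factor `exp (-(a - 1))` splits off. -/
theorem abs_besselMoment_le (t : ℝ) (j : ℕ) {a : ℝ} (ha : 1 ≤ a) :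
    |besselMoment t j a| ≤
      Real.exp (-(a - 1)) * ∫ s, Real.cosh s ^ j * Real.exp (-1 * Real.cosh s) := by
  rw [← integral_const_mul]
  rw [← Real.norm_eq_abs, besselMoment]
  refine norm_integral_le_of_norm_le ((integrable_cosh_pow_mul_exp j one_pos).const_mul _)
    (ae_of_all _ fun s ↦ ?_)
  have hcp := Real.cosh_pos s
  rw [norm_mul, Real.norm_of_nonneg (by positivity)]
  refine (mul_le_of_le_one_right (by positivity) (Real.abs_cos_le_one _)).trans ?_
  rw [mul_left_comm, ← Real.exp_add]
  gcongr
  nlinarith [Real.one_le_cosh s]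

theorem tendsto_sqrt_mul_besselMoment (t : ℝ) (j : ℕ) {k : ℝ} (hk : 0 < k) :
    Tendsto (fun y ↦ √y * besselMoment t j (k * y)) atTop (𝓝 0) := by
  set C := ∫ s, Real.cosh s ^ j * Real.exp (-1 * Real.cosh s) with hC
  have hC0 : 0 ≤ C := integral_nonneg fun s ↦ by have := Real.cosh_pos s; positivity
  have h1 : Tendsto (fun y : ℝ ↦ y ^ (1 / 2 : ℝ) * Real.exp (-k * y)) atTop (𝓝 0) :=
    tendsto_rpow_mul_exp_neg_mul_atTop_nhds_zero _ _ hk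
  have h2 := h1.mul_const (Real.exp 1 * C)
  rw [zero_mul] at h2
  refine squeeze_zero_norm' ?_ h2
  filter_upwards [eventually_ge_atTop (1 / k)] with y hy
  have hky : 1 ≤ k * y := by rwa [div_le_iff₀' hk] at hy
  have h3 := abs_besselMoment_le t j hky
  rw [norm_mul, Real.norm_of_nonneg (Real.sqrt_nonneg _), ← Real.sqrt_eq_rpow, Real.norm_eq_abs,
    mul_assoc]
  refine mul_le_mul_of_nonneg_left (h3.trans (le_of_eq ?_)) (Real.sqrt_nonneg _)
  rw [← mul_assoc, ← Real.exp_add]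
  congr 2; ring

end Bessel

/-! ### Energy of decaying solutions of the mode equation -/

section ModeEquation

open Set Filter Topology

/-- `u` is a decaying solution, not eventually zero, of `u'' = (k² - lam / y²) u` on the half-line;
`v` is its derivative. -/
structure IsDecayingMode (k lam : ℝ) (u v : ℝ → ℝ) : Prop where
  hasDerivAt : ∀ y, 0 < y → HasDerivAt u (v y) y
  hasDerivAt_deriv : ∀ y, 0 < y → HasDerivAt v ((k ^ 2 - lam / y ^ 2) * u y) y
  tendsto : Tendsto u atTop (𝓝 0)
  tendsto_deriv : Tendsto v atTop (𝓝 0)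
  pos : ∀ᶠ y in atTop, 0 < u y

/-- The energy `u'² + (lam / y² - k²) u²`. -/
def modeEnergy (k lam : ℝ) (u v : ℝ → ℝ) (y : ℝ) : ℝ :=
  v y ^ 2 + (lam / y ^ 2 - k ^ 2) * u y ^ 2

variable {k lam : ℝ} {u v : ℝ → ℝ}

theorem IsDecayingMode.hasDerivAt_energy (h : IsDecayingMode k lam u v) {y : ℝ} (hy : 0 < y) :
    HasDerivAt (modeEnergy k lam u v) (-(2 * lam / y ^ 3 * u y ^ 2)) y := by
  have hy0 := hy.ne'
  refine (((h.hasDerivAt_deriv y hy).fun_pow 2).fun_add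
    ((((hasDerivAt_const y lam).fun_div (hasDerivAt_pow 2 y) (pow_ne_zero 2 hy0)).sub_const
      (k ^ 2)).fun_mul ((h.hasDerivAt y hy).fun_pow 2))).congr_deriv ?_
  field_simp
  push_cast
  ring

theorem IsDecayingMode.tendsto_energy (h : IsDecayingMode k lam u v) :
    Tendsto (modeEnergy k lam u v) atTop (𝓝 0) := by
  have h1 : Tendsto (fun y : ℝ ↦ lam / y ^ 2) atTop (𝓝 0) :=
    tendsto_const_nhds.div_atTop (tendsto_pow_atTop two_ne_zero)
  have h2 := (h.tendsto_deriv.pow 2).add ((h1.sub_const (k ^ 2)).mul (h.tendsto.pow 2))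
  simp only [ne_eq, OfNat.ofNat_ne_zero, not_false_eq_true, zero_pow, mul_zero, add_zero] at h2
  exact h2

theorem IsDecayingMode.antitoneOn_energy (h : IsDecayingMode k lam u v) (hlam : 0 < lam) :
    AntitoneOn (modeEnergy k lam u v) (Ioi 0) := by
  refine antitoneOn_of_hasDerivWithinAt_nonpos (convex_Ioi 0)
    (fun y hy ↦ (h.hasDerivAt_energy hy).continuousAt.continuousWithinAt)
    (fun y hy ↦ (h.hasDerivAt_energy (interior_subset hy)).hasDerivWithinAt) fun y hy ↦ ?_
  have hy' : 0 < y := interior_subset hy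
  have : 0 ≤ 2 * lam / y ^ 3 * u y ^ 2 := by positivity
  linarith

theorem IsDecayingMode.energy_nonneg (h : IsDecayingMode k lam u v) (hlam : 0 < lam) {y : ℝ}
    (hy : 0 < y) : 0 ≤ modeEnergy k lam u v y := by
  refine le_of_tendsto h.tendsto_energy ?_
  filter_upwards [eventually_ge_atTop y] with z hz
  exact h.antitoneOn_energy hlam hy (hy.trans_le hz) hz

/-- The energy is nonnegative and nonincreasing, so a zero would make it vanish from there on. Its
derivative, a negative multiple of `u²`, would then vanish too, against eventual positivity of `u`.
-/
theorem IsDecayingMode.energy_pos (h : IsDecayingMode k lam u v) (hlam : 0 < lam) {y : ℝ}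
    (hy : 0 < y) : 0 < modeEnergy k lam u v y := by
  refine (h.energy_nonneg hlam hy).lt_of_ne' fun h0 ↦ ?_
  obtain ⟨z, hz, hyz⟩ := (h.pos.and (eventually_gt_atTop y)).exists
  have hzero : ∀ x, y ≤ x → modeEnergy k lam u v x = 0 := fun x hx ↦
    le_antisymm (h0 ▸ h.antitoneOn_energy hlam hy (hy.trans_le hx) hx)
      (h.energy_nonneg hlam (hy.trans_le hx))
  have hz0 := hy.trans hyz
  have h1 : HasDerivAt (modeEnergy k lam u v) 0 z := by
    refine (hasDerivAt_const z (0 : ℝ)).congr_of_eventuallyEq ?_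
    filter_upwards [Ioi_mem_nhds hyz] with x hx
    exact hzero x (le_of_lt hx)
  have h2 := h1.unique (h.hasDerivAt_energy hz0)
  have : 0 < 2 * lam / z ^ 3 * u z ^ 2 := by positivity
  linarith

/-- The energy tends to `0`, so its value at `Y` is the total of its losses. This is the equality
behind the optimal weight. -/
theorem IsDecayingMode.integral_energy (h : IsDecayingMode k lam u v) (hlam : 0 < lam) {Y : ℝ}
    (hY : 0 < Y) : IntegrableOn (fun y ↦ 2 * lam / y ^ 3 * u y ^ 2) (Ioi Y) ∧
      ∫ y in Ioi Y, 2 * lam / y ^ 3 * u y ^ 2 = modeEnergy k lam u v Y := by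
  have hneg : ∀ y ∈ Ioi Y, -(2 * lam / y ^ 3 * u y ^ 2) ≤ 0 := fun y hy ↦ by
    have hy' : 0 < y := hY.trans hy
    have : 0 ≤ 2 * lam / y ^ 3 * u y ^ 2 := by positivity
    linarith
  have hc : ContinuousWithinAt (modeEnergy k lam u v) (Ici Y) Y :=
    (h.hasDerivAt_energy hY).continuousAt.continuousWithinAt
  have hd : ∀ y ∈ Ioi Y, HasDerivAt (modeEnergy k lam u v) (-(2 * lam / y ^ 3 * u y ^ 2)) y :=
    fun y hy ↦ h.hasDerivAt_energy (hY.trans hy)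
  have h1 := integrableOn_Ioi_deriv_of_nonpos hc hd hneg h.tendsto_energy
  have h2 := integral_Ioi_of_hasDerivAt_of_nonpos hc hd hneg h.tendsto_energy
  rw [integral_neg] at h2
  refine ⟨?_, by linarith⟩
  simpa using h1.neg

/-- The condition on `lam` makes `k²` at most half of `lam / y²` up to height `b`. -/
theorem potential_ge {b y : ℝ} (hy : 0 < y) (hyb : y ≤ b) (hlam : 2 * k ^ 2 * b ^ 2 ≤ lam) :
    lam / (2 * y ^ 2) ≤ lam / y ^ 2 - k ^ 2 := by
  have h1 : k ^ 2 ≤ lam / (2 * y ^ 2) := by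
    rw [le_div_iff₀ (by positivity)]
    have : y ^ 2 ≤ b ^ 2 := by gcongr
    nlinarith [mul_le_mul_of_nonneg_left this (sq_nonneg k)]
  have h2 : lam / y ^ 2 = lam / (2 * y ^ 2) + lam / (2 * y ^ 2) := by
    field_simp; ring
  linarith

theorem sq_le_energy {b y : ℝ} (hy : 0 < y) (hyb : y ≤ b) (hlam0 : 0 < lam)
    (hlam : 2 * k ^ 2 * b ^ 2 ≤ lam) : lam * u y ^ 2 ≤ 2 * y ^ 2 * modeEnergy k lam u v y := by
  have h1 := mul_le_mul_of_nonneg_right (potential_ge hy hyb hlam) (sq_nonneg (u y))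
  have h2 : lam / (2 * y ^ 2) * u y ^ 2 ≤ modeEnergy k lam u v y := by
    rw [modeEnergy]; linarith [sq_nonneg (v y)]
  have h3 : lam * u y ^ 2 = 2 * y ^ 2 * (lam / (2 * y ^ 2) * u y ^ 2) := by field_simp
  rw [h3]
  gcongr

/-- Where the potential is at least `lam / (2 y²)`, the energy controls `lam u²`, whence `H' ≥ -4 H
/ y`. So `y⁴ H` is nondecreasing, and the energies at `Y` and `b` are comparable uniformly in `lam`.
-/
theorem IsDecayingMode.energy_mul_pow_le (h : IsDecayingMode k lam u v) (hlam0 : 0 < lam)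
    {Y b : ℝ} (hY : 0 < Y) (hYb : Y ≤ b) (hlam : 2 * k ^ 2 * b ^ 2 ≤ lam) :
    Y ^ 4 * modeEnergy k lam u v Y ≤ b ^ 4 * modeEnergy k lam u v b := by
  have hd : ∀ y, 0 < y → HasDerivAt (fun y ↦ y ^ 4 * modeEnergy k lam u v y)
      (4 * y ^ 3 * modeEnergy k lam u v y - 2 * y * (lam * u y ^ 2)) y := fun y hy ↦ by
    refine ((hasDerivAt_pow 4 y).fun_mul (h.hasDerivAt_energy hy)).congr_deriv ?_
    field_simp
    push_cast
    ring
  refine monotoneOn_of_hasDerivWithinAt_nonneg (convex_Icc Y b)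
    (fun y hy ↦ (hd y (hY.trans_le hy.1)).continuousAt.continuousWithinAt)
    (fun y hy ↦ (hd y (hY.trans_le (interior_subset hy).1)).hasDerivWithinAt) (fun y hy ↦ ?_)
    (left_mem_Icc.mpr hYb) (right_mem_Icc.mpr hYb) hYb
  have hy' : y ∈ Icc Y b := interior_subset hy
  have hy0 : 0 < y := hY.trans_le hy'.1
  have h1 := sq_le_energy (u := u) (v := v) hy0 hy'.2 hlam0 hlam
  have h2 := mul_le_mul_of_nonneg_left h1 (by positivity : 0 ≤ 2 * y)
  linarith

/-- Equipartition of energy gives a lower bound for the mass of a decaying mode. -/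
theorem IsDecayingMode.mass_ge (h : IsDecayingMode k lam u v) (hlam0 : 0 < lam) {Y a b : ℝ}
    (hY : 0 < Y) (hYa : Y ≤ a) (hab : a < b) (hlam : 2 * k ^ 2 * b ^ 2 ≤ lam)
    (hlam' : 8 * ((b / Y) ^ 4) ^ 2 * b ^ 2 / (b - a) ^ 2 ≤ lam) :
    modeEnergy k lam u v b * (b - a) / 4 ≤ lam * ∫ y in a..b, u y ^ 2 / y ^ 2 := by
  have ha : 0 < a := hY.trans_le hYa
  have hb : 0 < b := ha.trans hab
  have hpos : ∀ y ∈ Icc a b, 0 < y := fun y hy ↦ ha.trans_le hy.1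
  set H := modeEnergy k lam u v with hH
  set M := (b / Y) ^ 4 with hM
  have hM0 : 0 < M := by positivity
  have hHb : 0 ≤ H b := h.energy_nonneg hlam0 hb
  have cu : ContinuousOn u (Icc a b) := fun y hy ↦
    (h.hasDerivAt y (hpos y hy)).continuousAt.continuousWithinAt
  have cv : ContinuousOn v (Icc a b) := fun y hy ↦
    (h.hasDerivAt_deriv y (hpos y hy)).continuousAt.continuousWithinAt
  have cH : ContinuousOn H (Icc a b) := fun y hy ↦
    (h.hasDerivAt_energy (hpos y hy)).continuousAt.continuousWithinAt
  have cq : ContinuousOn (fun y ↦ lam / y ^ 2) (Icc a b) :=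
    continuousOn_const.div (by fun_prop) fun y hy ↦ pow_ne_zero 2 (hpos y hy).ne'
  have ci : ∀ {f : ℝ → ℝ}, ContinuousOn f (Icc a b) → IntervalIntegrable f volume a b := fun hf ↦
    ContinuousOn.intervalIntegrable (by rwa [uIcc_of_le hab.le])
  have iqu : IntervalIntegrable (fun y ↦ (lam / y ^ 2 - k ^ 2) * u y ^ 2) volume a b :=
    ci ((cq.sub continuousOn_const).mul (cu.pow 2))
  have ivv : IntervalIntegrable (fun y ↦ v y ^ 2) volume a b := ci (cv.pow 2)
  -- Equipartition: the difference of kinetic and potential energy is the derivative of `u u'`, so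
  -- it integrates to boundary terms.
  have equi : (∫ y in a..b, (v y ^ 2 - (lam / y ^ 2 - k ^ 2) * u y ^ 2)) = u b * v b - u a * v a :=
    intervalIntegral.integral_eq_sub_of_hasDerivAt (f := fun y ↦ u y * v y) (fun y hy ↦ by
      rw [uIcc_of_le hab.le] at hy
      exact ((h.hasDerivAt y (hpos y hy)).fun_mul
        (h.hasDerivAt_deriv y (hpos y hy))).congr_deriv (by ring)) (ivv.sub iqu)
  have total : (b - a) * H b ≤ ∫ y in a..b, (v y ^ 2 + (lam / y ^ 2 - k ^ 2) * u y ^ 2) := by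
    have := intervalIntegral.integral_mono_on hab.le (intervalIntegrable_const (c := H b)) (ci cH)
      fun y hy ↦ h.antitoneOn_energy hlam0 (hpos y hy) hb hy.2
    rwa [intervalIntegral.integral_const, smul_eq_mul] at this
  rw [intervalIntegral.integral_sub ivv iqu] at equi
  rw [intervalIntegral.integral_add ivv iqu] at total
  have upper : (∫ y in a..b, (lam / y ^ 2 - k ^ 2) * u y ^ 2) ≤
      lam * ∫ y in a..b, u y ^ 2 / y ^ 2 := by
    rw [← intervalIntegral.integral_const_mul]
    refine intervalIntegral.integral_mono_on hab.le iqu (ci (continuousOn_const.mul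
      ((cu.pow 2).div (by fun_prop) fun y hy ↦ pow_ne_zero 2 (hpos y hy).ne'))) fun y _ ↦ ?_
    have : lam * (u y ^ 2 / y ^ 2) = lam / y ^ 2 * u y ^ 2 := by ring
    rw [this]
    nlinarith [mul_nonneg (sq_nonneg k) (sq_nonneg (u y))]
  have hHM : ∀ y, Y ≤ y → y ≤ b → H y ≤ M * H b := fun y hy _ ↦ by
    have h1 := h.energy_mul_pow_le hlam0 hY (hYa.trans hab.le) hlam
    have h2 : H y ≤ H Y := h.antitoneOn_energy hlam0 hY (hY.trans_le hy) hy
    have h3 : M * H b = b ^ 4 * H b / Y ^ 4 := by rw [hM]; field_simp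
    rw [h3]
    refine h2.trans ?_
    rw [le_div_iff₀ (by positivity)]
    linarith
  -- Chosen so that the boundary terms, at most `M H(b) / σ`, take up at most half of the total
  -- energy `(b - a) H(b)`; the second lower bound on `lam` ensures `σ²` is below the potential.
  set σ := 2 * M / (b - a) with hσ
  have hba : 0 < b - a := sub_pos.mpr hab
  have hσ0 : 0 < σ := by positivity
  have hσq : ∀ y, Y ≤ y → y ≤ b → σ ^ 2 ≤ lam / y ^ 2 - k ^ 2 := fun y hy hyb ↦ by
    have hy0 := hY.trans_le hy
    refine le_trans ?_ (potential_ge hy0 hyb hlam)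
    rw [le_div_iff₀ (by positivity)]
    refine le_trans ?_ hlam'
    have : y ^ 2 ≤ b ^ 2 := by gcongr
    calc σ ^ 2 * (2 * y ^ 2) ≤ σ ^ 2 * (2 * b ^ 2) := by gcongr
      _ = 8 * M ^ 2 * b ^ 2 / (b - a) ^ 2 := by rw [hσ]; field_simp; ring
  have cross : ∀ y, Y ≤ y → y ≤ b → 2 * σ * |u y * v y| ≤ M * H b := fun y hy hyb ↦ by
    refine le_trans ?_ (hHM y hy hyb)
    have h1 := mul_le_mul_of_nonneg_right (hσq y hy hyb) (sq_nonneg (u y))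
    have h2 : 2 * σ * |u y * v y| ≤ v y ^ 2 + σ ^ 2 * u y ^ 2 := by
      rw [abs_mul, ← sq_abs (v y), ← sq_abs (u y)]
      nlinarith [sq_nonneg (|v y| - σ * |u y|)]
    rw [hH, modeEnergy]; linarith
  have hc1 := cross b (hYa.trans hab.le) le_rfl
  have hc2 := cross a hYa hab.le
  have hcc : σ * (u b * v b - u a * v a) ≤ M * H b := by
    nlinarith [le_abs_self (u b * v b), neg_abs_le (u a * v a)]
  have hcd : u b * v b - u a * v a ≤ (b - a) * H b / 2 := by
    refine le_of_mul_le_mul_left (hcc.trans (le_of_eq ?_)) hσ0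
    rw [hσ]; field_simp
  linarith

end ModeEquation

/-! ### The Bessel functions as decaying modes -/

section BesselMode

open Set Filter Topology

theorem isDecayingMode_bessel (t : ℝ) {k : ℝ} (hk : 0 < k) :
    IsDecayingMode k (1 / 4 + t ^ 2) (fun y ↦ √y * besselMoment t 0 (k * y))
      (fun y ↦ 1 / (2 * √y) * besselMoment t 0 (k * y) - k * (√y * besselMoment t 1 (k * y))) where
  hasDerivAt y hy := by
    have hb := (hasDerivAt_besselMoment t 0 (mul_pos hk hy)).comp y
      ((hasDerivAt_id y).const_mul k)
    refine ((Real.hasDerivAt_sqrt hy.ne').fun_mul hb).congr_deriv ?_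
    simp only [Function.comp]
    ring
  hasDerivAt_deriv y hy := by
    have hb0 := (hasDerivAt_besselMoment t 0 (mul_pos hk hy)).comp y
      ((hasDerivAt_id y).const_mul k)
    have hb1 := (hasDerivAt_besselMoment t 1 (mul_pos hk hy)).comp y
      ((hasDerivAt_id y).const_mul k)
    have hs := Real.hasDerivAt_sqrt hy.ne'
    have hs0 : √y ≠ 0 := (Real.sqrt_pos.mpr hy).ne'
    have hi := (hasDerivAt_const y (1 : ℝ)).fun_div (hs.const_mul 2)
      (mul_ne_zero two_ne_zero hs0)
    refine ((hi.fun_mul hb0).fun_sub ((hs.fun_mul hb1).const_mul k)).congr_deriv ?_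
    have hode := besselMoment_ode t (mul_pos hk hy)
    simp only [Function.comp]
    generalize besselMoment t 0 (k * y) = b0 at *
    generalize besselMoment t 1 (k * y) = b1 at *
    norm_num
    generalize besselMoment t 2 (k * y) = b2 at *
    have hy2 : y = √y ^ 2 := (Real.sq_sqrt hy.le).symm
    generalize √y = r at *
    subst hy2
    field_simp
    linear_combination 16 * hode
  tendsto := tendsto_sqrt_mul_besselMoment t 0 hk
  tendsto_deriv := by
    have h0 := tendsto_sqrt_mul_besselMoment t 0 hk
    have h1 := tendsto_sqrt_mul_besselMoment t 1 hk
    have h2 : Tendsto (fun y : ℝ ↦ 1 / 2 * y⁻¹) atTop (𝓝 0) := by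
      have := (tendsto_inv_atTop_zero (𝕜 := ℝ)).const_mul (1 / 2)
      rwa [mul_zero] at this
    have h3 := (h2.mul h0).sub (h1.const_mul k)
    rw [mul_zero, mul_zero, sub_zero] at h3
    refine h3.congr' ?_
    filter_upwards [eventually_gt_atTop 0] with y hy
    have hs0 : √y ≠ 0 := (Real.sqrt_pos.mpr hy).ne'
    have hy2 : y⁻¹ = (√y ^ 2)⁻¹ := by rw [Real.sq_sqrt hy.le]
    rw [hy2]
    field_simp
  pos := by
    filter_upwards [eventually_gt_atTop ((1 + t ^ 2) / k)] with y hy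
    have hy0 : 0 < y := lt_trans (by positivity) hy
    rw [div_lt_iff₀' hk] at hy
    exact mul_pos (Real.sqrt_pos.mpr hy0)
      (besselMoment_zero_pos t (mul_pos hk hy0) (by nlinarith [sq_nonneg t]))

end BesselMode

/-! ### An excessive weight contradicts large eigenvalues -/

section Sharpness

open Set Filter Topology

variable {k lam : ℝ} {u v : ℝ → ℝ}

/-- Subtracting the exact identity for the weight `Y / y` from the assumed inequality leaves the
mass against the excess `α G - Y / y ≥ 0`, of which only the part over `[a, b]` is kept. -/
theorem IsDecayingMode.weighted_mass_le (h : IsDecayingMode k lam u v) (hlam0 : 0 < lam)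
    {Y a b c α : ℝ} {G : ℝ → ℝ} (hY : 0 < Y) (hYa : Y ≤ a) (hab : a < b)
    (hint : IntegrableOn (fun y ↦ (y ^ 2)⁻¹ * (u y ^ 2 * G y)) (Ioi Y))
    (hle : 2 * α * ∫ y in Ioi Y, (y ^ 2)⁻¹ * (u y ^ 2 * G y) ≤
      Y⁻¹ * u Y ^ 2 + lam⁻¹ * (Y * v Y ^ 2))
    (hδ : ∀ y, Y ≤ y → Y * y⁻¹ ≤ α * G y)
    (hc : ∀ y ∈ Icc a b, c ≤ α * G y - Y * y⁻¹) :
    2 * lam * c * ∫ y in a..b, u y ^ 2 / y ^ 2 ≤ Y * k ^ 2 * u Y ^ 2 := by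
  obtain ⟨i1, e1⟩ := h.integral_energy hlam0 hY
  set J := ∫ y in Ioi Y, (y ^ 2)⁻¹ * (u y ^ 2 * G y) with hJ
  have i2 := (hint.const_mul (2 * lam * α)).sub' (i1.const_mul Y)
  have e2 : ∫ y in Ioi Y, (2 * lam * α * ((y ^ 2)⁻¹ * (u y ^ 2 * G y)) -
      Y * (2 * lam / y ^ 3 * u y ^ 2)) = 2 * lam * α * J - Y * modeEnergy k lam u v Y := by
    rw [integral_sub (hint.const_mul _) (i1.const_mul Y), integral_const_mul, integral_const_mul,
      e1]
  have hform : ∀ y, 0 < y → 2 * lam * α * ((y ^ 2)⁻¹ * (u y ^ 2 * G y)) -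
      Y * (2 * lam / y ^ 3 * u y ^ 2) = 2 * lam * (u y ^ 2 / y ^ 2) * (α * G y - Y * y⁻¹) :=
    fun y hy ↦ by field_simp
  have hnn : ∀ y ∈ Ioi Y, 0 ≤ 2 * lam * α * ((y ^ 2)⁻¹ * (u y ^ 2 * G y)) -
      Y * (2 * lam / y ^ 3 * u y ^ 2) := fun y hy ↦ by
    rw [hform y (hY.trans hy)]
    have := sub_nonneg.mpr (hδ y (le_of_lt hy))
    positivity
  have hpos : ∀ y ∈ Icc a b, 0 < y := fun y hy ↦ (hY.trans_le hYa).trans_le hy.1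
  have hsub : Ioc a b ⊆ Ioi Y := fun y hy ↦ hYa.trans_lt hy.1
  have cu : ContinuousOn u (Icc a b) := fun y hy ↦
    (h.hasDerivAt y (hpos y hy)).continuousAt.continuousWithinAt
  have i3 : IntegrableOn (fun y ↦ u y ^ 2 / y ^ 2) (Ioc a b) :=
    (ContinuousOn.integrableOn_Icc ((cu.pow 2).div (by fun_prop)
      fun y hy ↦ pow_ne_zero 2 (hpos y hy).ne')).mono_set Ioc_subset_Icc_self
  have h1 : 2 * lam * c * ∫ y in a..b, u y ^ 2 / y ^ 2 ≤ ∫ y in Ioc a b,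
      (2 * lam * α * ((y ^ 2)⁻¹ * (u y ^ 2 * G y)) - Y * (2 * lam / y ^ 3 * u y ^ 2)) := by
    rw [intervalIntegral.integral_of_le hab.le, ← integral_const_mul]
    refine setIntegral_mono_on (i3.const_mul _) (IntegrableOn.mono_set i2 hsub) measurableSet_Ioc
      fun y hy ↦ ?_
    rw [hform y (hY.trans (hsub hy))]
    have h2 := mul_le_mul_of_nonneg_left (hc y (Ioc_subset_Icc_self hy))
      (by positivity : 0 ≤ 2 * lam * (u y ^ 2 / y ^ 2))
    linarith
  have h2 : ∫ y in Ioc a b,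
      (2 * lam * α * ((y ^ 2)⁻¹ * (u y ^ 2 * G y)) - Y * (2 * lam / y ^ 3 * u y ^ 2)) ≤
      ∫ y in Ioi Y,
      (2 * lam * α * ((y ^ 2)⁻¹ * (u y ^ 2 * G y)) - Y * (2 * lam / y ^ 3 * u y ^ 2)) := by
    refine setIntegral_mono_set i2 ?_ (LE.le.eventuallyLE hsub)
    filter_upwards [ae_restrict_mem measurableSet_Ioi] with y hy using hnn y hy
  rw [e2] at h2
  refine (h1.trans h2).trans ?_
  have h3 := mul_le_mul_of_nonneg_left hle hlam0.le
  -- The restricted norm is the boundary energy with the `-k² u²` term missing; this error is all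
  -- that remains on the right.
  have h4 : lam * (Y⁻¹ * u Y ^ 2 + lam⁻¹ * (Y * v Y ^ 2)) =
      Y * modeEnergy k lam u v Y + Y * k ^ 2 * u Y ^ 2 := by
    rw [modeEnergy]; field_simp; ring
  linarith

/-- A weight that exceeds the optimal one on an interval is impossible once the eigenvalue of the
decaying modes is large. -/
theorem exists_eigenvalue_bound (k : ℝ) {Y a b c : ℝ} (hY : 0 < Y) (hYa : Y ≤ a) (hab : a < b)
    (hc : 0 < c) : ∃ L : ℝ, ∀ lam, 0 < lam → L ≤ lam → ∀ u v : ℝ → ℝ, IsDecayingMode k lam u v →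
      Y * k ^ 2 * u Y ^ 2 < 2 * lam * c * ∫ y in a..b, u y ^ 2 / y ^ 2 := by
  have hba : 0 < b - a := sub_pos.mpr hab
  have hYb : Y ≤ b := hYa.trans hab.le
  have hb : 0 < b := hY.trans_le hYb
  set M := (b / Y) ^ 4 with hM
  have hM0 : 0 < M := by positivity
  -- The first two thresholds are those of `IsDecayingMode.mass_ge`. The third makes the `O(H(b) /
  -- lam)` bound for `k² u(Y)²` smaller than the mass on `[a, b]`, and the `+ 1` makes this strict.
  refine ⟨max (max (2 * k ^ 2 * b ^ 2) (8 * M ^ 2 * b ^ 2 / (b - a) ^ 2))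
    (4 * Y ^ 3 * k ^ 2 * M / (c * (b - a)) + 1), fun lam hlam0 hL u v h ↦ ?_⟩
  have hL1 : 2 * k ^ 2 * b ^ 2 ≤ lam := le_trans (le_trans (le_max_left _ _) (le_max_left _ _)) hL
  have hL2 : 8 * M ^ 2 * b ^ 2 / (b - a) ^ 2 ≤ lam :=
    le_trans (le_trans (le_max_right _ _) (le_max_left _ _)) hL
  have hL3 : 4 * Y ^ 3 * k ^ 2 * M / (c * (b - a)) < lam :=
    lt_of_lt_of_le (lt_add_one _) (le_trans (le_max_right _ _) hL)
  have h1 := h.mass_ge hlam0 hY hYa hab hL1 hL2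
  have h2 := sq_le_energy (u := u) (v := v) hY hYb hlam0 hL1
  have h3 := h.energy_mul_pow_le hlam0 hY hYb hL1
  have hHb := h.energy_pos hlam0 hb
  set Hb := modeEnergy k lam u v b
  set HY := modeEnergy k lam u v Y
  have h4 : HY ≤ M * Hb := by
    have e : M * Hb = b ^ 4 * Hb / Y ^ 4 := by rw [hM]; field_simp
    rw [e, le_div_iff₀ (by positivity)]; linarith
  rw [div_lt_iff₀ (by positivity)] at hL3
  have h5 : lam * (Y * k ^ 2 * u Y ^ 2) ≤ 2 * Y ^ 3 * k ^ 2 * M * Hb := by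
    calc lam * (Y * k ^ 2 * u Y ^ 2) = Y * k ^ 2 * (lam * u Y ^ 2) := by ring
      _ ≤ Y * k ^ 2 * (2 * Y ^ 2 * (M * Hb)) := by
        refine mul_le_mul_of_nonneg_left (h2.trans ?_) (by positivity)
        gcongr
      _ = _ := by ring
  have h6 : 2 * Y ^ 3 * k ^ 2 * M * Hb < lam * (c * (Hb * (b - a)) / 2) := by nlinarith
  have h7 : c * (Hb * (b - a)) / 2 ≤ 2 * lam * c * ∫ y in a..b, u y ^ 2 / y ^ 2 := by
    have := mul_le_mul_of_nonneg_left h1 hc.le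
    linarith
  exact (lt_of_mul_lt_mul_left (h5.trans_lt h6) hlam0.le).trans_le h7

end Sharpness

/-! ### Cusp eigenfunctions built from modes, and sharpness -/

section CuspMode

open Set Filter Topology

variable {lam : ℝ} {u v : ℝ → ℝ}

/-- The function `u(y) cos (2 π x)`. -/
def modeFunction (𝕜 : Type*) [RCLike 𝕜] (u : ℝ → ℝ) (z : ℍ) : 𝕜 :=
  ((u z.im * Real.cos (2 * Real.pi * z.re) : ℝ) : 𝕜)

/-- The function `u(y) cos (2 π x)` in the coordinate `x + i y`. -/
def planeMode (u : ℝ → ℝ) (z : ℂ) : ℝ := u z.im * Real.cos (2 * Real.pi * z.re)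

theorem inCoord_modeFunction (𝕜 : Type*) [RCLike 𝕜] (u : ℝ → ℝ) {z : ℂ} (hz : 0 < z.im) :
    inCoord (modeFunction 𝕜 u) z = ((planeMode u z : ℝ) : 𝕜) := by
  rw [inCoord, modeFunction, ofComplex_apply_of_im_pos hz]
  rfl

/-- The equation bootstraps regularity: `u` is continuous, hence so is the derivative of `v`, hence
`u` is `C²`. -/
theorem IsDecayingMode.contDiffOn {k : ℝ} (h : IsDecayingMode k lam u v) :
    ContDiffOn ℝ 2 u (Ioi 0) := by
  have hu : EqOn (deriv u) v (Ioi 0) := fun y hy ↦ (h.hasDerivAt y hy).deriv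
  have hv : EqOn (deriv v) (fun y ↦ (k ^ 2 - lam / y ^ 2) * u y) (Ioi 0) := fun y hy ↦
    (h.hasDerivAt_deriv y hy).deriv
  have du : DifferentiableOn ℝ u (Ioi 0) := fun y hy ↦
    (h.hasDerivAt y hy).differentiableAt.differentiableWithinAt
  have dv : DifferentiableOn ℝ v (Ioi 0) := fun y hy ↦
    (h.hasDerivAt_deriv y hy).differentiableAt.differentiableWithinAt
  have h1 : ContDiffOn ℝ 1 v (Ioi 0) := by
    rw [show (1 : WithTop ℕ∞) = 0 + 1 by norm_num, contDiffOn_succ_iff_deriv_of_isOpen isOpen_Ioi]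
    refine ⟨dv, by simp, ?_⟩
    rw [contDiffOn_zero, continuousOn_congr hv]
    refine ContinuousOn.mul (continuousOn_const.sub (continuousOn_const.div (by fun_prop)
      fun y hy ↦ ?_)) du.continuousOn
    exact pow_ne_zero 2 (ne_of_gt hy)
  rw [show (2 : WithTop ℕ∞) = 1 + 1 by norm_num, contDiffOn_succ_iff_deriv_of_isOpen isOpen_Ioi]
  exact ⟨du, by simp, h1.congr hu⟩

theorem IsDecayingMode.contDiffOn_planeMode {k : ℝ} (h : IsDecayingMode k lam u v) :
    ContDiffOn ℝ 2 (planeMode u) {z | 0 < z.im} := by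
  have h1 : ContDiffOn ℝ 2 (fun z : ℂ ↦ u z.im) {z | 0 < z.im} :=
    h.contDiffOn.comp Complex.imCLM.contDiff.contDiffOn fun z hz ↦ hz
  have h2 : ContDiff ℝ 2 fun z : ℂ ↦ Real.cos (2 * Real.pi * z.re) :=
    Real.contDiff_cos.comp (contDiff_const.mul Complex.reCLM.contDiff)
  exact h1.mul h2.contDiffOn

theorem hasDerivAt_cos_two_pi (x : ℝ) : HasDerivAt (fun x ↦ Real.cos (2 * Real.pi * x))
    (-(2 * Real.pi * Real.sin (2 * Real.pi * x))) x := by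
  have h := ((hasDerivAt_id x).const_mul (2 * Real.pi)).cos
  refine h.congr_deriv ?_
  simp only [id]; ring

theorem hasDerivAt_sin_two_pi (x : ℝ) : HasDerivAt (fun x ↦ Real.sin (2 * Real.pi * x))
    (2 * Real.pi * Real.cos (2 * Real.pi * x)) x := by
  have h := ((hasDerivAt_id x).const_mul (2 * Real.pi)).sin
  refine h.congr_deriv ?_
  simp only [id]; ring

theorem IsDecayingMode.hasFDerivAt_planeMode {k : ℝ} (h : IsDecayingMode k lam u v) {z : ℂ}
    (hz : 0 < z.im) : HasFDerivAt (planeMode u)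
      ((v z.im * Real.cos (2 * Real.pi * z.re)) • Complex.imCLM +
        (-(u z.im * (2 * Real.pi * Real.sin (2 * Real.pi * z.re)))) • Complex.reCLM) z := by
  have h1 : HasFDerivAt (fun z : ℂ ↦ u z.im) (v z.im • Complex.imCLM) z :=
    (h.hasDerivAt z.im hz).comp_hasFDerivAt z Complex.imCLM.hasFDerivAt
  have h2 : HasFDerivAt (fun z : ℂ ↦ Real.cos (2 * Real.pi * z.re))
      (-(2 * Real.pi * Real.sin (2 * Real.pi * z.re)) • Complex.reCLM) z :=
    (hasDerivAt_cos_two_pi z.re).comp_hasFDerivAt z Complex.reCLM.hasFDerivAt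
  refine (h1.mul h2).congr_fderiv ?_
  ext1 w
  simp
  ring

theorem IsDecayingMode.laplacian_planeMode (h : IsDecayingMode (2 * Real.pi) lam u v) {z : ℂ}
    (hz : 0 < z.im) :
    Laplacian.laplacian (planeMode u) z = -(lam / z.im ^ 2 * planeMode u z) := by
  have hev : fderiv ℝ (planeMode u) =ᶠ[𝓝 z] fun z ↦
      ((v z.im * Real.cos (2 * Real.pi * z.re)) • Complex.imCLM +
        (-(u z.im * (2 * Real.pi * Real.sin (2 * Real.pi * z.re)))) • Complex.reCLM) := by
    filter_upwards [(isOpen_lt continuous_const Complex.continuous_im).mem_nhds hz] with w hw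
    exact (h.hasFDerivAt_planeMode hw).fderiv
  have h1 : HasFDerivAt (fun z : ℂ ↦ u z.im) (v z.im • Complex.imCLM) z :=
    (h.hasDerivAt z.im hz).comp_hasFDerivAt z Complex.imCLM.hasFDerivAt
  have h2 : HasFDerivAt (fun z : ℂ ↦ v z.im)
      ((((2 * Real.pi) ^ 2 - lam / z.im ^ 2) * u z.im) • Complex.imCLM) z :=
    (h.hasDerivAt_deriv z.im hz).comp_hasFDerivAt z Complex.imCLM.hasFDerivAt
  have h3 : HasFDerivAt (fun z : ℂ ↦ Real.cos (2 * Real.pi * z.re))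
      (-(2 * Real.pi * Real.sin (2 * Real.pi * z.re)) • Complex.reCLM) z :=
    (hasDerivAt_cos_two_pi z.re).comp_hasFDerivAt z Complex.reCLM.hasFDerivAt
  have h4 : HasFDerivAt (fun z : ℂ ↦ Real.sin (2 * Real.pi * z.re))
      ((2 * Real.pi * Real.cos (2 * Real.pi * z.re)) • Complex.reCLM) z :=
    (hasDerivAt_sin_two_pi z.re).comp_hasFDerivAt z Complex.reCLM.hasFDerivAt
  have h5 := ((h2.fun_mul h3).smul_const Complex.imCLM).fun_add
    (((h1.fun_mul (h4.const_mul (2 * Real.pi))).fun_neg).smul_const Complex.reCLM)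
  rw [laplacian_eq_fderiv_fderiv, hev.fderiv_eq, h5.fderiv, planeMode]
  simp
  ring

variable (𝕜 : Type*) [RCLike 𝕜]

theorem IsDecayingMode.continuous_modeFunction {k : ℝ} (h : IsDecayingMode k lam u v) :
    Continuous (modeFunction 𝕜 u) := by
  refine RCLike.continuous_ofReal.comp (Continuous.mul ?_ ?_)
  · exact h.contDiffOn.continuousOn.comp_continuous continuous_im fun z ↦ z.im_pos
  · have := continuous_re
    fun_prop

theorem IsDecayingMode.exists_bound {k : ℝ} (h : IsDecayingMode k lam u v) {A : ℝ} (hA : 0 < A) :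
    ∃ C, ∀ y, A ≤ y → |u y| ≤ C := by
  obtain ⟨T, hT⟩ := eventually_atTop.mp (h.tendsto.eventually (Metric.ball_mem_nhds 0 one_pos))
  obtain ⟨C, hC⟩ := (isCompact_Icc (a := A) (b := T)).exists_bound_of_continuousOn
    (h.contDiffOn.continuousOn.mono fun y hy ↦ hA.trans_le hy.1)
  refine ⟨max C 1, fun y hy ↦ ?_⟩
  rcases le_total y T with hyT | hyT
  · exact (hC y ⟨hy, hyT⟩).trans (le_max_left _ _)
  · have := hT y hyT
    rw [dist_zero_right, Real.norm_eq_abs] at this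
    exact (le_of_lt this).trans (le_max_right _ _)

theorem volume_cuspStrip_lt_top {A : ℝ} (hA : 0 < A) : volume (cuspStrip A) < ⊤ := by
  have h := (setIntegral_cuspStrip hA fun _ ↦ 1).2.mpr (by
    have h1 : IntegrableOn (fun s : ℝ ↦ (s ^ 2)⁻¹) (Ici A) := by
      rw [integrableOn_Ici_iff_integrableOn_Ioi]
      refine (integrableOn_Ioi_rpow_of_lt (by norm_num : (-2 : ℝ) < -1) hA).congr_fun
        (fun s hs ↦ ?_) measurableSet_Ioi
      have hs0 : 0 < s := hA.trans hs
      simp only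
      rw [Real.rpow_neg hs0.le, Real.rpow_two]
    have h2 : IntegrableOn (fun _ : ℝ ↦ (1 : ℝ)) (Ioc (-(1 / 2)) (1 / 2)) :=
      integrableOn_const (by simp)
    have h3 := Integrable.mul_prod h1 h2
    rw [IntegrableOn, Measure.volume_eq_prod, ← Measure.prod_restrict]
    exact h3)
  rw [integrableOn_const_iff] at h
  simpa using h

theorem IsDecayingMode.isCuspEigenfunction (h : IsDecayingMode (2 * Real.pi) lam u v) {A : ℝ}
    (hA : 0 < A) : IsCuspEigenfunction A lam (modeFunction 𝕜 u) where
  eigenfunction :=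
    { contDiffOn := by
        rw [image_cuspRegion hA]
        refine ((RCLike.ofRealCLM (K := 𝕜)).contDiff.comp_contDiffOn
          (h.contDiffOn_planeMode.mono fun z hz ↦ hA.trans_le hz)).congr fun z hz ↦ ?_
        exact inCoord_modeFunction 𝕜 u (hA.trans_le hz)
      eigen := fun z _ ↦ by
        have hz := z.im_pos
        have hc := h.contDiffOn_planeMode.contDiffAt
          ((isOpen_lt continuous_const Complex.continuous_im).mem_nhds hz)
        have hev : inCoord (modeFunction 𝕜 u) =ᶠ[𝓝 (z : ℂ)]
            (RCLike.ofRealCLM (K := 𝕜)) ∘ planeMode u := by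
          filter_upwards [(isOpen_lt continuous_const Complex.continuous_im).mem_nhds hz]
            with w hw
          exact inCoord_modeFunction 𝕜 u hw
        rw [hypLaplacian, (InnerProductSpace.laplacian_congr_nhds hev).eq_of_nhds,
          hc.laplacian_CLM_comp_left, Function.comp, h.laplacian_planeMode hz]
        have hz0 : (z : ℂ).im ≠ 0 := hz.ne'
        have e : planeMode u z = u z.im * Real.cos (2 * Real.pi * z.re) := rfl
        rw [modeFunction, ← e, ← map_smul, ← map_neg, RCLike.ofRealCLM_apply,
          RCLike.real_smul_eq_coe_mul (K := 𝕜) lam, ← RCLike.ofReal_mul]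
        congr 1
        have e2 : z.im = (z : ℂ).im := rfl
        rw [e2, smul_eq_mul]
        field_simp }
  periodic z _ := by
    have h1 : ((1 : ℝ) +ᵥ z).im = z.im := UpperHalfPlane.vadd_im 1 z
    have h2 : ((1 : ℝ) +ᵥ z).re = 1 + z.re := UpperHalfPlane.vadd_re 1 z
    rw [modeFunction, modeFunction, h1, h2, mul_add, mul_one, add_comm, Real.cos_add_two_pi]
  memLp := by
    obtain ⟨C, hC⟩ := h.exists_bound hA
    have : IsFiniteMeasure (volume.restrict (cuspStrip A)) :=
      ⟨by rw [Measure.restrict_apply_univ]; exact volume_cuspStrip_lt_top hA⟩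
    refine MemLp.of_bound (h.continuous_modeFunction 𝕜).aestronglyMeasurable C ?_
    filter_upwards [ae_restrict_mem (measurableSet_cuspStrip A)] with z hz
    rw [modeFunction, RCLike.norm_ofReal, abs_mul]
    exact (mul_le_of_le_one_right (abs_nonneg _) (Real.abs_cos_le_one _)).trans (hC _ hz.2.2)

theorem IsDecayingMode.isZeroAtImInfty {k : ℝ} (h : IsDecayingMode k lam u v) :
    IsZeroAtImInfty (modeFunction 𝕜 u) := by
  have h1 : Tendsto (fun z : ℍ ↦ |u z.im|) atImInfty (𝓝 0) := by
    have := (h.tendsto.comp (tendsto_comap (f := UpperHalfPlane.im))).abs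
    rwa [abs_zero] at this
  refine squeeze_zero_norm (fun z ↦ ?_) h1
  rw [modeFunction, RCLike.norm_ofReal, abs_mul]
  exact mul_le_of_le_one_right (abs_nonneg _) (Real.abs_cos_le_one _)

theorem integral_cos_two_pi_sq :
    ∫ θ in (-(1 / 2) : ℝ)..1 / 2, Real.cos (2 * Real.pi * θ) ^ 2 = 1 / 2 := by
  have h2pi : (2 * Real.pi) ≠ 0 := by positivity
  rw [intervalIntegral.integral_comp_mul_left (fun x ↦ Real.cos x ^ 2) h2pi, integral_cos_sq]
  have e1 : 2 * Real.pi * (1 / 2) = Real.pi := by ring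
  have e2 : 2 * Real.pi * (-(1 / 2)) = -Real.pi := by ring
  rw [e1, e2, Real.sin_neg, Real.sin_pi, smul_eq_mul]
  field_simp
  ring

theorem IsDecayingMode.restrictedNorm_modeFunction {k : ℝ} (h : IsDecayingMode k lam u v) {A Y : ℝ}
    (hA : 0 < A) (hY : A ≤ Y) (hY0 : 0 < Y) :
    restrictedNorm (cuspRegion A) lam (modeFunction 𝕜 u) (horocycle Y hY0) (-(1 / 2)) (1 / 2) =
      1 / 2 * (Y⁻¹ * u Y ^ 2 + lam⁻¹ * (Y * v Y ^ 2)) := by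
  have him : ∀ θ : ℝ, ((θ : ℂ) + (Y : ℂ) * Complex.I).im = Y := fun θ ↦ by simp
  have hre : ∀ θ : ℝ, ((θ : ℂ) + (Y : ℂ) * Complex.I).re = θ := fun θ ↦ by simp
  have h1 : ∀ θ : ℝ, ‖inCoord (modeFunction 𝕜 u) ((θ : ℂ) + (Y : ℂ) * Complex.I)‖ ^ 2 =
      u Y ^ 2 * Real.cos (2 * Real.pi * θ) ^ 2 := fun θ ↦ by
    rw [inCoord_modeFunction 𝕜 u (by rw [him]; exact hY0), RCLike.norm_ofReal, sq_abs, planeMode,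
      him, hre, mul_pow]
  have h2 : ∀ θ : ℝ, ‖fderivWithin ℝ (inCoord (modeFunction 𝕜 u))
      (UpperHalfPlane.coe '' cuspRegion A) ((θ : ℂ) + (Y : ℂ) * Complex.I) Complex.I‖ ^ 2 =
      v Y ^ 2 * Real.cos (2 * Real.pi * θ) ^ 2 := fun θ ↦ by
    set z : ℂ := (θ : ℂ) + (Y : ℂ) * Complex.I with hz
    have hz0 : 0 < z.im := by rw [him]; exact hY0
    have hd : HasFDerivAt (inCoord (modeFunction 𝕜 u)) (RCLike.ofRealCLM (K := 𝕜) ∘L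
        ((v z.im * Real.cos (2 * Real.pi * z.re)) • Complex.imCLM +
        (-(u z.im * (2 * Real.pi * Real.sin (2 * Real.pi * z.re)))) • Complex.reCLM)) z := by
      refine ((RCLike.ofRealCLM (K := 𝕜)).hasFDerivAt.comp z
        (h.hasFDerivAt_planeMode hz0)).congr_of_eventuallyEq ?_
      filter_upwards [(isOpen_lt continuous_const Complex.continuous_im).mem_nhds hz0] with w hw
      exact inCoord_modeFunction 𝕜 u hw
    rw [hd.hasFDerivWithinAt.fderivWithin (uniqueDiffOn_image_cuspRegion hA z (by
      rw [image_cuspRegion hA]; exact hY.trans (him θ).ge)), him, hre]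
    simp [mul_pow]
  rw [restrictedNorm_horocycle hY0]
  simp only [h1, h2, intervalIntegral.integral_const_mul, integral_cos_two_pi_sq]
  ring

/-- The variables separate, and `cos²` contributes the same factor `1/2` as in the restricted norm,
so it cancels in the comparison. -/
theorem setIntegral_modeFunction {Y : ℝ} (hY : 0 < Y) (G : ℝ → ℝ) :
    (∫ z in cuspStrip Y, ‖modeFunction 𝕜 u z‖ ^ 2 * G z.im =
      1 / 2 * ∫ y in Ioi Y, (y ^ 2)⁻¹ * (u y ^ 2 * G y)) ∧
    (IntegrableOn (fun z ↦ ‖modeFunction 𝕜 u z‖ ^ 2 * G z.im) (cuspStrip Y) →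
      IntegrableOn (fun y ↦ (y ^ 2)⁻¹ * (u y ^ 2 * G y)) (Ioi Y)) := by
  obtain ⟨h1, h2⟩ := setIntegral_cuspStrip hY fun z ↦ ‖modeFunction 𝕜 u z‖ ^ 2 * G z.im
  have hmeas' : MeasurableSet (Ici Y ×ˢ Ioc (-(1 / 2) : ℝ) (1 / 2)) :=
    measurableSet_Ici.prod measurableSet_Ioc
  have hcongr : ∀ x ∈ Ici Y ×ˢ Ioc (-(1 / 2) : ℝ) (1 / 2),
      (x.1 ^ 2)⁻¹ * (‖modeFunction 𝕜 u (ofComplex ((x.2 : ℂ) + (x.1 : ℂ) * Complex.I))‖ ^ 2 *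
        G (ofComplex ((x.2 : ℂ) + (x.1 : ℂ) * Complex.I)).im) =
      ((x.1 ^ 2)⁻¹ * (u x.1 ^ 2 * G x.1)) * Real.cos (2 * Real.pi * x.2) ^ 2 := by
    intro x hx
    have hx0 : 0 < x.1 := hY.trans_le hx.1
    have him : (ofComplex ((x.2 : ℂ) + (x.1 : ℂ) * Complex.I)).im = x.1 := by
      rw [ofComplex_apply_of_im_pos (by simpa using hx0)]
      simp [UpperHalfPlane.im]
    have hre : (ofComplex ((x.2 : ℂ) + (x.1 : ℂ) * Complex.I)).re = x.2 := by
      rw [ofComplex_apply_of_im_pos (by simpa using hx0)]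
      simp [UpperHalfPlane.re]
    rw [modeFunction, RCLike.norm_ofReal, sq_abs, him, hre]
    ring
  have hcos : ∫ θ in Ioc (-(1 / 2) : ℝ) (1 / 2), Real.cos (2 * Real.pi * θ) ^ 2 = 1 / 2 := by
    rw [← intervalIntegral.integral_of_le (by norm_num), integral_cos_two_pi_sq]
  constructor
  · rw [h1, setIntegral_congr_fun hmeas' hcongr, Measure.volume_eq_prod,
      setIntegral_prod_mul (fun y ↦ (y ^ 2)⁻¹ * (u y ^ 2 * G y))
        (fun θ ↦ Real.cos (2 * Real.pi * θ) ^ 2), hcos, integral_Ici_eq_integral_Ioi, mul_comm]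
  · intro hi
    have h3 := (integrableOn_congr_fun hcongr hmeas').mp (h2.mp hi)
    rw [IntegrableOn, Measure.volume_eq_prod, ← Measure.prod_restrict] at h3
    have h4 := h3.integral_prod_left
    simp only [integral_const_mul, hcos] at h4
    rw [← integrableOn_Ici_iff_integrableOn_Ioi]
    refine (h4.const_mul 2).congr (ae_of_all _ fun y ↦ ?_)
    simp only
    ring

/-- If the weight were too large at one height, continuity of `G` would keep a definite excess on an
interval to the right, which a Bessel mode of large eigenvalue rules out. The test function is real,
merely cast into `𝕜`, so both scalar fields are covered. -/
theorem sharpness_horocycle {A : ℝ} (hA : 0 < A) {α G : ℝ → ℝ} (hG : ContinuousOn G (Ici A))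
    (hw : ∀ Y y, A ≤ Y → Y ≤ y → Y * y⁻¹ ≤ α Y * G y)
    (H : ∀ (Y : ℝ) (hY : A ≤ Y) (lam : ℝ), 0 < lam → ∀ ψ : ℍ → 𝕜,
      IsCuspEigenfunction A lam ψ → IsZeroAtImInfty ψ →
        IntegrableOn (fun z => ‖ψ z‖ ^ 2 * G z.im) (cuspStrip Y) ∧
        2 * α Y * (∫ z in cuspStrip Y, ‖ψ z‖ ^ 2 * G z.im) ≤
          restrictedNorm (cuspRegion A) lam ψ (horocycle Y (hA.trans_le hY)) (-(1 / 2)) (1 / 2))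
    {Y y : ℝ} (hY : A ≤ Y) (hy : Y ≤ y) : α Y * G y = Y * y⁻¹ := by
  by_contra hne
  have hY0 := hA.trans_le hY
  have hpos : 0 < α Y * G y - Y * y⁻¹ := sub_pos.mpr ((hw Y y hY hy).lt_of_ne' hne)
  have hcont : ContinuousOn (fun s ↦ α Y * G s - Y * s⁻¹) (Ici y) :=
    (continuousOn_const.mul (hG.mono fun s hs ↦ (hY.trans hy).trans hs)).sub
      (continuousOn_const.mul (continuousOn_inv₀.mono fun s hs ↦
        ((hY0.trans_le hy).trans_le hs).ne'))
  have hev : ∀ᶠ s in 𝓝[≥] y, (α Y * G y - Y * y⁻¹) / 2 < α Y * G s - Y * s⁻¹ :=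
    (hcont y self_mem_Ici).eventually (lt_mem_nhds (half_lt_self hpos))
  obtain ⟨b, hyb, hb⟩ := mem_nhdsGE_iff_exists_Icc_subset.mp hev
  obtain ⟨L, hL⟩ := exists_eigenvalue_bound (2 * Real.pi) hY0 hy hyb (half_pos hpos)
  -- Order `t = √|L|` gives the eigenvalue `1/4 + |L|`, which is positive and at least `L`.
  have hmode := isDecayingMode_bessel (√|L|) (mul_pos two_pos Real.pi_pos)
  rw [Real.sq_sqrt (abs_nonneg L)] at hmode
  have hlam : 0 < 1 / 4 + |L| := by positivity
  obtain ⟨hi, hle⟩ := H Y hY _ hlam _ (hmode.isCuspEigenfunction 𝕜 hA) (hmode.isZeroAtImInfty 𝕜)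
  obtain ⟨h1, h2⟩ := setIntegral_modeFunction 𝕜
    (u := fun y ↦ √y * besselMoment (√|L|) 0 (2 * Real.pi * y)) hY0 G
  rw [h1, hmode.restrictedNorm_modeFunction 𝕜 hA hY] at hle
  have h3 := hmode.weighted_mass_le hlam hY0 hy hyb (h2 hi) (by linarith)
    (fun s hs ↦ hw Y s hY hs) (fun s hs ↦ le_of_lt (hb hs))
  have h4 := hL _ hlam (by linarith [le_abs_self L]) _ _ hmode
  exact absurd h4 (not_lt.mpr h3)

end CuspMode

end HypRestriction

end

theorem theorem1p2 {𝕜 : Type*} [RCLike 𝕜] :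
    -- hyperbolic circles
    (∀ (w : ℍ) (R : ℝ), 0 < R → ∀ (lam : ℝ), 0 < lam → ∀ ψ : ℍ → 𝕜,
      HypRestriction.IsEigenfunctionOn (Metric.closedBall w R) lam ψ →
        IntegrableOn (fun z => Real.cosh (dist z w) * ‖ψ z‖ ^ 2) (Metric.closedBall w R) ∧
        2 / Real.sinh R * (∫ z in Metric.closedBall w R, Real.cosh (dist z w) * ‖ψ z‖ ^ 2) ≤
          HypRestriction.restrictedNorm (Metric.closedBall w R) lam ψ
            (HypRestriction.polar w R) 0 (2 * Real.pi)) ∧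
    -- closed horocycles
    (∀ (A : ℝ) (hA : 0 < A) (Y : ℝ) (hY : A ≤ Y) (lam : ℝ), 0 < lam → ∀ ψ : ℍ → 𝕜,
      HypRestriction.IsCuspEigenfunction A lam ψ →
        IntegrableOn (fun z => ‖ψ z‖ ^ 2 * z.im⁻¹) (HypRestriction.cuspStrip Y) ∧
        2 * Y * (∫ z in HypRestriction.cuspStrip Y, ‖ψ z‖ ^ 2 * z.im⁻¹) ≤
          HypRestriction.restrictedNorm (HypRestriction.cuspRegion A) lam ψ
            (HypRestriction.horocycle Y (hA.trans_le hY)) (-(1 / 2)) (1 / 2)) ∧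
    -- sharpness of the weight for closed horocycles
    (∀ (A : ℝ) (hA : 0 < A) (α G : ℝ → ℝ),
      ContDiffOn ℝ ∞ α (Set.Ici A) → ContDiffOn ℝ ∞ G (Set.Ici A) →
      (∀ y, A ≤ y → 0 < α y) → (∀ y, A ≤ y → 0 < G y) →
      (∀ Y y, A ≤ Y → Y ≤ y → Y * y⁻¹ ≤ α Y * G y) →
      (∀ (Y : ℝ) (hY : A ≤ Y) (lam : ℝ), 0 < lam → ∀ ψ : ℍ → 𝕜,
        HypRestriction.IsCuspEigenfunction A lam ψ → IsZeroAtImInfty ψ →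
          IntegrableOn (fun z => ‖ψ z‖ ^ 2 * G z.im) (HypRestriction.cuspStrip Y) ∧
          2 * α Y * (∫ z in HypRestriction.cuspStrip Y, ‖ψ z‖ ^ 2 * G z.im) ≤
            HypRestriction.restrictedNorm (HypRestriction.cuspRegion A) lam ψ
              (HypRestriction.horocycle Y (hA.trans_le hY)) (-(1 / 2)) (1 / 2)) →
      ∀ Y y, A ≤ Y → Y ≤ y → α Y * G y = Y * y⁻¹) := by
  refine ⟨fun w R hR lam hlam ψ hψ ↦ HypRestriction.restriction_circle w hR hlam hψ,
    fun A hA Y hY lam hlam ψ hψ ↦ HypRestriction.restriction_horocycle hA hY hlam hψ,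
    fun A hA α G _ hG _ _ hw H Y y hY hy ↦
      HypRestriction.sharpness_horocycle 𝕜 hA hG.continuousOn hw H hY hy⟩
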